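/- Let $\operatorname{Bir}_e(\mathbb P^2,\pm\Omega)$ be the subgroup of the group of birational transformations of $\mathbb P^2$ generated by $E:(x,y)\mapsto (x,\,y(x+1)^{-1})$ and by the monomial maps $(x,y)\mapsto (x^ay^c,x^by^d)$, $\begin{pmatrix}a&b\\c&d\end{pmatrix}\in \mathrm{GL}_2(\mathbb Z)$. (All of these preserve $\Omega=d\log x\wedge d\log y$ up to sign.) Let $\operatorname{CY2}$ be the set of log Calabi–Yau surfaces with explicit toric model: an element $\xi$ consists of a complete smooth fan in $\mathbb Z^2$ and an integer $m_{\mathbf n}\ge 0$ for each of its rays (with primitive generator $\mathbf n$). The surface $Y_\xi$ is obtained from the toric surface $\bar Y_\xi$ of the fan by blowing up, for each ray $\mathbf n=(n_1,n_2)$, $m_{\mathbf n}$ times the distinguished point of the boundary component $\bar D_{\mathbf n}$ (the point of its interior at which $x^{n_2}y^{-n_1}=-1$), each time at the corresponding point of the strict transform of $\bar D_{\mathbf n}$. Let $D_\xi\subset Y_\xi$ be the strict transform of the toric boundary, $U_\xi=Y_\xi\setminus D_\xi$, and $\iota_\xi:(\mathbb C^*)^2\hookrightarrow U_\xi$ the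 embedding of the torus. Write $\eta>\xi$ if $\eta$ is obtained from $\xi$ by a non-empty finite sequence of steps, each of which is either a corner blow-up (the star subdivision of a two-dimensional cone $\langle \mathbf n,\mathbf n'\rangle$ by the ray $\mathbf n+\mathbf n'$, with $m_{\mathbf n+\mathbf n'}=0$) or an interior blow-up (some $m_{\mathbf n}$ is increased by $1$); then there is a blow-down map $p_{\eta,\xi}:Y_\eta\to Y_\xi$, the holomorphic map with $p_{\eta,\xi}\circ\iota_\eta=\iota_\xi$. A birational transformation $\phi$ of $\mathbb P^2$ defines a map $f:Y_\xi\to Y_{\xi'}$ if $f(\iota_\xi(t))=\iota_{\xi'}(\phi(t))$ for all $t\in(\mathbb C^*)^2$ at which $\phi$ is regular with $\phi(t)\in(\mathbb C^*)^2$. **Proposition.** Let $\xi,\xi'\in\operatorname{CY2}$ (one writes $\xi'=\phi_*\xi$), and suppose that $\phi\in\operatorname{Bir}_e(\mathbb P^2,\pm\Omega)$ defines a biholomorphism $\phi:Y_\xi\to Y_{\xi'}$. Then $\phi$ restricts to biholomorphisms $U_\xi\to U_{\xi'}$ and $D_\xi\to D_{\xi'}$. Moreover, for every $\eta\in\operatorname{CY2}$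 with $\eta>\xi$ there is $\eta'\in\operatorname{CY2}$ (one writes $\eta'=\phi_*\eta$) with $\eta'>\xi'$ such that $\phi$ defines a biholomorphism $Y_\eta\to Y_{\eta'}$, and the blow-down maps satisfy $p_{\eta',\xi'}\circ\phi=\phi\circ p_{\eta,\xi}$ on $Y_\eta$. -/

import Mathlib

open Set Topology
open scoped Manifold ContDiff

noncomputable section

/-! ## Gluing complex surfaces from charts birational to the torus -/

/-- The complex torus `(ℂ^*)²`, as a subset of `ℂ²`. -/
def torus : Set (ℂ × ℂ) := {t | t.1 ≠ 0 ∧ t.2 ≠ 0}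

theorem isOpen_torus : IsOpen torus :=
  (isOpen_ne_fun continuous_fst continuous_const).inter
    (isOpen_ne_fun continuous_snd continuous_const)

theorem dense_torus : Dense torus := by
  have h : torus = ({0}ᶜ : Set ℂ) ×ˢ ({0}ᶜ : Set ℂ) := by
    ext t; simp [torus]
  rw [h]
  exact (dense_compl_singleton 0).prod (dense_compl_singleton 0)

/-- A family of charts `dom i ⊆ ℂ²`, each of which comes with an (injective, densely defined)
identification `par i` of the set `{p ∈ dom i | par i p ∈ torus}` with a part of the torus.
The torus itself is one of the charts. -/
structure TorusAtlas where
  Index : Type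
  dom : Index → Set (ℂ × ℂ)
  par : Index → ℂ × ℂ → ℂ × ℂ
  isOpen_dom : ∀ i, IsOpen (dom i)
  dom_subset_closure : ∀ i, dom i ⊆ closure {p | p ∈ dom i ∧ par i p ∈ torus}
  injOn_par : ∀ i, InjOn (par i) {p | p ∈ dom i ∧ par i p ∈ torus}
  torusIndex : Index
  dom_torusIndex : dom torusIndex = torus
  par_torusIndex : par torusIndex = id

namespace TorusAtlas

variable (A : TorusAtlas)

/-- The disjoint union of the charts. -/
abbrev Pre : Type := Σ i : A.Index, A.dom i

/-- A point `p` of one chart is glued to a point `q` of another one if and only if some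
biholomorphism `g` from a neighbourhood of `p` to a neighbourhood of `q`, taking `p` to `q`,
is compatible with the identifications of the two charts with the torus. So the charts are glued
along the largest possible open subsets. -/
def Glue (P Q : A.Pre) : Prop :=
  ∃ g : OpenPartialHomeomorph (ℂ × ℂ) (ℂ × ℂ),
    (P.2 : ℂ × ℂ) ∈ g.source ∧ g P.2 = Q.2 ∧
    g.source ⊆ A.dom P.1 ∧ g.target ⊆ A.dom Q.1 ∧
    ContDiffOn ℂ ω g g.source ∧ ContDiffOn ℂ ω g.symm g.target ∧
    (∀ z ∈ g.source, A.par P.1 z ∈ torus → A.par Q.1 (g z) = A.par P.1 z) ∧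
    (∀ z ∈ g.target, A.par Q.1 z ∈ torus → A.par P.1 (g.symm z) = A.par Q.1 z)

theorem glue_refl (P : A.Pre) : A.Glue P P :=
  ⟨OpenPartialHomeomorph.ofSet (A.dom P.1) (A.isOpen_dom P.1), P.2.2, rfl,
    subset_rfl, subset_rfl, contDiffOn_id, contDiffOn_id,
    fun _ _ _ => rfl, fun _ _ _ => rfl⟩

theorem glue_symm {P Q : A.Pre} (h : A.Glue P Q) : A.Glue Q P := by
  obtain ⟨g, hp, hpq, hs, ht, hd, hd', hc, hc'⟩ := h
  refine ⟨g.symm, ?_, ?_, ht, hs, hd', ?_, hc', ?_⟩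
  · rw [← hpq]; exact g.map_source hp
  · rw [← hpq]; exact g.left_inv hp
  · simpa using hd
  · simpa using hc

theorem glue_trans {P Q R : A.Pre} (h : A.Glue P Q) (h' : A.Glue Q R) : A.Glue P R := by
  obtain ⟨g, gp, gpq, gs, gt, gd, gd', gc, gc'⟩ := h
  obtain ⟨k, kp, kpq, ks, kt, kd, kd', kc, kc'⟩ := h'
  refine ⟨g.trans k, ?_, ?_, ?_, ?_, ?_, ?_, ?_, ?_⟩
  · rw [OpenPartialHomeomorph.trans_source]
    exact ⟨gp, by simpa [gpq] using kp⟩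
  · simp [gpq, kpq]
  · rw [OpenPartialHomeomorph.trans_source]
    exact fun z hz => gs hz.1
  · rw [OpenPartialHomeomorph.trans_target]
    exact fun z hz => kt hz.1
  · rw [OpenPartialHomeomorph.trans_source]
    exact kd.comp (gd.mono fun z hz => hz.1) fun z hz => hz.2
  · rw [OpenPartialHomeomorph.trans_target]
    exact gd'.comp (kd'.mono fun z hz => hz.1) fun z hz => hz.2
  · intro z hz hzt
    rw [OpenPartialHomeomorph.trans_source] at hz
    have h1 := gc z hz.1 hzt
    have h2 := kc (g z) hz.2 (by rw [h1]; exact hzt)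
    exact h2.trans h1
  · intro z hz hzt
    rw [OpenPartialHomeomorph.trans_target] at hz
    have h1 := kc' z hz.1 hzt
    have h2 := gc' (k.symm z) hz.2 (by rw [h1]; exact hzt)
    exact h2.trans h1

/-- Gluing as an equivalence relation. -/
def setoid : Setoid A.Pre where
  r := A.Glue
  iseqv := ⟨A.glue_refl, A.glue_symm, A.glue_trans⟩

/-- The complex surface obtained by gluing the charts. -/
def Space : Type := Quotient A.setoid

variable {A}

/-- The point of the glued surface with coordinates `p` in the chart `i`. -/
def pt (i : A.Index) (p : ℂ × ℂ) (hp : p ∈ A.dom i) : A.Space :=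
  Quotient.mk A.setoid ⟨i, p, hp⟩

theorem pt_eq_iff {i j : A.Index} {p q : ℂ × ℂ} {hp : p ∈ A.dom i} {hq : q ∈ A.dom j} :
    pt i p hp = pt j q hq ↔ A.Glue ⟨i, p, hp⟩ ⟨j, q, hq⟩ :=
  Quotient.eq (r := A.setoid)

theorem exists_pt (y : A.Space) : ∃ i p, ∃ hp : p ∈ A.dom i, pt i p hp = y := by
  induction y using Quotient.inductionOn with
  | h a => exact ⟨a.1, a.2.1, a.2.2, rfl⟩

theorem pt_injective {i : A.Index} {p q : ℂ × ℂ} {hp : p ∈ A.dom i} {hq : q ∈ A.dom i}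
    (h : pt i p hp = pt i q hq) : p = q := by
  obtain ⟨g, gp, gpq, gs, gt, -, -, gc, -⟩ := pt_eq_iff.1 h
  simp only at gp gpq gs gt gc
  set r : Set (ℂ × ℂ) := {p | p ∈ A.dom i ∧ A.par i p ∈ torus} with hr
  have hcl : p ∈ closure (g.source ∩ r) :=
    g.open_source.inter_closure ⟨gp, A.dom_subset_closure i hp⟩
  have hcont : ContinuousAt g p := g.continuousAt gp
  have heq : ∀ z ∈ g.source ∩ r, g z = z := by
    rintro z ⟨hz, hzr⟩
    have h1 := gc z hz hzr.2
    refine A.injOn_par i ⟨gt (g.map_source hz), ?_⟩ hzr h1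
    rw [h1]; exact hzr.2
  have hne : (𝓝[g.source ∩ r] p).NeBot := mem_closure_iff_nhdsWithin_neBot.1 hcl
  have t1 : Filter.Tendsto g (𝓝[g.source ∩ r] p) (𝓝 (g p)) :=
    hcont.tendsto.mono_left nhdsWithin_le_nhds
  have t2 : Filter.Tendsto g (𝓝[g.source ∩ r] p) (𝓝 p) :=
    Filter.Tendsto.congr' (f₁ := id)
      (by filter_upwards [self_mem_nhdsWithin] with z hz using (heq z hz).symm)
      (Filter.tendsto_id.mono_left nhdsWithin_le_nhds)
  rw [← gpq]
  exact tendsto_nhds_unique t2 t1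

theorem one_mem_dom_torusIndex : ((1, 1) : ℂ × ℂ) ∈ A.dom A.torusIndex := by
  rw [A.dom_torusIndex]; simp [torus]

open Classical in
/-- The chart `i`, as a partial bijection between the glued surface and `ℂ²`. -/
def chart (i : A.Index) : PartialEquiv A.Space (ℂ × ℂ) where
  toFun y := if h : ∃ p, ∃ hp : p ∈ A.dom i, pt i p hp = y then h.choose else 0
  invFun p := if hp : p ∈ A.dom i then pt i p hp else pt A.torusIndex (1, 1) one_mem_dom_torusIndex
  source := {y | ∃ p, ∃ hp : p ∈ A.dom i, pt i p hp = y}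
  target := A.dom i
  map_source' y h := by
    have h' : ∃ p, ∃ hp : p ∈ A.dom i, pt i p hp = y := h
    rw [dif_pos h']; exact h'.choose_spec.choose
  map_target' p hp := by
    rw [dif_pos hp]; exact ⟨p, hp, rfl⟩
  left_inv' y h := by
    have h' : ∃ p, ∃ hp : p ∈ A.dom i, pt i p hp = y := h
    rw [dif_pos h', dif_pos h'.choose_spec.choose]
    exact h'.choose_spec.choose_spec
  right_inv' p hp := by
    have h' : ∃ q, ∃ hq : q ∈ A.dom i, pt i q hq = pt i p hp := ⟨p, hp, rfl⟩
    rw [dif_pos hp, dif_pos h']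
    exact pt_injective h'.choose_spec.choose_spec

theorem chart_target (i : A.Index) : (chart i).target = A.dom i := rfl

theorem chart_symm_apply {i : A.Index} {p : ℂ × ℂ} (hp : p ∈ A.dom i) :
    (chart i).symm p = pt i p hp :=
  dif_pos hp

theorem chart_pt {i : A.Index} {p : ℂ × ℂ} (hp : p ∈ A.dom i) :
    chart i (pt i p hp) = p := by
  rw [← chart_symm_apply hp]; exact (chart i).right_inv hp

theorem exists_local_transition {i j : A.Index} {p : ℂ × ℂ}
    (hp : p ∈ ((chart i).symm.trans (chart j)).source) :
    ∃ s, IsOpen s ∧ p ∈ s ∧ s ⊆ ((chart i).symm.trans (chart j)).source ∧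
      ContDiffOn ℂ ω ((chart i).symm.trans (chart j)) s := by
  have hpi : p ∈ (chart i).target := hp.1
  rw [chart_target] at hpi
  obtain ⟨q, hq, hqp⟩ : ∃ q, ∃ hq : q ∈ A.dom j, pt j q hq = (chart i).symm p := hp.2
  rw [chart_symm_apply hpi] at hqp
  obtain ⟨g, gp, gpq, gs, gt, gd, gd', gc, gc'⟩ := pt_eq_iff.1 hqp.symm
  have key : ∀ z (hz : z ∈ g.source), pt i z (gs hz) = pt j (g z) (gt (g.map_source hz)) :=
    fun z hz => pt_eq_iff.2 ⟨g, hz, rfl, gs, gt, gd, gd', gc, gc'⟩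
  refine ⟨g.source, g.open_source, gp, fun z hz => ⟨gs hz, ?_⟩, gd.congr fun z hz => ?_⟩
  · change (chart i).symm z ∈ (chart j).source
    rw [chart_symm_apply (gs hz), key z hz]
    exact ⟨_, _, rfl⟩
  · rw [PartialEquiv.coe_trans, Function.comp_apply, chart_symm_apply (gs hz), key z hz, chart_pt]

variable (A) in
/-- The charts form an atlas. -/
def core : ChartedSpaceCore (ℂ × ℂ) A.Space where
  atlas := range chart
  chartAt y := chart (exists_pt y).choose
  mem_chart_source y := by
    obtain ⟨p, hp, h⟩ := (exists_pt y).choose_spec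
    exact ⟨p, hp, h⟩
  chart_mem_atlas y := mem_range_self _
  open_source := by
    rintro _ _ ⟨i, rfl⟩ ⟨j, rfl⟩
    rw [isOpen_iff_mem_nhds]
    intro p hp
    obtain ⟨s, hs, hps, hsub, -⟩ := exists_local_transition hp
    exact Filter.mem_of_superset (hs.mem_nhds hps) hsub
  continuousOn_toFun := by
    rintro _ _ ⟨i, rfl⟩ ⟨j, rfl⟩ p hp
    obtain ⟨s, hs, hps, -, hd⟩ := exists_local_transition hp
    exact (hd.continuousOn.continuousAt (hs.mem_nhds hps)).continuousWithinAt

instance : TopologicalSpace A.Space := A.core.toTopologicalSpace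

instance : ChartedSpace (ℂ × ℂ) A.Space := A.core.toChartedSpace

instance : IsManifold 𝓘(ℂ, ℂ × ℂ) ω A.Space := by
  apply isManifold_of_contDiffOn
  intro e e' he he'
  obtain ⟨_, ⟨i, rfl⟩, hei⟩ : ∃ c, ∃ h : c ∈ A.core.atlas,
      e ∈ ({A.core.openPartialHomeomorph c h} : Set _) := by
    obtain ⟨c, hc⟩ := mem_iUnion.1 he
    exact ⟨c, mem_iUnion.1 hc⟩
  obtain ⟨_, ⟨j, rfl⟩, hej⟩ : ∃ c, ∃ h : c ∈ A.core.atlas,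
      e' ∈ ({A.core.openPartialHomeomorph c h} : Set _) := by
    obtain ⟨c, hc⟩ := mem_iUnion.1 he'
    exact ⟨c, mem_iUnion.1 hc⟩
  rw [mem_singleton_iff] at hei hej
  subst hei hej
  intro p hp
  obtain ⟨s, hs, hps, -, hd⟩ := exists_local_transition (i := i) (j := j) (p := p) hp.1
  exact (hd.contDiffAt (hs.mem_nhds hps)).contDiffWithinAt

variable (A) in
/-- The canonical embedding of the torus in the glued surface. -/
def emb (t : torus) : A.Space :=
  pt A.torusIndex t (by rw [A.dom_torusIndex]; exact t.2)

end TorusAtlas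

/-! ## Log Calabi-Yau surfaces with explicit toric models -/

/-- The determinant of a pair of vectors of `ℤ²`. -/
def det2 (v w : ℤ × ℤ) : ℤ := v.1 * w.2 - v.2 * w.1

/-- A complete smooth fan in `ℤ²`, given by its two-dimensional cones. A two-dimensional cone is
recorded by the primitive generators `(n, n')` of its two rays, in counterclockwise order. -/
structure SmoothCompleteFan where
  cones : Finset ((ℤ × ℤ) × (ℤ × ℤ))
  smooth : ∀ σ ∈ cones, det2 σ.1 σ.2 = 1
  /-- Every lattice vector lies in some cone. -/
  complete : ∀ v : ℤ × ℤ, ∃ σ ∈ cones, ∃ a b : ℕ, v = a • σ.1 + b • σ.2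
  /-- No interior vector of a two-dimensional cone lies in another two-dimensional cone. -/
  eq_of_interior : ∀ σ ∈ cones, ∀ τ ∈ cones, ∀ a b c d : ℕ, 0 < a → 0 < b →
    a • σ.1 + b • σ.2 = c • τ.1 + d • τ.2 → σ = τ

/-- The primitive generators of the rays of a fan. -/
def SmoothCompleteFan.rays (F : SmoothCompleteFan) : Finset (ℤ × ℤ) :=
  F.cones.image Prod.fst ∪ F.cones.image Prod.snd

/-- A log Calabi-Yau surface with an explicit toric model: a complete smooth fan with a
non-negative integer for each ray, the number of interior blow-ups on the corresponding
component of the toric boundary (extended by zero to all of `ℤ²`). -/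
structure CY2 extends SmoothCompleteFan where
  m : ℤ × ℤ → ℕ
  m_eq_zero : ∀ n, n ∉ toSmoothCompleteFan.rays → m n = 0

/-- The toric coordinates `(a, b)` of the cone spanned by `n` and `n'`:
the map `(a, b) ↦ a ^ n * b ^ n'`. The boundary component of the ray `n` is `a = 0`, that of the
ray `n'` is `b = 0`. -/
def monomialMap (σ : (ℤ × ℤ) × (ℤ × ℤ)) (p : ℂ × ℂ) : ℂ × ℂ :=
  (p.1 ^ σ.1.1 * p.2 ^ σ.2.1, p.1 ^ σ.1.2 * p.2 ^ σ.2.2)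

/-- Coordinates `(s, v)` centred at the distinguished point `(a, b) = (0, -1)` of the boundary
component `a = 0`, which becomes `v = 0`. -/
def centre (p : ℂ × ℂ) : ℂ × ℂ := (p.2, p.1 - 1)

/-- The chart of the blow-up of the origin which does not meet the strict transform of the second
axis `s = 0`: the exceptional curve is `s = 0` and the strict transform of `v = 0` is `w = 0`. -/
def blowUpStrict (p : ℂ × ℂ) : ℂ × ℂ := (p.1, p.1 * p.2)

/-- The other chart of the blow-up of the origin, which does not meet the strict transform
of `v = 0`. -/
def blowUpExc (p : ℂ × ℂ) : ℂ × ℂ := (p.1 * p.2, p.2)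

/-- The index set of the charts of the surface given by `ξ`. -/
inductive CY2.ChartIndex (ξ : CY2) : Type
  /-- the torus -/
  | torus
  /-- the affine plane of a cone, without the distinguished points of its two axes -/
  | cone (σ : (ℤ × ℤ) × (ℤ × ℤ)) (hσ : σ ∈ ξ.cones)
  /-- for a cone `σ` with first ray `n`, the chart around the strict transform of the interior of
  the boundary component of `n`, after all `m n` blow-ups -/
  | strict (σ : (ℤ × ℤ) × (ℤ × ℤ)) (hσ : σ ∈ ξ.cones)
  /-- for a cone `σ` with first ray `n`, the chart around the exceptional curve of the blow-up
  number `j` at the distinguished point of the boundary component of `n`, away from the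
  strict transform of that boundary component -/
  | exc (σ : (ℤ × ℤ) × (ℤ × ℤ)) (hσ : σ ∈ ξ.cones) (j : Fin (ξ.m σ.1))

/-- The identification of (part of) each chart with the torus: the distinguished point on the
boundary component of `n` is blown up `m n` times, each time at the point of the strict transform
of that component. -/
def CY2.chartPar (ξ : CY2) : ξ.ChartIndex → ℂ × ℂ → ℂ × ℂ
  | .torus => id
  | .cone σ _ => monomialMap σ
  | .strict σ _ => monomialMap σ ∘ centre ∘ blowUpStrict^[ξ.m σ.1]
  | .exc σ _ j => monomialMap σ ∘ centre ∘ blowUpStrict^[(j : ℕ)] ∘ blowUpExc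

/-- The domains of the charts. In the charts near a boundary component, the first coordinate `s`
of the blown-down point is kept different from `1`, where `b = s - 1` vanishes. -/
def CY2.chartDom (ξ : CY2) : ξ.ChartIndex → Set (ℂ × ℂ)
  | .torus => torus
  | .cone _ _ => {(0, -1), (-1, 0)}ᶜ
  | .strict _ _ => {p | p.1 ≠ 1}
  | .exc _ _ _ => {p | p.1 * p.2 ≠ 1}

theorem blowUpStrict_iterate (k : ℕ) (p : ℂ × ℂ) :
    blowUpStrict^[k] p = (p.1, p.1 ^ k * p.2) := by
  induction k with
  | zero => simp
  | succ k ih =>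
    rw [Function.iterate_succ_apply', ih, blowUpStrict]
    ext <;> simp [pow_succ', mul_assoc]

theorem monomialMap_mem_torus {σ : (ℤ × ℤ) × (ℤ × ℤ)} {p : ℂ × ℂ} (hp : p ∈ torus) :
    monomialMap σ p ∈ torus :=
  ⟨mul_ne_zero (zpow_ne_zero _ hp.1) (zpow_ne_zero _ hp.2),
    mul_ne_zero (zpow_ne_zero _ hp.1) (zpow_ne_zero _ hp.2)⟩

theorem mem_torus_of_monomialMap {σ : (ℤ × ℤ) × (ℤ × ℤ)} (hσ : det2 σ.1 σ.2 = 1) {p : ℂ × ℂ}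
    (hp : monomialMap σ p ∈ torus) : p ∈ torus := by
  obtain ⟨⟨a, b⟩, c, d⟩ := σ
  obtain ⟨x, y⟩ := p
  simp only [torus, monomialMap, det2, mem_ofPred_eq, ne_eq, mul_eq_zero, not_or] at hp hσ ⊢
  obtain ⟨⟨h1, h2⟩, h3, h4⟩ := hp
  constructor
  · rintro rfl
    have ha : a = 0 := by
      by_contra h
      exact h1 (zero_zpow a h)
    have hb : b = 0 := by
      by_contra h
      exact h3 (zero_zpow b h)
    simp [ha, hb] at hσ
  · rintro rfl
    have hc : c = 0 := by
      by_contra h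
      exact h2 (zero_zpow c h)
    have hd : d = 0 := by
      by_contra h
      exact h4 (zero_zpow d h)
    simp [hc, hd] at hσ

theorem monomialMap_injOn {σ : (ℤ × ℤ) × (ℤ × ℤ)} (hσ : det2 σ.1 σ.2 = 1) :
    InjOn (monomialMap σ) torus := by
  obtain ⟨⟨a, b⟩, c, d⟩ := σ
  rintro ⟨x, y⟩ ⟨hx, hy⟩ ⟨x', y'⟩ ⟨hx', hy'⟩ h
  simp only [monomialMap, det2, Prod.mk.injEq] at h hσ hx hy hx' hy' ⊢
  obtain ⟨h1, h2⟩ := h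
  have key : ∀ u v : ℂ, u ≠ 0 → v ≠ 0 →
      u = (u ^ a * v ^ c) ^ d * (u ^ b * v ^ d) ^ (-c) ∧
      v = (u ^ a * v ^ c) ^ (-b) * (u ^ b * v ^ d) ^ a := by
    intro u v hu hv
    constructor
    · rw [mul_zpow, mul_zpow, ← zpow_mul, ← zpow_mul, ← zpow_mul, ← zpow_mul,
        mul_mul_mul_comm, ← zpow_add₀ hu, ← zpow_add₀ hv,
        show a * d + b * -c = 1 by linarith, show c * d + d * -c = 0 by ring]
      simp
    · rw [mul_zpow, mul_zpow, ← zpow_mul, ← zpow_mul, ← zpow_mul, ← zpow_mul,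
        mul_mul_mul_comm, ← zpow_add₀ hu, ← zpow_add₀ hv,
        show a * -b + b * a = 0 by ring, show c * -b + d * a = 1 by linarith]
      simp
  constructor
  · rw [(key x y hx hy).1, (key x' y' hx' hy').1, h1, h2]
  · rw [(key x y hx hy).2, (key x' y' hx' hy').2, h1, h2]

theorem centre_injective : Function.Injective centre := by
  rintro ⟨x, y⟩ ⟨x', y'⟩ h
  simp only [centre, Prod.mk.injEq] at h ⊢
  exact ⟨sub_left_injective h.2, h.1⟩

theorem CY2.isOpen_chartDom (ξ : CY2) (i : ξ.ChartIndex) : IsOpen (ξ.chartDom i) := by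
  cases i with
  | torus => exact isOpen_torus
  | cone σ hσ => exact (Set.toFinite _).isClosed.isOpen_compl
  | strict σ hσ => exact isOpen_ne_fun continuous_fst continuous_const
  | exc σ hσ j => exact isOpen_ne_fun (continuous_fst.mul continuous_snd) continuous_const

theorem CY2.chartPar_mem_torus (ξ : CY2) (i : ξ.ChartIndex) {p : ℂ × ℂ}
    (hp : p ∈ ξ.chartDom i) (hp' : p ∈ _root_.torus) : ξ.chartPar i p ∈ _root_.torus := by
  cases i with
  | torus => exact hp
  | cone σ hσ => exact monomialMap_mem_torus hp'
  | strict σ hσ =>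
    refine monomialMap_mem_torus ?_
    simp only [Function.comp_apply, blowUpStrict_iterate, centre]
    exact ⟨mul_ne_zero (pow_ne_zero _ hp'.1) hp'.2, sub_ne_zero.2 hp⟩
  | exc σ hσ j =>
    refine monomialMap_mem_torus ?_
    simp only [Function.comp_apply, blowUpStrict_iterate, blowUpExc, centre]
    exact ⟨mul_ne_zero (pow_ne_zero _ (mul_ne_zero hp'.1 hp'.2)) hp'.2, sub_ne_zero.2 hp⟩

theorem CY2.injOn_chartPar (ξ : CY2) (i : ξ.ChartIndex) :
    InjOn (ξ.chartPar i) {p | p ∈ ξ.chartDom i ∧ ξ.chartPar i p ∈ _root_.torus} := by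
  cases i with
  | torus => exact injOn_id _
  | cone σ hσ =>
    rintro p ⟨-, hp⟩ q ⟨-, hq⟩ h
    exact monomialMap_injOn (ξ.smooth σ hσ) (mem_torus_of_monomialMap (ξ.smooth σ hσ) hp)
      (mem_torus_of_monomialMap (ξ.smooth σ hσ) hq) h
  | strict σ hσ =>
    rintro ⟨s, w⟩ ⟨-, hp⟩ ⟨s', w'⟩ ⟨-, hq⟩ h
    have hp' := mem_torus_of_monomialMap (ξ.smooth σ hσ) hp
    have hq' := mem_torus_of_monomialMap (ξ.smooth σ hσ) hq
    have h' := centre_injective (monomialMap_injOn (ξ.smooth σ hσ) hp' hq' h)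
    simp only [Function.comp_apply, blowUpStrict_iterate, centre, torus, mem_ofPred_eq,
      Prod.mk.injEq] at h' hp'
    obtain ⟨rfl, h'⟩ := h'
    rw [mul_right_inj' (left_ne_zero_of_mul hp'.1)] at h'
    rw [h']
  | exc σ hσ j =>
    rintro ⟨s, w⟩ ⟨-, hp⟩ ⟨s', w'⟩ ⟨-, hq⟩ h
    have hp' := mem_torus_of_monomialMap (ξ.smooth σ hσ) hp
    have hq' := mem_torus_of_monomialMap (ξ.smooth σ hσ) hq
    have h' := centre_injective (monomialMap_injOn (ξ.smooth σ hσ) hp' hq' h)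
    simp only [Function.comp_apply, blowUpStrict_iterate, blowUpExc, centre, torus, mem_ofPred_eq,
      Prod.mk.injEq] at h' hp'
    obtain ⟨h1, h2⟩ := h'
    rw [h1] at h2 hp'
    rw [mul_right_inj' (left_ne_zero_of_mul hp'.1)] at h2
    subst h2
    rw [mul_left_inj' (right_ne_zero_of_mul hp'.1)] at h1
    rw [h1]

/-- The charts of the surface given by `ξ`. -/
def CY2.atlas (ξ : CY2) : TorusAtlas where
  Index := ξ.ChartIndex
  dom := ξ.chartDom
  par := ξ.chartPar
  isOpen_dom := ξ.isOpen_chartDom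
  dom_subset_closure i :=
    (dense_torus.open_subset_closure_inter (ξ.isOpen_chartDom i)).trans
      (closure_mono fun _ hp => ⟨hp.1, ξ.chartPar_mem_torus i hp.1 hp.2⟩)
  injOn_par := ξ.injOn_chartPar
  torusIndex := .torus
  dom_torusIndex := rfl
  par_torusIndex := rfl

/-- The compact complex surface `Y_ξ`. -/
abbrev CY2.Y (ξ : CY2) : Type := ξ.atlas.Space

/-- The embedding of the torus in `Y_ξ`. -/
abbrev CY2.emb (ξ : CY2) : torus → ξ.Y := ξ.atlas.emb

/-- The boundary divisor `D_ξ` of `Y_ξ`, as a set: the strict transform of the toric boundary,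
that is, the closure of the toric boundary without the distinguished points. -/
def CY2.D (ξ : CY2) : Set ξ.Y :=
  closure {y | ∃ σ, ∃ hσ : σ ∈ ξ.cones, ∃ p, ∃ hp : p ∈ ξ.chartDom (.cone σ hσ),
    p.1 * p.2 = 0 ∧ y = TorusAtlas.pt (A := ξ.atlas) (.cone σ hσ) p hp}

/-- The interior `U_ξ`, the complement of `D_ξ`. -/
def CY2.U (ξ : CY2) : TopologicalSpace.Opens ξ.Y := ⟨ξ.Dᶜ, isClosed_closure.isOpen_compl⟩

/-- `ξ.BlowUpStep η` if `Y_η` is obtained from `Y_ξ` by a single blow-up: of the distinguished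
interior point of a boundary component, or of a corner, that is, by the star subdivision of
a cone. -/
inductive CY2.BlowUpStep (ξ η : CY2) : Prop
  | interior (n : ℤ × ℤ) (hn : n ∈ ξ.rays) (hcones : η.cones = ξ.cones)
      (hm : η.m = Function.update ξ.m n (ξ.m n + 1))
  | corner (σ : (ℤ × ℤ) × (ℤ × ℤ)) (hσ : σ ∈ ξ.cones)
      (hcones : η.cones =
        insert (σ.1, σ.1 + σ.2) (insert (σ.1 + σ.2, σ.2) (ξ.cones.erase σ)))
      (hm : η.m = ξ.m)

/-- The blow-up order: `ξ < η` if `Y_η` is obtained from `Y_ξ` by a non-empty finite sequence of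
corner and interior blow-ups. -/
instance : LT CY2 := ⟨Relation.TransGen CY2.BlowUpStep⟩

/-- The blow-down map `p : Y_η → Y_ξ`: the (unique) holomorphic map which restricts to the
identity on the torus. -/
def CY2.IsBlowDown {η ξ : CY2} (p : η.Y → ξ.Y) : Prop :=
  ContMDiff 𝓘(ℂ, ℂ × ℂ) 𝓘(ℂ, ℂ × ℂ) ω p ∧ ∀ t, p (η.emb t) = ξ.emb t

/-- A map between subsets of complex manifolds (in particular, between reduced analytic subsets)
is holomorphic if it is, locally, the restriction of a holomorphic map between the ambient
manifolds. -/
def IsHolomorphicOnSubsets {ξ ξ' : CY2} {S : Set ξ.Y} {S' : Set ξ'.Y} (f : S → S') : Prop :=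
  ∀ x : S, ∃ O : Set ξ.Y, IsOpen O ∧ (x : ξ.Y) ∈ O ∧ ∃ F : ξ.Y → ξ'.Y,
    ContMDiffOn 𝓘(ℂ, ℂ × ℂ) 𝓘(ℂ, ℂ × ℂ) ω F O ∧ ∀ y : S, (y : ξ.Y) ∈ O → F y = f y

/-! ## Birational transformations of the plane -/

/-- The field `ℂ(x, y)` of rational functions on the projective plane. -/
abbrev RatField : Type := FractionRing (MvPolynomial (Fin 2) ℂ)

/-- The two coordinates of `ℂ(x, y)`. -/
def coord (k : Fin 2) : RatField := algebraMap (MvPolynomial (Fin 2) ℂ) RatField (MvPolynomial.X k)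

/-- The group `Bir(ℙ²)` of birational transformations of the projective plane, as the opposite of
the group of automorphisms of its function field: `φ` is recorded by the pullback
`f ↦ f ∘ φ`. -/
abbrev BirP2 : Type := (RatField ≃ₐ[ℂ] RatField)ᵐᵒᵖ

/-- The pullback `f ↦ f ∘ φ`. -/
def BirP2.pullback (φ : BirP2) : RatField ≃ₐ[ℂ] RatField := φ.unop

theorem coord_ne_zero (k : Fin 2) : coord k ≠ 0 := by
  rw [coord, Ne, FaithfulSMul.algebraMap_eq_zero_iff]
  exact MvPolynomial.X_ne_zero k

theorem coord_add_one_ne_zero (k : Fin 2) : coord k + 1 ≠ 0 := by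
  rw [coord, ← map_one (algebraMap (MvPolynomial (Fin 2) ℂ) RatField), ← map_add, Ne,
    FaithfulSMul.algebraMap_eq_zero_iff]
  intro h
  have := congrArg (MvPolynomial.eval (fun _ => (0 : ℂ))) h
  simp at this

theorem eq_top_of_coord_mem {L : IntermediateField ℂ RatField} (h : ∀ k, coord k ∈ L) :
    L = ⊤ := by
  rw [eq_top_iff]
  intro f _
  have hpol : ∀ P : MvPolynomial (Fin 2) ℂ, algebraMap _ RatField P ∈ L := by
    intro P
    induction P using MvPolynomial.induction_on with
    | C c =>
      have hc : algebraMap (MvPolynomial (Fin 2) ℂ) RatField (MvPolynomial.C c)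
          = algebraMap ℂ RatField c := by
        rw [← MvPolynomial.algebraMap_eq, ← IsScalarTower.algebraMap_apply]
      rw [hc]
      exact L.algebraMap_mem c
    | add p q hp hq => rw [map_add]; exact L.add_mem hp hq
    | mul_X p k hp => rw [map_mul]; exact L.mul_mem hp (h k)
  obtain ⟨P, Q, -, rfl⟩ := IsFractionRing.div_surjective (A := MvPolynomial (Fin 2) ℂ) f
  exact L.div_mem (hpol P) (hpol Q)

theorem algebraicIndependent_of_adjoin {f : Fin 2 → RatField}
    (hf : IntermediateField.adjoin ℂ (range f) = ⊤) : AlgebraicIndependent ℂ f := by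
  have halg : Algebra.IsAlgebraic (Algebra.adjoin ℂ (range f)) RatField := by
    rw [← IntermediateField.isAlgebraic_adjoin_iff_top]
    refine ⟨fun z => ?_⟩
    have hz : z ∈ IntermediateField.adjoin ℂ (range f) := by rw [hf]; trivial
    exact isAlgebraic_algebraMap (⟨z, hz⟩ : IntermediateField.adjoin ℂ (range f))
  have hcoord : AlgebraicIndependent ℂ coord :=
    (MvPolynomial.algebraicIndependent_X (Fin 2) ℂ).map'
      (f := IsScalarTower.toAlgHom ℂ (MvPolynomial (Fin 2) ℂ) RatField)
      (IsFractionRing.injective _ _)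
  exact (halg.isTranscendenceBasis_of_le_trdeg_of_finite ℂ f hcoord.cardinalMk_le_trdeg).1

/-- The birational transformation `(x, y) ↦ (f 0, f 1)`, for rational functions `f 0`, `f 1` which
generate the function field. -/
def birOf (f : Fin 2 → RatField) (hf : IntermediateField.adjoin ℂ (range f) = ⊤) : BirP2 :=
  MulOpposite.op <| (algebraicIndependent_of_adjoin hf).aevalEquivField.trans <|
    (IntermediateField.equivOfEq hf).trans IntermediateField.topEquiv

theorem birOf_pullback_coord (f : Fin 2 → RatField)
    (hf : IntermediateField.adjoin ℂ (range f) = ⊤) (k : Fin 2) :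
    (birOf f hf).pullback (coord k) = f k := by
  have h := (algebraicIndependent_of_adjoin hf).aevalEquivField_algebraMap_apply_coe
    (MvPolynomial.X k)
  rw [MvPolynomial.aeval_X] at h
  exact h

theorem adjoin_elementary :
    IntermediateField.adjoin ℂ (range ![coord 0, coord 1 * (coord 0 + 1)⁻¹]) = ⊤ := by
  set L := IntermediateField.adjoin ℂ (range ![coord 0, coord 1 * (coord 0 + 1)⁻¹]) with hL
  have h0 : coord 0 ∈ L := IntermediateField.subset_adjoin _ _ ⟨0, rfl⟩
  have h1 : coord 1 * (coord 0 + 1)⁻¹ ∈ L := IntermediateField.subset_adjoin _ _ ⟨1, rfl⟩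
  refine eq_top_of_coord_mem fun k => ?_
  fin_cases k
  · exact h0
  · have h := L.mul_mem h1 (L.add_mem h0 L.one_mem)
    rwa [inv_mul_cancel_right₀ (coord_add_one_ne_zero 0)] at h

/-- The elementary transformation `E : (x, y) ↦ (x, y (x + 1)⁻¹)`. -/
def elementaryE : BirP2 := birOf ![coord 0, coord 1 * (coord 0 + 1)⁻¹] adjoin_elementary

theorem adjoin_monomial (A : GL (Fin 2) ℤ) :
    IntermediateField.adjoin ℂ (range fun k => coord 0 ^ A 0 k * coord 1 ^ A 1 k) = ⊤ := by
  set f : Fin 2 → RatField := fun k => coord 0 ^ A 0 k * coord 1 ^ A 1 k with hf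
  set L := IntermediateField.adjoin ℂ (range f) with hL
  have hmem : ∀ k, f k ∈ L := fun k => IntermediateField.subset_adjoin _ _ ⟨k, rfl⟩
  set B : GL (Fin 2) ℤ := A⁻¹ with hB
  have hAB : (A : Matrix (Fin 2) (Fin 2) ℤ) * (B : Matrix (Fin 2) (Fin 2) ℤ) = 1 := by
    rw [← Units.val_mul, hB, mul_inv_cancel, Units.val_one]
  have hx := coord_ne_zero 0
  have hy := coord_ne_zero 1
  have key : ∀ i j : ℤ, f 0 ^ i * f 1 ^ j =
      coord 0 ^ (A 0 0 * i + A 0 1 * j) * coord 1 ^ (A 1 0 * i + A 1 1 * j) := by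
    intro i j
    simp only [hf]
    rw [mul_zpow, mul_zpow, ← zpow_mul, ← zpow_mul, ← zpow_mul, ← zpow_mul,
      mul_mul_mul_comm, ← zpow_add₀ hx, ← zpow_add₀ hy]
  have hentry : ∀ r c : Fin 2, A r 0 * B 0 c + A r 1 * B 1 c
      = (1 : Matrix (Fin 2) (Fin 2) ℤ) r c := by
    intro r c
    rw [← hAB, Matrix.mul_apply, Fin.sum_univ_two]
  refine eq_top_of_coord_mem fun k => ?_
  have h := L.mul_mem (zpow_mem (hmem 0) (B 0 k)) (zpow_mem (hmem 1) (B 1 k))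
  rw [key, hentry, hentry] at h
  fin_cases k <;> simpa [Matrix.one_apply] using h

/-- The action of a matrix `A = (a b; c d)` of `GL₂(ℤ)`,
namely `(x, y) ↦ (x ^ a y ^ c, x ^ b y ^ d)`. -/
def monomialBir (A : GL (Fin 2) ℤ) : BirP2 :=
  birOf (fun k => coord 0 ^ A 0 k * coord 1 ^ A 1 k) (adjoin_monomial A)

/-- The group `Bir_e(ℙ², ±Ω)`, generated by `E` and `GL₂(ℤ)`. All generators preserve
`Ω = d log x ∧ d log y` up to sign. -/
def BirE : Subgroup BirP2 := Subgroup.closure ({elementaryE} ∪ range monomialBir)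

/-- The rational function `f` is regular at the point `t` of `ℂ²`, with value `c`. -/
def HasValueAt (f : RatField) (t : ℂ × ℂ) (c : ℂ) : Prop :=
  ∃ P Q : MvPolynomial (Fin 2) ℂ, MvPolynomial.eval ![t.1, t.2] Q ≠ 0 ∧
    f = algebraMap _ RatField P / algebraMap _ RatField Q ∧
    c = MvPolynomial.eval ![t.1, t.2] P / MvPolynomial.eval ![t.1, t.2] Q

/-- The birational transformation `φ` is regular at the point `t` of `ℂ²` as a map to `ℂ²`, and
takes it to `t'`. -/
def BirP2.MapsPoint (φ : BirP2) (t t' : ℂ × ℂ) : Prop :=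
  HasValueAt (φ.pullback (coord 0)) t t'.1 ∧ HasValueAt (φ.pullback (coord 1)) t t'.2

/-- The map `f : Y_ξ → Y_ξ'` is given by the birational transformation `φ`, via the embeddings of
the torus in the two surfaces. -/
def BirP2.Defines (φ : BirP2) {ξ ξ' : CY2} (f : ξ.Y → ξ'.Y) : Prop :=
  ∀ t t' : torus, φ.MapsPoint t t' → f (ξ.emb t) = ξ'.emb t'

end

/-! The boundary of a surface is detected by arcs in the torus. An arc whose coordinates have
leading exponents n converges to the boundary component of the ray n, at the point where x ^ n₂ * y
^ (-n₁) takes a value z. A monomial map acts linearly on n and sends z to z or z⁻¹. The map E acts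
by (p, q) ↦ (p, q - min(p, 0)) and fixes z, provided z ≠ -1 when p = 0. Hence each element φ of the
group acts on primitive vectors n and sends z to z ^ ε with ε = ±1 (`TransformsArcs`).

Let φ define a biholomorphism Φ. Arcs tending to the component of a ray n of ξ go to arcs with some
exponent n'. If n' were interior to a cone of ξ', all image arcs would tend to one corner and Φ
would contract the component. So n' is a ray, and Φ takes component to component by c ↦ c ^ ε
(`Realizes.exists_mapsComponent`). By continuity D_ξ goes into D_ξ'. The same argument for φ⁻¹ gives
equality, hence also the statement on U.

Passing to the limits c → 0 and c → -1, corners go to corners, and the next centre of interior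
blow-ups on a component goes to the next centre on the image component, because -1 is its own
inverse. So the centre of every blow-up step of ξ goes to the centre of a step of ξ', and a
biholomorphism lifts to the blow-ups of corresponding points (`IsBlowUp.exists_diffeomorph`).
Induction on the number of steps finishes the proof.

Since the surfaces are glued from charts, three facts have to be supplied: the torus is dense, so
that identities need only be checked there; the surfaces are Hausdorff (`t2Space_Y`), so that limits
are unique; and each step is a blow-up of a point in suitable coordinates
(`exists_isBlowUp_interior`, `exists_isBlowUp_corner`). -/

noncomputable section

/-! ### Points and charts of a glued surface. -/

namespace TorusAtlas

variable {A B C : TorusAtlas}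

/-- The point of the glued surface with coordinates `p` in the chart `i`, as a total function
(with a junk value outside the domain of the chart). -/
def ofChart (A : TorusAtlas) (i : A.Index) (p : ℂ × ℂ) : A.Space := (chart i).symm p

/-- The embedding of the torus, as a total function. -/
def ofTorus (A : TorusAtlas) (t : ℂ × ℂ) : A.Space := A.ofChart A.torusIndex t

theorem ofChart_eq_pt {i : A.Index} {p : ℂ × ℂ} (hp : p ∈ A.dom i) :
    A.ofChart i p = pt i p hp := chart_symm_apply hp

theorem emb_eq_ofTorus (t : torus) : A.emb t = A.ofTorus t :=
  (ofChart_eq_pt _).symm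

theorem chart_ofChart {i : A.Index} {p : ℂ × ℂ} (hp : p ∈ A.dom i) :
    chart i (A.ofChart i p) = p := by
  rw [ofChart_eq_pt hp, chart_pt hp]

theorem exists_ofChart (y : A.Space) : ∃ i p, p ∈ A.dom i ∧ A.ofChart i p = y := by
  obtain ⟨i, p, hp, rfl⟩ := exists_pt y
  exact ⟨i, p, hp, ofChart_eq_pt hp⟩

theorem ofChart_eq_iff {i j : A.Index} {p q : ℂ × ℂ} (hp : p ∈ A.dom i) (hq : q ∈ A.dom j) :
    A.ofChart i p = A.ofChart j q ↔ A.Glue ⟨i, p, hp⟩ ⟨j, q, hq⟩ := by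
  rw [ofChart_eq_pt hp, ofChart_eq_pt hq, pt_eq_iff]

theorem chart_source (i : A.Index) : (chart i).source = A.ofChart i '' A.dom i := by
  ext y
  constructor
  · rintro ⟨p, hp, rfl⟩
    exact ⟨p, hp, ofChart_eq_pt hp⟩
  · rintro ⟨p, hp, rfl⟩
    exact ⟨p, hp, (ofChart_eq_pt hp).symm⟩

/-- The chart `i` as a member of the atlas of the glued surface. -/
def homeoChart (A : TorusAtlas) (i : A.Index) : OpenPartialHomeomorph A.Space (ℂ × ℂ) :=
  A.core.openPartialHomeomorph (chart i) (mem_range_self i)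

theorem homeoChart_mem_maximalAtlas (i : A.Index) :
    A.homeoChart i ∈ IsManifold.maximalAtlas 𝓘(ℂ, ℂ × ℂ) ω A.Space := by
  apply IsManifold.subset_maximalAtlas
  exact mem_iUnion.2 ⟨chart i, mem_iUnion.2 ⟨mem_range_self i, rfl⟩⟩

theorem contMDiffOn_ofChart (i : A.Index) :
    ContMDiffOn 𝓘(ℂ, ℂ × ℂ) 𝓘(ℂ, ℂ × ℂ) ω (A.ofChart i) (A.dom i) :=
  contMDiffOn_symm_of_mem_maximalAtlas (homeoChart_mem_maximalAtlas i)

theorem contMDiffOn_chart (i : A.Index) :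
    ContMDiffOn 𝓘(ℂ, ℂ × ℂ) 𝓘(ℂ, ℂ × ℂ) ω (chart i) (A.ofChart i '' A.dom i) := by
  rw [← chart_source]
  exact contMDiffOn_of_mem_maximalAtlas (homeoChart_mem_maximalAtlas i)

theorem isOpen_ofChart_image {i : A.Index} {N : Set (ℂ × ℂ)} (hN : IsOpen N)
    (hNi : N ⊆ A.dom i) : IsOpen (A.ofChart i '' N) :=
  (A.homeoChart i).symm.isOpen_image_of_subset_source hN hNi

theorem continuousAt_ofChart {i : A.Index} {p : ℂ × ℂ} (hp : p ∈ A.dom i) :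
    ContinuousAt (A.ofChart i) p :=
  (contMDiffOn_ofChart i).continuousOn.continuousAt ((A.isOpen_dom i).mem_nhds hp)

/-! ### Maps between glued surfaces given in charts -/

/-- The holomorphic map `h` from the open subset `N` of the chart `i` of `A` to the chart `j` of
`B` is compatible with the identifications with the torus. -/
structure IsLocalMap (A B : TorusAtlas) (i : A.Index) (j : B.Index) (N : Set (ℂ × ℂ))
    (h : ℂ × ℂ → ℂ × ℂ) : Prop where
  isOpen : IsOpen N
  subset : N ⊆ A.dom i
  contDiffOn : ContDiffOn ℂ ω h N
  mapsTo : MapsTo h N (B.dom j)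
  par_eq : ∀ z ∈ N, A.par i z ∈ torus → B.par j (h z) = A.par i z

/-- Identity principle inside a chart: the points identified with torus points are dense, so limits
along them determine both values. -/
theorem eq_of_dense_par {i : A.Index} {N : Set (ℂ × ℂ)} (hN : IsOpen N) (hNi : N ⊆ A.dom i)
    {X : Type*} [TopologicalSpace X] [T2Space X] {f g : ℂ × ℂ → X} (hf : ContinuousOn f N)
    (hg : ContinuousOn g N) (h : ∀ z ∈ N, A.par i z ∈ torus → f z = g z) :
    ∀ z ∈ N, f z = g z := by
  intro p hp
  set r : Set (ℂ × ℂ) := {p | p ∈ A.dom i ∧ A.par i p ∈ torus}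
  have hcl : p ∈ closure (N ∩ r) :=
    hN.inter_closure ⟨hp, A.dom_subset_closure i (hNi hp)⟩
  have hne : (𝓝[N ∩ r] p).NeBot := mem_closure_iff_nhdsWithin_neBot.1 hcl
  have t1 : Filter.Tendsto f (𝓝[N ∩ r] p) (𝓝 (f p)) :=
    (hf.continuousAt (hN.mem_nhds hp)).tendsto.mono_left nhdsWithin_le_nhds
  have t2 : Filter.Tendsto g (𝓝[N ∩ r] p) (𝓝 (g p)) :=
    (hg.continuousAt (hN.mem_nhds hp)).tendsto.mono_left nhdsWithin_le_nhds
  refine tendsto_nhds_unique (t1.congr' ?_) t2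
  filter_upwards [self_mem_nhdsWithin] with z hz using h z hz.1 hz.2.2

/-- Two opposite compatible maps are automatically inverse to each other where their composites are
defined: both respect `par`, which is injective on a dense set. So they form a gluing. -/
theorem IsLocalMap.ofChart_eq {i j : A.Index} {N M : Set (ℂ × ℂ)} {h k : ℂ × ℂ → ℂ × ℂ}
    (hh : IsLocalMap A A i j N h) (hk : IsLocalMap A A j i M k) {p : ℂ × ℂ} (hp : p ∈ N)
    (hp' : h p ∈ M) : A.ofChart i p = A.ofChart j (h p) := by
  have key : ∀ {i j : A.Index} {N M : Set (ℂ × ℂ)} {h k : ℂ × ℂ → ℂ × ℂ}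
      (_ : IsLocalMap A A i j N h) (_ : IsLocalMap A A j i M k),
      IsOpen (N ∩ h ⁻¹' M) ∧ ∀ z ∈ N ∩ h ⁻¹' M, k (h z) = z := by
    intro i j N M h k hh hk
    have ho : IsOpen (N ∩ h ⁻¹' M) :=
      hh.contDiffOn.continuousOn.isOpen_inter_preimage hh.isOpen hk.isOpen
    refine ⟨ho, eq_of_dense_par (i := i) ho (inter_subset_left.trans hh.subset)
      (hk.contDiffOn.continuousOn.comp (hh.contDiffOn.continuousOn.mono inter_subset_left)
        fun z hz => hz.2) continuousOn_id ?_⟩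
    intro z hz hzt
    have h1 := hh.par_eq z hz.1 hzt
    have h2 := hk.par_eq (h z) hz.2 (by rw [h1]; exact hzt)
    refine A.injOn_par i ⟨hk.mapsTo hz.2, ?_⟩ ⟨hh.subset hz.1, hzt⟩ (h2.trans h1)
    rw [h2, h1]; exact hzt
  obtain ⟨o1, e1⟩ := key hh hk
  obtain ⟨o2, e2⟩ := key hk hh
  rw [ofChart_eq_iff (hh.subset hp) (hk.subset hp')]
  refine ⟨{
    toFun := h
    invFun := k
    source := N ∩ h ⁻¹' M
    target := M ∩ k ⁻¹' N
    map_source' := fun z hz => ⟨hz.2, by change k (h z) ∈ N; rw [e1 z hz]; exact hz.1⟩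
    map_target' := fun z hz => ⟨hz.2, by change h (k z) ∈ M; rw [e2 z hz]; exact hz.1⟩
    left_inv' := e1
    right_inv' := e2
    open_source := o1
    open_target := o2
    continuousOn_toFun := hh.contDiffOn.continuousOn.mono inter_subset_left
    continuousOn_invFun := hk.contDiffOn.continuousOn.mono inter_subset_left },
    ⟨hp, hp'⟩, rfl, fun z hz => hh.subset hz.1, fun z hz => hk.subset hz.1,
    hh.contDiffOn.mono inter_subset_left, hk.contDiffOn.mono inter_subset_left,
    fun z hz => hh.par_eq z hz.1, fun z hz => hk.par_eq z hz.1⟩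

theorem par_eq_of_ofChart_eq {i j : A.Index} {p q : ℂ × ℂ} (hp : p ∈ A.dom i) (hq : q ∈ A.dom j)
    (h : A.ofChart i p = A.ofChart j q) (hqt : A.par j q ∈ torus) : A.par i p = A.par j q := by
  obtain ⟨g, gp, gpq, -, -, -, -, -, gc⟩ := (ofChart_eq_iff hp hq).1 h
  simp only at gp gpq gc
  have := gc q (gpq ▸ g.map_source gp) hqt
  rwa [← gpq, g.left_inv gp, gpq] at this

/-- The charts are glued to the torus wherever they are identified with a part of it. -/
class Uniformized (A : TorusAtlas) : Prop where
  ofChart_eq_ofTorus : ∀ i, ∀ z ∈ A.dom i, A.par i z ∈ torus → A.ofChart i z = A.ofTorus (A.par i z)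

theorem par_ofTorus {i : A.Index} {p t : ℂ × ℂ} (hp : p ∈ A.dom i) (ht : t ∈ torus)
    (h : A.ofChart i p = A.ofTorus t) : A.par i p = t := by
  have := par_eq_of_ofChart_eq hp (q := t) (j := A.torusIndex) (by rwa [A.dom_torusIndex]) h
    (by rw [A.par_torusIndex]; exact ht)
  rwa [A.par_torusIndex] at this

theorem dense_ofTorus_image [A.Uniformized] : Dense (A.ofTorus '' torus) := by
  intro y
  obtain ⟨i, p, hp, rfl⟩ := exists_ofChart y
  have hne := mem_closure_iff_nhdsWithin_neBot.1 (A.dom_subset_closure i hp)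
  refine mem_closure_of_tendsto (f := A.ofChart i)
    (b := 𝓝[{p | p ∈ A.dom i ∧ A.par i p ∈ torus}] p) ?_ ?_
  · exact (continuousAt_ofChart hp).tendsto.mono_left nhdsWithin_le_nhds
  · filter_upwards [self_mem_nhdsWithin] with z hz
    exact ⟨_, hz.2, (Uniformized.ofChart_eq_ofTorus i z hz.1 hz.2).symm⟩

/-- Some filter of points of the torus converges both to the point `p` of the chart `i` and to
the point `q` of the chart `j`. -/
def HaveCommonLimit (A : TorusAtlas) (i : A.Index) (p : ℂ × ℂ) (j : A.Index) (q : ℂ × ℂ) : Prop :=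
  ∃ (l : Filter A.Space) (f g : A.Space → ℂ × ℂ), l.NeBot ∧ Filter.Tendsto f l (𝓝 p) ∧
    Filter.Tendsto g l (𝓝 q) ∧ ∀ᶠ t in l, f t ∈ A.dom i ∧ g t ∈ A.dom j ∧
      A.par i (f t) ∈ torus ∧ A.par i (f t) = A.par j (g t)

/-- The tool for the Hausdorff property: inseparable points are common limits of a filter, and by
density the filter may be restricted to the torus, where the coordinates in the two charts are
related by explicit formulas. -/
theorem haveCommonLimit [A.Uniformized] {i j : A.Index} {p q : ℂ × ℂ} (hp : p ∈ A.dom i)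
    (hq : q ∈ A.dom j) (h : (𝓝 (A.ofChart i p) ⊓ 𝓝 (A.ofChart j q)).NeBot) :
    A.HaveCommonLimit i p j q := by
  have hc : ∀ (i : A.Index) (p : ℂ × ℂ), p ∈ A.dom i →
      Filter.Tendsto (chart i) (𝓝 (A.ofChart i p)) (𝓝 p) ∧
      A.ofChart i '' A.dom i ∈ 𝓝 (A.ofChart i p) := by
    intro i p hp
    have ho := (isOpen_ofChart_image (A.isOpen_dom i) subset_rfl).mem_nhds (mem_image_of_mem _ hp)
    have := ((contMDiffOn_chart i).continuousOn.continuousAt ho).tendsto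
    rw [chart_ofChart hp] at this
    exact ⟨this, ho⟩
  refine ⟨𝓝 (A.ofChart i p) ⊓ 𝓝 (A.ofChart j q) ⊓ Filter.principal (A.ofTorus '' torus),
    chart i, chart j, ?_, ?_, ?_, ?_⟩
  · rw [Filter.inf_principal_neBot_iff]
    intro U hU
    obtain ⟨V, hV, W, hW, rfl⟩ := Filter.mem_inf_iff.1 hU
    have h1 := Filter.inter_mem (Filter.mem_inf_of_left (g := 𝓝 (A.ofChart j q))
      (interior_mem_nhds.2 hV)) (Filter.mem_inf_of_right (f := 𝓝 (A.ofChart i p))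
      (interior_mem_nhds.2 hW))
    obtain ⟨y, hy⟩ := Filter.nonempty_of_mem h1
    obtain ⟨z, hz, hz'⟩ := dense_ofTorus_image.inter_open_nonempty _
      (isOpen_interior.inter isOpen_interior) ⟨y, hy⟩
    exact ⟨z, ⟨interior_subset hz.1, interior_subset hz.2⟩, hz'⟩
  · exact (hc i p hp).1.mono_left (inf_le_left.trans inf_le_left)
  · exact (hc j q hq).1.mono_left (inf_le_left.trans inf_le_right)
  · have h1 : ∀ᶠ y in 𝓝 (A.ofChart i p) ⊓ 𝓝 (A.ofChart j q) ⊓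
        Filter.principal (A.ofTorus '' torus), y ∈ A.ofChart i '' A.dom i :=
      Filter.mem_inf_of_left (Filter.mem_inf_of_left (hc i p hp).2)
    have h2 : ∀ᶠ y in 𝓝 (A.ofChart i p) ⊓ 𝓝 (A.ofChart j q) ⊓
        Filter.principal (A.ofTorus '' torus), y ∈ A.ofChart j '' A.dom j :=
      Filter.mem_inf_of_left (Filter.mem_inf_of_right (hc j q hq).2)
    have h3 : ∀ᶠ y in 𝓝 (A.ofChart i p) ⊓ 𝓝 (A.ofChart j q) ⊓
        Filter.principal (A.ofTorus '' torus), y ∈ A.ofTorus '' torus :=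
      Filter.mem_inf_of_right (Filter.mem_principal_self _)
    filter_upwards [h1, h2, h3]
    rintro y ⟨a, ha, hay⟩ ⟨b, hb, hby⟩ ⟨t, ht, rfl⟩
    have h1 := par_ofTorus ha ht hay
    have h2 := par_ofTorus hb ht hby
    rw [← hay, chart_ofChart ha, hay, ← hby, chart_ofChart hb, h1, h2]
    exact ⟨ha, hb, ht, rfl⟩

theorem haveCommonLimit_of_eq [A.Uniformized] {i j : A.Index} {p q : ℂ × ℂ} (hp : p ∈ A.dom i)
    (hq : q ∈ A.dom j) (h : A.ofChart i p = A.ofChart j q) : A.HaveCommonLimit i p j q :=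
  haveCommonLimit hp hq (by rw [h, inf_idem]; infer_instance)

/-- Holomorphic maps which are given locally and agree on a dense set with a given map can be
glued. -/
theorem exists_contMDiffOn_of_locally [T2Space B.Space] {O S : Set A.Space} (hS : Dense S)
    (f₀ : A.Space → B.Space)
    (h : ∀ y ∈ O, ∃ N, IsOpen N ∧ y ∈ N ∧ ∃ f : A.Space → B.Space,
      ContMDiffOn 𝓘(ℂ, ℂ × ℂ) 𝓘(ℂ, ℂ × ℂ) ω f N ∧ ∀ z ∈ N ∩ S, f z = f₀ z) :
    ∃ F : A.Space → B.Space, ContMDiffOn 𝓘(ℂ, ℂ × ℂ) 𝓘(ℂ, ℂ × ℂ) ω F O ∧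
      ∀ z ∈ O ∩ S, F z = f₀ z := by
  have : Nonempty B.Space := ⟨B.ofTorus 0⟩
  choose! N hN hyN f hf hfS using h
  -- The local maps agree on overlaps, since they agree with `f₀` on a dense set and the target is
  -- Hausdorff. So the diagonal choice `f y y` coincides near `y` with a single local map.
  have key : ∀ y ∈ O, ∀ z ∈ O, z ∈ N y → f z z = f y z := by
    intro y hy z hz hzy
    have ho := (hN y hy).inter (hN z hz)
    have hne : (𝓝[(N y ∩ N z) ∩ S] z).NeBot :=
      mem_closure_iff_nhdsWithin_neBot.1 (hS.open_subset_closure_inter ho ⟨hzy, hyN z hz⟩)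
    have t1 : Filter.Tendsto (f z) (𝓝[(N y ∩ N z) ∩ S] z) (𝓝 (f z z)) :=
      ((hf z hz).continuousOn.continuousAt ((hN z hz).mem_nhds (hyN z hz))).tendsto.mono_left
        nhdsWithin_le_nhds
    have t2 : Filter.Tendsto (f y) (𝓝[(N y ∩ N z) ∩ S] z) (𝓝 (f y z)) :=
      ((hf y hy).continuousOn.continuousAt ((hN y hy).mem_nhds hzy)).tendsto.mono_left
        nhdsWithin_le_nhds
    refine tendsto_nhds_unique (t1.congr' ?_) t2
    filter_upwards [self_mem_nhdsWithin] with x hx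
    rw [hfS z hz x ⟨hx.1.2, hx.2⟩, hfS y hy x ⟨hx.1.1, hx.2⟩]
  refine ⟨fun y => f y y, fun y hy => ?_, fun z hz => hfS z hz.1 z ⟨hyN z hz.1, hz.2⟩⟩
  have h1 : ContMDiffWithinAt 𝓘(ℂ, ℂ × ℂ) 𝓘(ℂ, ℂ × ℂ) ω (f y) O y :=
    ((hf y hy).contMDiffAt ((hN y hy).mem_nhds (hyN y hy))).contMDiffWithinAt
  refine h1.congr_of_eventuallyEq ?_ (key y hy y hy (hyN y hy))
  filter_upwards [self_mem_nhdsWithin, mem_nhdsWithin_of_mem_nhds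
    ((hN y hy).mem_nhds (hyN y hy))] with z hz hz'
  exact key y hy z hz hz'

theorem eqOn_of_eqOn_ofTorus [A.Uniformized] {X : Type*} [TopologicalSpace X] [T2Space X]
    {O : Set A.Space} (hO : IsOpen O) {f g : A.Space → X} (hf : ContinuousOn f O)
    (hg : ContinuousOn g O) (h : ∀ t ∈ torus, A.ofTorus t ∈ O → f (A.ofTorus t) = g (A.ofTorus t)) :
    ∀ y ∈ O, f y = g y := by
  intro y hy
  have hne : (𝓝[O ∩ A.ofTorus '' torus] y).NeBot :=
    mem_closure_iff_nhdsWithin_neBot.1 (dense_ofTorus_image.open_subset_closure_inter hO hy)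
  have t1 : Filter.Tendsto f (𝓝[O ∩ A.ofTorus '' torus] y) (𝓝 (f y)) :=
    (hf.continuousAt (hO.mem_nhds hy)).tendsto.mono_left nhdsWithin_le_nhds
  have t2 : Filter.Tendsto g (𝓝[O ∩ A.ofTorus '' torus] y) (𝓝 (g y)) :=
    (hg.continuousAt (hO.mem_nhds hy)).tendsto.mono_left nhdsWithin_le_nhds
  refine tendsto_nhds_unique (t1.congr' ?_) t2
  filter_upwards [self_mem_nhdsWithin]
  rintro _ ⟨hz, t, ht, rfl⟩
  exact h t ht hz

theorem IsLocalMap.ofChart_ofTorus [A.Uniformized] [B.Uniformized] {i : A.Index} {j : B.Index}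
    {N : Set (ℂ × ℂ)} {h : ℂ × ℂ → ℂ × ℂ} (hh : IsLocalMap A B i j N h) {z : ℂ × ℂ} (hz : z ∈ N)
    (hzt : A.par i z ∈ torus) :
    A.ofChart i z = A.ofTorus (A.par i z) ∧ B.ofChart j (h z) = B.ofTorus (A.par i z) := by
  refine ⟨Uniformized.ofChart_eq_ofTorus i z (hh.subset hz) hzt, ?_⟩
  rw [Uniformized.ofChart_eq_ofTorus j (h z) (hh.mapsTo hz), hh.par_eq z hz hzt]
  rw [hh.par_eq z hz hzt]; exact hzt

/-- A holomorphic map which is the identity on the torus is given by any compatible map of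
charts. -/
theorem IsLocalMap.map_ofChart [A.Uniformized] [B.Uniformized] [T2Space B.Space]
    {i : A.Index} {j : B.Index} {N : Set (ℂ × ℂ)} {h : ℂ × ℂ → ℂ × ℂ}
    (hh : IsLocalMap A B i j N h) {O : Set A.Space} (hO : IsOpen O) {F : A.Space → B.Space}
    (hF : ContinuousOn F O) (hFt : ∀ t ∈ torus, A.ofTorus t ∈ O → F (A.ofTorus t) = B.ofTorus t)
    {z : ℂ × ℂ} (hz : z ∈ N) (hzO : A.ofChart i z ∈ O) :
    F (A.ofChart i z) = B.ofChart j (h z) := by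
  have hc : ContinuousOn (A.ofChart i) N :=
    (contMDiffOn_ofChart i).continuousOn.mono hh.subset
  have ho : IsOpen (N ∩ A.ofChart i ⁻¹' O) := hc.isOpen_inter_preimage hh.isOpen hO
  refine eq_of_dense_par (A := A) (i := i) (f := fun z => F (A.ofChart i z))
    (g := fun z => B.ofChart j (h z)) ho
    (inter_subset_left.trans hh.subset) (hF.comp (hc.mono inter_subset_left) fun z hz => hz.2)
    ((contMDiffOn_ofChart j).continuousOn.comp
      (hh.contDiffOn.continuousOn.mono inter_subset_left) fun z hz => hh.mapsTo hz.1) ?_ z ⟨hz, hzO⟩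
  intro z hz hzt
  obtain ⟨h1, h2⟩ := hh.ofChart_ofTorus hz.1 hzt
  have h3 : A.ofTorus (A.par i z) ∈ O := h1 ▸ hz.2
  rw [h1, h2, hFt _ hzt h3]

/-- A map which is given locally by compatible maps of charts is holomorphic. -/
theorem exists_contMDiffOn_of_isLocalMap [A.Uniformized] [B.Uniformized] [T2Space B.Space]
    {O : Set A.Space}
    (h : ∀ i, ∀ p ∈ A.dom i, A.ofChart i p ∈ O → ∃ j N k, IsLocalMap A B i j N k ∧ p ∈ N) :
    ∃ F : A.Space → B.Space, ContMDiffOn 𝓘(ℂ, ℂ × ℂ) 𝓘(ℂ, ℂ × ℂ) ω F O ∧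
      ∀ t ∈ torus, A.ofTorus t ∈ O → F (A.ofTorus t) = B.ofTorus t := by
  have htor : ∀ t ∈ torus, B.ofTorus (chart A.torusIndex (A.ofTorus t)) = B.ofTorus t := by
    intro t ht
    rw [ofTorus, ofTorus, chart_ofChart (by rwa [A.dom_torusIndex])]
    rfl
  obtain ⟨F, hF, hF'⟩ := exists_contMDiffOn_of_locally (O := O) (A := A) (B := B)
    dense_ofTorus_image (fun y => B.ofTorus (chart A.torusIndex y)) (by
      intro y hy
      obtain ⟨i, p, hp, rfl⟩ := exists_ofChart y
      obtain ⟨j, N, k, hk, hpN⟩ := h i p hp hy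
      refine ⟨A.ofChart i '' N, isOpen_ofChart_image hk.isOpen hk.subset, mem_image_of_mem _ hpN,
        fun y => B.ofChart j (k (chart i y)), ?_, ?_⟩
      · refine (contMDiffOn_ofChart j).comp (hk.contDiffOn.contMDiffOn.comp
          ((contMDiffOn_chart i).mono (image_mono hk.subset)) ?_) ?_
        · rintro _ ⟨z, hz, rfl⟩
          rw [mem_preimage, chart_ofChart (hk.subset hz)]; exact hz
        · rintro _ ⟨z, hz, rfl⟩
          simp only [mem_preimage]
          rw [chart_ofChart (hk.subset hz)]; exact hk.mapsTo hz
      · rintro _ ⟨⟨z, hz, hzt⟩, t, ht, rfl⟩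
        have hpar := par_ofTorus (hk.subset hz) ht hzt
        simp only
        rw [htor t ht, ← hzt, chart_ofChart (hk.subset hz),
          (hk.ofChart_ofTorus hz (by rw [hpar]; exact ht)).2, hpar])
  refine ⟨F, hF, fun t ht htO => ?_⟩
  rw [hF' _ ⟨htO, t, ht, rfl⟩]
  exact htor t ht

end TorusAtlas

/-! ### Monomial maps -/

theorem monomialMap_comp (σ ρ : (ℤ × ℤ) × (ℤ × ℤ)) {p : ℂ × ℂ} (hp : p ∈ torus) :
    monomialMap σ (monomialMap ρ p) =
      monomialMap (ρ.1.1 • σ.1 + ρ.1.2 • σ.2, ρ.2.1 • σ.1 + ρ.2.2 • σ.2) p := by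
  obtain ⟨h1, h2⟩ := hp
  have key : ∀ i j : ℤ, (p.1 ^ ρ.1.1 * p.2 ^ ρ.2.1) ^ i * (p.1 ^ ρ.1.2 * p.2 ^ ρ.2.2) ^ j =
      p.1 ^ (ρ.1.1 * i + ρ.1.2 * j) * p.2 ^ (ρ.2.1 * i + ρ.2.2 * j) := by
    intro i j
    rw [mul_zpow, mul_zpow, ← zpow_mul, ← zpow_mul, ← zpow_mul, ← zpow_mul, mul_mul_mul_comm,
      ← zpow_add₀ h1, ← zpow_add₀ h2]
  simp [monomialMap, key]

theorem monomialMap_one (p : ℂ × ℂ) : monomialMap ((1, 0), (0, 1)) p = p := by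
  simp [monomialMap]

/-- Cramer's rule. It turns membership in a cone into sign conditions on determinants. -/
theorem det2_expand {v w : ℤ × ℤ} (h : det2 v w = 1) (n : ℤ × ℤ) :
    n = det2 n w • v + det2 v n • w := by
  simp only [det2] at h
  ext
  · simp only [det2, Prod.fst_add, Prod.smul_fst, smul_eq_mul]; linear_combination -n.1 * h
  · simp only [det2, Prod.snd_add, Prod.smul_snd, smul_eq_mul]; linear_combination -n.2 * h

theorem det2_self (v : ℤ × ℤ) : det2 v v = 0 := by simp [det2, mul_comm]

theorem det2_swap (v w : ℤ × ℤ) : det2 v w = -det2 w v := by simp only [det2]; ring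

theorem det2_add_left (u v w : ℤ × ℤ) : det2 (u + v) w = det2 u w + det2 v w := by
  simp only [det2, Prod.fst_add, Prod.snd_add]; ring

theorem det2_add_right (u v w : ℤ × ℤ) : det2 u (v + w) = det2 u v + det2 u w := by
  simp only [det2, Prod.fst_add, Prod.snd_add]; ring

theorem det2_smul_left (k : ℤ) (v w : ℤ × ℤ) : det2 (k • v) w = k * det2 v w := by
  simp only [det2, Prod.smul_fst, Prod.smul_snd, smul_eq_mul]; ring

theorem det2_smul_right (k : ℤ) (v w : ℤ × ℤ) : det2 v (k • w) = k * det2 v w := by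
  simp only [det2, Prod.smul_fst, Prod.smul_snd, smul_eq_mul]; ring

/-- The change of coordinates from the cone `τ` to the cone `σ`. -/
def transition (σ τ : (ℤ × ℤ) × (ℤ × ℤ)) : (ℤ × ℤ) × (ℤ × ℤ) :=
  ((det2 τ.1 σ.2, det2 σ.1 τ.1), (det2 τ.2 σ.2, det2 σ.1 τ.2))

theorem monomialMap_transition {σ : (ℤ × ℤ) × (ℤ × ℤ)} (hσ : det2 σ.1 σ.2 = 1)
    (τ : (ℤ × ℤ) × (ℤ × ℤ)) {p : ℂ × ℂ} (hp : p ∈ torus) :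
    monomialMap σ (monomialMap (transition σ τ) p) = monomialMap τ p := by
  rw [monomialMap_comp _ _ hp]
  simp only [transition]
  rw [← det2_expand hσ τ.1, ← det2_expand hσ τ.2]

theorem eq_monomialMap_transition {σ τ : (ℤ × ℤ) × (ℤ × ℤ)} (hσ : det2 σ.1 σ.2 = 1)
    {p q : ℂ × ℂ} (hp : p ∈ torus) (hq : q ∈ torus) (h : monomialMap σ p = monomialMap τ q) :
    p = monomialMap (transition σ τ) q :=
  monomialMap_injOn hσ hp (monomialMap_mem_torus hq)
    (by rw [h, monomialMap_transition hσ τ hq])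

theorem contDiffOn_zpow_fst (n : ℤ) :
    ContDiffOn ℂ ω (fun p : ℂ × ℂ => p.1 ^ n) {p | p.1 ≠ 0} := by
  cases n with
  | ofNat k => simpa using (contDiff_fst.pow k).contDiffOn
  | negSucc k =>
    simp only [zpow_negSucc]
    exact (contDiff_fst.pow (k + 1)).contDiffOn.inv fun p hp => pow_ne_zero _ hp

theorem contDiffOn_zpow_snd (n : ℤ) :
    ContDiffOn ℂ ω (fun p : ℂ × ℂ => p.2 ^ n) {p | p.2 ≠ 0} := by
  cases n with
  | ofNat k => simpa using (contDiff_snd.pow k).contDiffOn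
  | negSucc k =>
    simp only [zpow_negSucc]
    exact (contDiff_snd.pow (k + 1)).contDiffOn.inv fun p hp => pow_ne_zero _ hp

theorem contDiffOn_monomialMap (σ : (ℤ × ℤ) × (ℤ × ℤ)) : ContDiffOn ℂ ω (monomialMap σ) torus := by
  have h1 : torus ⊆ {p : ℂ × ℂ | p.1 ≠ 0} := fun p hp => hp.1
  have h2 : torus ⊆ {p : ℂ × ℂ | p.2 ≠ 0} := fun p hp => hp.2
  exact (((contDiffOn_zpow_fst _).mono h1).mul ((contDiffOn_zpow_snd _).mono h2)).prodMk
    (((contDiffOn_zpow_fst _).mono h1).mul ((contDiffOn_zpow_snd _).mono h2))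

theorem continuousAt_monomialMap (σ : (ℤ × ℤ) × (ℤ × ℤ)) {p : ℂ × ℂ} (hp : p ∈ torus) :
    ContinuousAt (monomialMap σ) p :=
  (contDiffOn_monomialMap σ).continuousOn.continuousAt (isOpen_torus.mem_nhds hp)

/-- The coordinates of the cone `σ` on the torus. -/
def toricCoords (σ : (ℤ × ℤ) × (ℤ × ℤ)) : ℂ × ℂ → ℂ × ℂ :=
  monomialMap (transition σ ((1, 0), (0, 1)))

theorem monomialMap_toricCoords {σ : (ℤ × ℤ) × (ℤ × ℤ)} (hσ : det2 σ.1 σ.2 = 1) {p : ℂ × ℂ}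
    (hp : p ∈ torus) : monomialMap σ (toricCoords σ p) = p := by
  rw [toricCoords, monomialMap_transition hσ _ hp, monomialMap_one]

theorem toricCoords_mem_torus {σ : (ℤ × ℤ) × (ℤ × ℤ)} {p : ℂ × ℂ} (hp : p ∈ torus) :
    toricCoords σ p ∈ torus := monomialMap_mem_torus hp

theorem toricCoords_monomialMap {σ : (ℤ × ℤ) × (ℤ × ℤ)} (hσ : det2 σ.1 σ.2 = 1) {p : ℂ × ℂ}
    (hp : p ∈ torus) : toricCoords σ (monomialMap σ p) = p :=
  monomialMap_injOn hσ (toricCoords_mem_torus (monomialMap_mem_torus hp)) hp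
    (monomialMap_toricCoords hσ (monomialMap_mem_torus hp))

/-! ### Fans -/

namespace SmoothCompleteFan

variable {F : SmoothCompleteFan}

/-- By Cramer's rule the hypotheses say that `v` is interior to `σ` and lies in the closed cone `τ`.
Uniqueness arguments for fans apply this to a ray of one of the cones. -/
theorem eq_of_det2_pos {σ τ : (ℤ × ℤ) × (ℤ × ℤ)} (hσ : σ ∈ F.cones) (hτ : τ ∈ F.cones)
    {v : ℤ × ℤ} (h1 : 0 < det2 v σ.2) (h2 : 0 < det2 σ.1 v) (h3 : 0 ≤ det2 v τ.2)
    (h4 : 0 ≤ det2 τ.1 v) : σ = τ := by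
  refine F.eq_of_interior σ hσ τ hτ (det2 v σ.2).toNat (det2 σ.1 v).toNat (det2 v τ.2).toNat
    (det2 τ.1 v).toNat (by omega) (by omega) ?_
  have h : ∀ {ρ : (ℤ × ℤ) × (ℤ × ℤ)}, det2 ρ.1 ρ.2 = 1 → 0 ≤ det2 v ρ.2 → 0 ≤ det2 ρ.1 v →
      (det2 v ρ.2).toNat • ρ.1 + (det2 ρ.1 v).toNat • ρ.2 = v := by
    intro ρ hρ h h'
    rw [← natCast_zsmul, ← natCast_zsmul, Int.toNat_of_nonneg h, Int.toNat_of_nonneg h',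
      ← det2_expand hρ v]
  rw [h (F.smooth σ hσ) h1.le h2.le, h (F.smooth τ hτ) h3 h4]

/-- If the second rays differ, the one at the smaller angle from the common first ray is interior to
the other cone. -/
theorem eq_of_fst_eq {σ τ : (ℤ × ℤ) × (ℤ × ℤ)} (hσ : σ ∈ F.cones) (hτ : τ ∈ F.cones)
    (h : σ.1 = τ.1) : σ = τ := by
  have h1 := F.smooth σ hσ
  have h2 := F.smooth τ hτ
  rcases lt_trichotomy (det2 σ.2 τ.2) 0 with h3 | h3 | h3
  · exact F.eq_of_det2_pos hσ hτ (v := τ.2) (by rw [det2_swap]; omega) (by rw [h]; omega)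
      (by rw [det2_self]) (by omega)
  · have := det2_expand h1 τ.2
    rw [det2_swap, h3, h, h2] at this
    refine Prod.ext h ?_
    simpa using this.symm
  · exact (F.eq_of_det2_pos hτ hσ (v := σ.2) h3 (by rw [← h]; omega)
      (by rw [det2_self]) (by omega)).symm

theorem eq_of_snd_eq {σ τ : (ℤ × ℤ) × (ℤ × ℤ)} (hσ : σ ∈ F.cones) (hτ : τ ∈ F.cones)
    (h : σ.2 = τ.2) : σ = τ := by
  have h1 := F.smooth σ hσ
  have h2 := F.smooth τ hτ
  rcases lt_trichotomy (det2 σ.1 τ.1) 0 with h3 | h3 | h3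
  · exact (F.eq_of_det2_pos hτ hσ (v := σ.1) (by rw [← h]; omega) (by rw [det2_swap]; omega)
      (by omega) (by rw [det2_self])).symm
  · have := det2_expand h1 τ.1
    rw [h3, h, h2] at this
    refine Prod.ext ?_ h
    simpa using this.symm
  · exact F.eq_of_det2_pos hσ hτ (v := τ.1) (by rw [h]; omega) h3
      (by omega) (by rw [det2_self])

/-- Two distinct cones are separated by the line spanned by an edge of one of them. -/
theorem separation {σ τ : (ℤ × ℤ) × (ℤ × ℤ)} (hσ : σ ∈ F.cones) (hτ : τ ∈ F.cones)
    (hne : σ ≠ τ) :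
    (det2 σ.1 τ.1 ≤ 0 ∧ det2 σ.1 τ.2 ≤ 0) ∨ (0 ≤ det2 σ.2 τ.1 ∧ 0 ≤ det2 σ.2 τ.2) ∨
      (det2 τ.1 σ.1 ≤ 0 ∧ det2 τ.1 σ.2 ≤ 0) ∨ (0 ≤ det2 τ.2 σ.1 ∧ 0 ≤ det2 τ.2 σ.2) := by
  have h1 := F.smooth σ hσ
  have h2 := F.smooth τ hτ
  have e1 := det2_swap τ.1 σ.1
  have e2 := det2_swap τ.1 σ.2
  have e3 := det2_swap τ.2 σ.1
  have e4 := det2_swap τ.2 σ.2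
  by_contra! hcon
  obtain ⟨c1, c2, c3, c4⟩ := hcon
  have i1 : ¬ (0 < det2 τ.1 σ.2 ∧ 0 < det2 σ.1 τ.1) := fun h =>
    hne (F.eq_of_det2_pos hσ hτ h.1 h.2 (by omega) (by rw [det2_self]))
  have i3 : ¬ (0 < det2 σ.1 τ.2 ∧ 0 < det2 τ.1 σ.1) := fun h =>
    hne (F.eq_of_det2_pos hτ hσ h.1 h.2 (by omega) (by rw [det2_self])).symm
  have ha : det2 σ.1 τ.1 ≤ 0 := by
    by_contra h
    omega
  have hb := c1 ha
  -- A first ray of one cone cannot be interior to the other, so the only configuration left has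
  -- parallel first rays. The next identity makes them point in the same direction.
  have ha' : det2 σ.1 τ.1 = 0 := by omega
  have key : det2 τ.1 σ.2 * det2 σ.1 τ.2 = 1 := by
    have := congrArg (fun n => det2 n τ.2) (det2_expand h1 τ.1)
    simp only [ha', zero_smul, add_zero, det2_smul_left, h2] at this
    exact this.symm
  have hk : det2 τ.1 σ.2 = 1 := by nlinarith
  have := det2_expand h1 τ.1
  rw [ha', hk] at this
  exact hne (F.eq_of_fst_eq hσ hτ (by simpa using this.symm))

/-- For large N the vector N σ.2 - σ.1 lies just beyond the ray σ.2 in the counterclockwise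
direction. Once N exceeds the determinants involved, a cone containing this vector contains σ.2 as
well. There σ.2 is not interior, as the cone would then be `σ`, and not the second ray, as the
vector would lie outside; so it is the first ray. -/
theorem exists_fst_eq_snd {σ : (ℤ × ℤ) × (ℤ × ℤ)} (hσ : σ ∈ F.cones) :
    ∃ τ ∈ F.cones, τ.1 = σ.2 := by
  have h1 := F.smooth σ hσ
  set N : ℕ := 1 + ∑ τ ∈ F.cones, ((det2 τ.1 σ.1).natAbs + (det2 σ.1 τ.2).natAbs) with hN
  obtain ⟨τ, hτ, a, b, hab⟩ := F.complete ((N : ℤ) • σ.2 + (-1 : ℤ) • σ.1)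
  have h2 := F.smooth τ hτ
  refine ⟨τ, hτ, ?_⟩
  have hle := Finset.single_le_sum (f := fun τ : (ℤ × ℤ) × (ℤ × ℤ) =>
    (det2 τ.1 σ.1).natAbs + (det2 σ.1 τ.2).natAbs) (fun _ _ => Nat.zero_le _) hτ
  rw [← natCast_zsmul, ← natCast_zsmul] at hab
  have e1 := congrArg (det2 τ.1) hab
  have e2 := congrArg (fun v => det2 v τ.2) hab
  simp only [det2_add_right, det2_add_left, det2_smul_left, det2_smul_right, det2_self, h2] at e1 e2
  have p1 : 0 ≤ det2 τ.1 σ.2 := by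
    by_contra! h
    have : (N : ℤ) * det2 τ.1 σ.2 ≤ -N := by nlinarith
    omega
  have p2 : 0 ≤ det2 σ.2 τ.2 := by
    by_contra! h
    have : (N : ℤ) * det2 σ.2 τ.2 ≤ -N := by nlinarith
    omega
  have hex := det2_expand h2 σ.2
  rcases p1.lt_or_eq with p1 | p1
  · rcases p2.lt_or_eq with p2 | p2
    · have := F.eq_of_det2_pos hτ hσ p2 p1 (by rw [det2_self]) (by omega)
      rw [this, det2_self] at p2
      omega
    · rw [← p2, zero_smul, zero_add] at hex
      have h3 := h1
      rw [hex, det2_smul_right] at h3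
      have h4 : det2 σ.1 τ.2 = 1 := by
        by_contra h4
        have : det2 τ.1 σ.2 = 1 := by
          rcases Int.isUnit_iff.1 (IsUnit.of_mul_eq_one _ h3) with h | h <;> omega
        rw [this] at h3
        omega
      rw [← p2, h4] at e2
      omega
  · rw [← p1, zero_smul, add_zero] at hex
    have h3 := h1
    rw [hex, det2_smul_right] at h3
    have : det2 σ.2 τ.2 = 1 := by
      rcases Int.isUnit_iff.1 (IsUnit.of_mul_eq_one _ h3) with h | h <;> omega
    rw [this, one_smul] at hex
    exact hex.symm

theorem exists_fst_eq {n : ℤ × ℤ} (hn : n ∈ F.rays) : ∃ σ ∈ F.cones, σ.1 = n := by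
  simp only [rays, Finset.mem_union, Finset.mem_image] at hn
  rcases hn with h | ⟨σ, hσ, rfl⟩
  · exact h
  · exact F.exists_fst_eq_snd hσ

/-- By counting: every ray is a first ray, so there are at most as many rays as cones, and cones
have distinct second rays. Hence the second rays exhaust the rays. -/
theorem exists_snd_eq {n : ℤ × ℤ} (hn : n ∈ F.rays) : ∃ σ ∈ F.cones, σ.2 = n := by
  have hi : F.rays ⊆ F.cones.image Prod.fst := fun n hn => by
    simpa [Finset.mem_image] using F.exists_fst_eq hn
  have h1 : F.rays.card ≤ (F.cones.image Prod.snd).card := by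
    rw [Finset.card_image_of_injOn fun σ hσ τ hτ h => F.eq_of_snd_eq hσ hτ h]
    exact (Finset.card_le_card hi).trans Finset.card_image_le
  have h2 := Finset.eq_of_subset_of_card_le
    (Finset.subset_union_right : F.cones.image Prod.snd ⊆ F.rays) h1
  rw [rays, ← h2] at hn
  simpa [Finset.mem_image] using hn

theorem fst_mem_rays {σ : (ℤ × ℤ) × (ℤ × ℤ)} (hσ : σ ∈ F.cones) : σ.1 ∈ F.rays :=
  Finset.mem_union_left _ (Finset.mem_image_of_mem _ hσ)

theorem snd_mem_rays {σ : (ℤ × ℤ) × (ℤ × ℤ)} (hσ : σ ∈ F.cones) : σ.2 ∈ F.rays :=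
  Finset.mem_union_right _ (Finset.mem_image_of_mem _ hσ)

/-- The sum is interior to `σ`, so a cone with this first ray would be `σ` itself. It follows that
the new ray of a corner blow-up carries no interior blow-ups. -/
theorem add_notMem_rays {σ : (ℤ × ℤ) × (ℤ × ℤ)} (hσ : σ ∈ F.cones) : σ.1 + σ.2 ∉ F.rays := by
  intro h
  obtain ⟨τ, hτ, h⟩ := F.exists_fst_eq h
  have h1 := F.smooth σ hσ
  have h2 := F.smooth τ hτ
  have := F.eq_of_det2_pos hσ hτ (v := τ.1)
    (by rw [h, det2_add_left, det2_self]; omega) (by rw [h, det2_add_right, det2_self]; omega)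
    (by omega) (by rw [det2_self])
  subst this
  rw [left_eq_add] at h
  simp [h, det2] at h1

/-- Every nonzero primitive vector is a ray or lies in the interior of a cone. -/
theorem mem_rays_or_interior (F : SmoothCompleteFan) {n n₀ : ℤ × ℤ} (hn : det2 n n₀ = 1) :
    n ∈ F.rays ∨ ∃ σ ∈ F.cones, 0 < det2 n σ.2 ∧ 0 < det2 σ.1 n := by
  obtain ⟨σ, hσ, a, b, hab⟩ := F.complete n
  have h1 := F.smooth σ hσ
  rw [← natCast_zsmul, ← natCast_zsmul] at hab
  have ha : det2 n σ.2 = a := by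
    rw [hab, det2_add_left, det2_smul_left, det2_smul_left, det2_self, h1]; simp
  have hb : det2 σ.1 n = b := by
    rw [hab, det2_add_right, det2_smul_right, det2_smul_right, det2_self, h1]; simp
  rcases Nat.eq_zero_or_pos a with rfl | ha0
  · left
    rw [hab] at hn
    simp only [Nat.cast_zero, zero_smul, zero_add, det2_smul_left] at hn
    have : (b : ℤ) = 1 := by
      rcases Int.isUnit_iff.1 (IsUnit.of_mul_eq_one _ hn) with h | h <;> omega
    rw [hab, this]
    simpa using F.snd_mem_rays hσ
  · rcases Nat.eq_zero_or_pos b with rfl | hb0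
    · left
      rw [hab] at hn
      simp only [Nat.cast_zero, zero_smul, add_zero, det2_smul_left] at hn
      have : (a : ℤ) = 1 := by
        rcases Int.isUnit_iff.1 (IsUnit.of_mul_eq_one _ hn) with h | h <;> omega
      rw [hab, this]
      simpa using F.fst_mem_rays hσ
    · exact .inr ⟨σ, hσ, by omega, by omega⟩

theorem eq_or_of_mem_star {S : Finset ((ℤ × ℤ) × (ℤ × ℤ))} {σ τ : (ℤ × ℤ) × (ℤ × ℤ)}
    (h : τ ∈ insert (σ.1, σ.1 + σ.2) (insert (σ.1 + σ.2, σ.2) (S.erase σ))) :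
    τ = (σ.1, σ.1 + σ.2) ∨ τ = (σ.1 + σ.2, σ.2) ∨ (τ ∈ S ∧ τ ≠ σ) := by
  simpa [and_comm] using h

/-- The star subdivision of a fan at a two-dimensional cone. -/
def starSubdivision (F : SmoothCompleteFan) (σ : (ℤ × ℤ) × (ℤ × ℤ)) (hσ : σ ∈ F.cones) :
    SmoothCompleteFan where
  cones := insert (σ.1, σ.1 + σ.2) (insert (σ.1 + σ.2, σ.2) (F.cones.erase σ))
  smooth τ hτ := by
    have h1 := F.smooth σ hσ
    rcases eq_or_of_mem_star hτ with rfl | rfl | ⟨h, -⟩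
    · simp [det2_add_right, det2_self, h1]
    · simp [det2_add_left, det2_self, h1]
    · exact F.smooth τ h
  complete v := by
    obtain ⟨τ, hτ, a, b, rfl⟩ := F.complete v
    by_cases hτσ : τ = σ
    · subst hτσ
      rcases le_total a b with hab | hab
      · obtain ⟨c, rfl⟩ := Nat.exists_eq_add_of_le hab
        exact ⟨(τ.1 + τ.2, τ.2), by simp, a, c, by simp only [smul_add, add_smul]; abel⟩
      · obtain ⟨c, rfl⟩ := Nat.exists_eq_add_of_le hab
        exact ⟨(τ.1, τ.1 + τ.2), by simp, c, b, by simp only [smul_add, add_smul]; abel⟩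
    · exact ⟨τ, by simp [hτ, hτσ], a, b, rfl⟩
  eq_of_interior := by
    have h1 := F.smooth σ hσ
    -- Each cone of the subdivision lies in a cone of `F`. In the two halves of `σ` the coefficients
    -- satisfy b' ≤ a' and a' ≤ b' respectively, strictly for interior vectors, which is what keeps
    -- the halves apart.
    have key : ∀ τ ∈ insert (σ.1, σ.1 + σ.2) (insert (σ.1 + σ.2, σ.2) (F.cones.erase σ)),
        ∀ a b : ℕ, ∃ τ' ∈ F.cones, ∃ a' b' : ℕ, a • τ.1 + b • τ.2 = a' • τ'.1 + b' • τ'.2 ∧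
          (0 < a → 0 < b → 0 < a' ∧ 0 < b') ∧
          (τ' ≠ σ → τ = τ') ∧ (τ' = σ → (τ = (σ.1, σ.1 + σ.2) ∧ a' = a + b ∧ b' = b) ∨
            (τ = (σ.1 + σ.2, σ.2) ∧ a' = a ∧ b' = a + b)) := by
      intro τ hτ a b
      rcases eq_or_of_mem_star hτ with rfl | rfl | ⟨h, h'⟩
      · exact ⟨σ, hσ, a + b, b, by simp only [smul_add, add_smul]; abel,
          fun _ _ => ⟨by omega, by omega⟩, fun h => absurd rfl h, fun _ => .inl ⟨rfl, rfl, rfl⟩⟩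
      · exact ⟨σ, hσ, a, a + b, by simp only [smul_add, add_smul]; abel,
          fun _ _ => ⟨by omega, by omega⟩, fun h => absurd rfl h, fun _ => .inr ⟨rfl, rfl, rfl⟩⟩
      · exact ⟨τ, h, a, b, rfl, fun h h' => ⟨h, h'⟩, fun _ => rfl, fun h => absurd h h'⟩
    intro τ hτ ρ hρ a b c d ha hb h
    obtain ⟨τ', hτ', a', b', e1, p1, n1, q1⟩ := key τ hτ a b
    obtain ⟨ρ', hρ', c', d', e2, -, n2, q2⟩ := key ρ hρ c d
    obtain ⟨ha', hb'⟩ := p1 ha hb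
    rw [e1, e2] at h
    have heq := F.eq_of_interior τ' hτ' ρ' hρ' a' b' c' d' ha' hb' h
    subst heq
    by_cases hs : τ' = σ
    · subst hs
      simp only [← natCast_zsmul] at h
      have u1 := congrArg (det2 τ'.1) h
      have u2 := congrArg (fun v => det2 v τ'.2) h
      simp only [det2_add_right, det2_add_left, det2_smul_left, det2_smul_right, det2_self, h1]
        at u1 u2
      rcases q1 rfl with ⟨rfl, _, _⟩ | ⟨rfl, _, _⟩ <;> rcases q2 rfl with ⟨rfl, _, _⟩ | ⟨rfl, _, _⟩
      · rfl
      · omega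
      · omega
      · rfl
    · rw [n1 hs, n2 hs]

/-! ### Limits in toric surfaces -/

/-- The coordinates `f` are Laurent monomials in `g`, and these are continuous at a point of the
torus. -/
theorem mem_torus_of_tendsto {α : Type*} {l : Filter α} [l.NeBot] {f g : α → ℂ × ℂ} {p q : ℂ × ℂ}
    {σ τ : (ℤ × ℤ) × (ℤ × ℤ)} (hσ : det2 σ.1 σ.2 = 1) (hf : Filter.Tendsto f l (𝓝 p))
    (hg : Filter.Tendsto g l (𝓝 q))
    (hfg : ∀ᶠ t in l, f t ∈ torus ∧ g t ∈ torus ∧ monomialMap σ (f t) = monomialMap τ (g t))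
    (hq : q ∈ torus) : p ∈ torus := by
  have h1 := (continuousAt_monomialMap (transition σ τ) hq).tendsto.comp hg
  have h2 : p = monomialMap (transition σ τ) q := by
    refine tendsto_nhds_unique hf (h1.congr' ?_)
    filter_upwards [hfg] with t ht
    exact (eq_monomialMap_transition hσ ht.1 ht.2.1 ht.2.2).symm
  rw [h2]
  exact monomialMap_mem_torus hq

theorem tendsto_zpow_ne {α : Type*} {l : Filter α} {f : α → ℂ} {c : ℂ} (hf : Filter.Tendsto f l (𝓝 c))
    (hc : c ≠ 0) (k : ℤ) : Filter.Tendsto (fun t => f t ^ k) l (𝓝 (c ^ k)) :=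
  hf.zpow₀ k (.inl hc)

/-- The possible relations between the coordinates of a limit point in the charts of two cones. -/
def LimitRelation (σ τ : (ℤ × ℤ) × (ℤ × ℤ)) (p q : ℂ × ℂ) : Prop :=
  (σ = τ ∧ p = q) ∨ (p ∈ torus ∧ q ∈ torus) ∨ (σ.1 = τ.2 ∧ p.2 ≠ 0 ∧ q.1 ≠ 0) ∨
    (σ.2 = τ.1 ∧ p.1 ≠ 0 ∧ q.2 ≠ 0)

/-- This is the separatedness of the toric surface. If an edge of `σ` separates the cones, one
coordinate for `σ` is a monomial with exponents -P, -Q ≤ 0 in those for `τ`. Clearing denominators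
and passing to the limit gives a product equal to 1, so a coordinate of `q` can vanish only if its
exponent does. A vanishing exponent means that the cones have a common edge, or edges in opposite
directions; the latter forces the limits into the torus. -/
theorem limitRelation {σ τ : (ℤ × ℤ) × (ℤ × ℤ)} (hσ : σ ∈ F.cones) (hτ : τ ∈ F.cones)
    {α : Type*} {l : Filter α} [l.NeBot] {f g : α → ℂ × ℂ} {p q : ℂ × ℂ}
    (hf : Filter.Tendsto f l (𝓝 p)) (hg : Filter.Tendsto g l (𝓝 q))
    (hfg : ∀ᶠ t in l, f t ∈ torus ∧ g t ∈ torus ∧ monomialMap σ (f t) = monomialMap τ (g t)) :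
    LimitRelation σ τ p q := by
  have aux : ∀ {σ τ : (ℤ × ℤ) × (ℤ × ℤ)} (_ : σ ∈ F.cones) (_ : τ ∈ F.cones)
      {f g : α → ℂ × ℂ} {p q : ℂ × ℂ} (_ : Filter.Tendsto f l (𝓝 p))
      (_ : Filter.Tendsto g l (𝓝 q))
      (_ : ∀ᶠ t in l, f t ∈ torus ∧ g t ∈ torus ∧ monomialMap σ (f t) = monomialMap τ (g t)),
      (det2 σ.1 τ.1 ≤ 0 ∧ det2 σ.1 τ.2 ≤ 0) ∨ (0 ≤ det2 σ.2 τ.1 ∧ 0 ≤ det2 σ.2 τ.2) →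
      (p ∈ torus ∧ q ∈ torus) ∨ (σ.1 = τ.2 ∧ p.2 ≠ 0 ∧ q.1 ≠ 0) ∨
        (σ.2 = τ.1 ∧ p.1 ≠ 0 ∧ q.2 ≠ 0) := by
    intro σ τ hσ hτ f g p q hf hg hfg hsep
    have h1 := F.smooth σ hσ
    have h2 := F.smooth τ hτ
    have hq : q ∈ torus → p ∈ torus ∧ q ∈ torus := fun hq =>
      ⟨mem_torus_of_tendsto h1 hf hg hfg hq, hq⟩
    have tr : ∀ᶠ t in l, g t ∈ torus ∧
        (f t).1 = (g t).1 ^ det2 τ.1 σ.2 * (g t).2 ^ det2 τ.2 σ.2 ∧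
        (f t).2 = (g t).1 ^ det2 σ.1 τ.1 * (g t).2 ^ det2 σ.1 τ.2 := by
      filter_upwards [hfg] with t ht
      have := eq_monomialMap_transition h1 ht.1 ht.2.1 ht.2.2
      exact ⟨ht.2.1, congrArg Prod.fst this, congrArg Prod.snd this⟩
    have hf1 := (continuous_fst.tendsto _).comp hf
    have hf2 := (continuous_snd.tendsto _).comp hf
    have hg1 := (continuous_fst.tendsto _).comp hg
    have hg2 := (continuous_snd.tendsto _).comp hg
    have ex1 := det2_expand h1 τ.1
    have ex2 := det2_expand h1 τ.2
    -- The transition matrix between two oriented bases has determinant 1.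
    have hdet : det2 τ.1 σ.2 * det2 σ.1 τ.2 - det2 σ.1 τ.1 * det2 τ.2 σ.2 = 1 := by
      simp only [det2] at h1 h2 ⊢; linear_combination h2 + (τ.1.1 * τ.2.2 - τ.1.2 * τ.2.1) * h1
    have huniq := fun (P Q : ℕ) (u : α → ℂ) (c : ℂ) (hu : Filter.Tendsto u l (𝓝 c))
      (h : ∀ᶠ t in l, u t * ((g t).1 ^ P * (g t).2 ^ Q) = 1) =>
      tendsto_nhds_unique (hu.mul ((hg1.pow P).mul (hg2.pow Q)))
        ((tendsto_const_nhds (x := (1 : ℂ))).congr' (by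
          filter_upwards [h] with t ht using ht.symm))
    rcases hsep with ⟨ha, hb⟩ | ⟨hc, hd⟩
    · obtain ⟨P, hP⟩ := Int.eq_ofNat_of_zero_le (neg_nonneg.2 ha)
      obtain ⟨Q, hQ⟩ := Int.eq_ofNat_of_zero_le (neg_nonneg.2 hb)
      rw [neg_eq_iff_eq_neg] at hP hQ
      have hlim : p.2 * (q.1 ^ P * q.2 ^ Q) = 1 := by
        refine huniq P Q _ _ hf2 ?_
        filter_upwards [tr] with t ht
        have := pow_ne_zero P ht.1.1
        have := pow_ne_zero Q ht.1.2
        simp only [Function.comp_apply]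
        rw [ht.2.2, hP, hQ, zpow_neg, zpow_neg, zpow_natCast, zpow_natCast]
        field_simp
      have hp2 : p.2 ≠ 0 := left_ne_zero_of_mul_eq_one hlim
      have hq12 := right_ne_zero_of_mul_eq_one hlim
      rcases Nat.eq_zero_or_pos P with rfl | hP0
      · left
        -- Here the first rays are parallel, and as the second factor is -Q ≤ 0 they are opposite.
        -- The other coordinate then shows that `q.1` does not vanish either.
        have hprod : det2 τ.1 σ.2 * det2 σ.1 τ.2 = 1 := by rw [hP] at hdet; simpa using hdet
        have hu : det2 τ.1 σ.2 = -1 := by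
          rcases Int.isUnit_iff.1 (IsUnit.of_mul_eq_one _ hprod) with h | h
          · rw [h] at hprod; omega
          · exact h
        have hQ1 : Q = 1 := by rw [hu] at hprod; omega
        subst hQ1
        have hq2 : q.2 ≠ 0 := by simpa using hq12
        have hlim2 : p.1 * q.1 = q.2 ^ det2 τ.2 σ.2 := by
          refine tendsto_nhds_unique (hf1.mul hg1) ((tendsto_zpow_ne hg2 hq2 _).congr' ?_)
          filter_upwards [tr] with t ht
          have := ht.1.1
          simp only [Function.comp_apply]
          rw [ht.2.1, hu, zpow_neg_one]
          field_simp
        exact hq ⟨right_ne_zero_of_mul (hlim2 ▸ zpow_ne_zero _ hq2), hq2⟩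
      · have hq1 : q.1 ≠ 0 := fun h => hq12 (by simp [h, hP0.ne'])
        rcases Nat.eq_zero_or_pos Q with rfl | hQ0
        · right; left
          refine ⟨?_, hp2, hq1⟩
          rw [hQ] at hdet ex2
          have hu : det2 τ.2 σ.2 = 1 := by
            have h' : (P : ℤ) * det2 τ.2 σ.2 = 1 := by rw [hP] at hdet; simpa using hdet
            rcases Int.isUnit_iff.1 (IsUnit.of_mul_eq_one _ h') with h | h
            · rw [h] at h'; omega
            · omega
          rw [hu] at ex2
          simpa using ex2.symm
        · exact .inl (hq ⟨hq1, fun h => hq12 (by simp [h, hQ0.ne'])⟩)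
    · have s1 := det2_swap τ.1 σ.2
      have s2 := det2_swap τ.2 σ.2
      obtain ⟨P, hP⟩ := Int.eq_ofNat_of_zero_le hc
      obtain ⟨Q, hQ⟩ := Int.eq_ofNat_of_zero_le hd
      rw [hP] at s1
      rw [hQ] at s2
      have hlim : p.1 * (q.1 ^ P * q.2 ^ Q) = 1 := by
        refine huniq P Q _ _ hf1 ?_
        filter_upwards [tr] with t ht
        have := pow_ne_zero P ht.1.1
        have := pow_ne_zero Q ht.1.2
        simp only [Function.comp_apply]
        rw [ht.2.1, s1, s2, zpow_neg, zpow_neg, zpow_natCast, zpow_natCast]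
        field_simp
      have hp1 : p.1 ≠ 0 := left_ne_zero_of_mul_eq_one hlim
      have hq12 := right_ne_zero_of_mul_eq_one hlim
      rcases Nat.eq_zero_or_pos Q with rfl | hQ0
      · left
        have hprod : det2 τ.1 σ.2 * det2 σ.1 τ.2 = 1 := by rw [s2] at hdet; simpa using hdet
        have hu : det2 σ.1 τ.2 = -1 := by
          rw [mul_comm] at hprod
          rcases Int.isUnit_iff.1 (IsUnit.of_mul_eq_one _ hprod) with h | h
          · rw [h] at hprod; omega
          · exact h
        have hP1 : P = 1 := by rw [hu] at hprod; omega
        subst hP1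
        have hq1 : q.1 ≠ 0 := by simpa using hq12
        have hlim2 : p.2 * q.2 = q.1 ^ det2 σ.1 τ.1 := by
          refine tendsto_nhds_unique (hf2.mul hg2) ((tendsto_zpow_ne hg1 hq1 _).congr' ?_)
          filter_upwards [tr] with t ht
          have := ht.1.2
          simp only [Function.comp_apply]
          rw [ht.2.2, hu, zpow_neg_one]
          field_simp
        exact hq ⟨hq1, right_ne_zero_of_mul (hlim2 ▸ zpow_ne_zero _ hq1)⟩
      · have hq2 : q.2 ≠ 0 := fun h => hq12 (by simp [h, hQ0.ne'])
        rcases Nat.eq_zero_or_pos P with rfl | hP0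
        · right; right
          refine ⟨?_, hp1, hq2⟩
          rw [s1] at ex1 hdet
          have hu : det2 σ.1 τ.1 = 1 := by
            have h' : (Q : ℤ) * det2 σ.1 τ.1 = 1 := by
              rw [s2] at hdet; simpa [mul_comm] using hdet
            rcases Int.isUnit_iff.1 (IsUnit.of_mul_eq_one _ h') with h | h
            · rw [h] at h'; omega
            · omega
          rw [hu] at ex1
          simpa using ex1.symm
        · exact .inl (hq ⟨fun h => hq12 (by simp [h, hP0.ne']), hq2⟩)
  by_cases hne : σ = τ
  · subst hne
    refine .inl ⟨rfl, tendsto_nhds_unique hf (hg.congr' ?_)⟩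
    filter_upwards [hfg] with t ht
    exact (monomialMap_injOn (F.smooth σ hσ) ht.1 ht.2.1 ht.2.2).symm
  · right
    have hgf : ∀ᶠ t in l, g t ∈ torus ∧ f t ∈ torus ∧ monomialMap τ (g t) = monomialMap σ (f t) := by
      filter_upwards [hfg] with t ht using ⟨ht.2.1, ht.1, ht.2.2.symm⟩
    rcases F.separation hσ hτ hne with h | h | h | h
    · exact aux hσ hτ hf hg hfg (.inl h)
    · exact aux hσ hτ hf hg hfg (.inr h)
    · rcases aux hτ hσ hg hf hgf (.inl h) with h | h | h
      · exact .inl ⟨h.2, h.1⟩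
      · exact .inr (.inr ⟨h.1.symm, h.2.2, h.2.1⟩)
      · exact .inr (.inl ⟨h.1.symm, h.2.2, h.2.1⟩)
    · rcases aux hτ hσ hg hf hgf (.inr h) with h | h | h
      · exact .inl ⟨h.2, h.1⟩
      · exact .inr (.inr ⟨h.1.symm, h.2.2, h.2.1⟩)
      · exact .inr (.inl ⟨h.1.symm, h.2.2, h.2.1⟩)

end SmoothCompleteFan

namespace TorusAtlas

variable {A : TorusAtlas}

theorem HaveCommonLimit.symm {i j : A.Index} {p q : ℂ × ℂ} (h : A.HaveCommonLimit i p j q) :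
    A.HaveCommonLimit j q i p := by
  obtain ⟨l, f, g, hl, hf, hg, h⟩ := h
  refine ⟨l, g, f, hl, hg, hf, ?_⟩
  filter_upwards [h] with t ht
  exact ⟨ht.2.1, ht.1, by rw [← ht.2.2.2]; exact ht.2.2.1, ht.2.2.2.symm⟩

theorem HaveCommonLimit.eq {i : A.Index} {p q : ℂ × ℂ} (h : A.HaveCommonLimit i p i q) :
    p = q := by
  obtain ⟨l, f, g, hl, hf, hg, h⟩ := h
  refine tendsto_nhds_unique hf (hg.congr' ?_)
  filter_upwards [h] with t ht
  exact (A.injOn_par i ⟨ht.1, ht.2.2.1⟩ ⟨ht.2.1, by rw [← ht.2.2.2]; exact ht.2.2.1⟩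
    ht.2.2.2).symm

/-- Along the common filter `h ∘ f = g`, because `par` is injective; so `h p = q`, and the two
charts are glued at these points. -/
theorem HaveCommonLimit.ofChart_eq {i j : A.Index} {p q : ℂ × ℂ} (hl : A.HaveCommonLimit i p j q)
    {N M : Set (ℂ × ℂ)} {h k : ℂ × ℂ → ℂ × ℂ}
    (hh : IsLocalMap A A i j N h) (hk : IsLocalMap A A j i M k) (hp : p ∈ N) (hq : q ∈ M) :
    A.ofChart i p = A.ofChart j q := by
  have hpq : h p = q := by
    obtain ⟨l, f, g, hl, hf, hg, he⟩ := hl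
    have h1 := (hh.contDiffOn.continuousOn.continuousAt (hh.isOpen.mem_nhds hp)).tendsto.comp hf
    refine tendsto_nhds_unique h1 (hg.congr' ?_)
    filter_upwards [he, hf (hh.isOpen.mem_nhds hp)] with t ht htN
    have h2 := hh.par_eq (f t) htN ht.2.2.1
    refine A.injOn_par j ⟨ht.2.1, by rw [← ht.2.2.2]; exact ht.2.2.1⟩ ⟨hh.mapsTo htN, ?_⟩ ?_
    · rw [Function.comp_apply, h2]; exact ht.2.2.1
    · rw [Function.comp_apply, h2, ht.2.2.2]
  rw [← hpq]
  exact hh.ofChart_eq hk hp (hpq ▸ hq)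

end TorusAtlas

/-! ### The charts of the surface of ξ and their overlaps. -/

open TorusAtlas

namespace CY2

variable {ξ : CY2}

theorem chartPar_strict {σ : (ℤ × ℤ) × (ℤ × ℤ)} (hσ : σ ∈ ξ.cones) (p : ℂ × ℂ) :
    ξ.chartPar (.strict σ hσ) p = monomialMap σ (p.1 ^ ξ.m σ.1 * p.2, p.1 - 1) := by
  simp [chartPar, blowUpStrict_iterate, centre]

theorem chartPar_exc {σ : (ℤ × ℤ) × (ℤ × ℤ)} (hσ : σ ∈ ξ.cones) (j : Fin (ξ.m σ.1)) (p : ℂ × ℂ) :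
    ξ.chartPar (.exc σ hσ j) p =
      monomialMap σ ((p.1 * p.2) ^ (j : ℕ) * p.2, p.1 * p.2 - 1) := by
  simp [chartPar, blowUpStrict_iterate, centre, blowUpExc]

theorem mem_chartDom_strict {σ : (ℤ × ℤ) × (ℤ × ℤ)} {hσ : σ ∈ ξ.cones} {p : ℂ × ℂ} :
    p ∈ ξ.chartDom (.strict σ hσ) ↔ p.1 ≠ 1 := Iff.rfl

theorem mem_chartDom_exc {σ : (ℤ × ℤ) × (ℤ × ℤ)} {hσ : σ ∈ ξ.cones} {j : Fin (ξ.m σ.1)}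
    {p : ℂ × ℂ} : p ∈ ξ.chartDom (.exc σ hσ j) ↔ p.1 * p.2 ≠ 1 := Iff.rfl

theorem mem_chartDom_cone {σ : (ℤ × ℤ) × (ℤ × ℤ)} {hσ : σ ∈ ξ.cones} {p : ℂ × ℂ} :
    p ∈ ξ.chartDom (.cone σ hσ) ↔ p ≠ (0, -1) ∧ p ≠ (-1, 0) := by
  simp [chartDom]

theorem torus_subset_chartDom_cone {σ : (ℤ × ℤ) × (ℤ × ℤ)} {hσ : σ ∈ ξ.cones} :
    _root_.torus ⊆ ξ.chartDom (.cone σ hσ) := by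
  intro p hp
  rw [mem_chartDom_cone]
  exact ⟨fun h => hp.1 (by rw [h]), fun h => hp.2 (by rw [h])⟩

/-- The coordinates of a chart in terms of the toric coordinates, given by functions which are
holomorphic where `d` does not vanish. -/
theorem ofChart_eq_ofTorus_aux {i : ξ.ChartIndex} {σ : (ℤ × ℤ) × (ℤ × ℤ)} (hσ : σ ∈ ξ.cones)
    (b : ℂ × ℂ → ℂ × ℂ) (hb : ContDiff ℂ ω b) (hpar : ∀ p, ξ.chartPar i p = monomialMap σ (b p))
    (d : ℂ × ℂ → ℂ) (hd : Continuous d) (k : ℂ × ℂ → ℂ × ℂ)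
    (hk : ContDiffOn ℂ ω k (_root_.torus ∩ {q | d q ≠ 0}))
    (hbk : ∀ q ∈ _root_.torus, d q ≠ 0 → k q ∈ ξ.chartDom i ∧ b (k q) = q)
    (hdb : ∀ p ∈ ξ.chartDom i, b p ∈ _root_.torus → d (b p) ≠ 0)
    (z : ℂ × ℂ) (hz : z ∈ ξ.chartDom i) (hzt : ξ.chartPar i z ∈ _root_.torus) :
    ξ.atlas.ofChart i z = ξ.atlas.ofTorus (ξ.chartPar i z) := by
  have hs := ξ.smooth σ hσ
  have ht : IsOpen (_root_.torus ∩ {q | d q ≠ 0}) :=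
    isOpen_torus.inter (isOpen_ne_fun hd continuous_const)
  have hbz : b z ∈ _root_.torus := mem_torus_of_monomialMap hs (by rw [← hpar]; exact hzt)
  have h1 : IsLocalMap ξ.atlas ξ.atlas i .torus (ξ.chartDom i ∩ b ⁻¹' _root_.torus)
      (ξ.chartPar i) :=
    { isOpen := (ξ.isOpen_chartDom i).inter (isOpen_torus.preimage hb.continuous)
      subset := inter_subset_left
      contDiffOn := by
        rw [show ξ.chartPar i = monomialMap σ ∘ b from funext hpar]
        exact (contDiffOn_monomialMap σ).comp hb.contDiffOn fun p hp => hp.2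
      mapsTo := fun p hp => by
        change ξ.chartPar i p ∈ _root_.torus
        rw [hpar]; exact monomialMap_mem_torus hp.2
      par_eq := fun _ _ _ => rfl }
  have h2 : IsLocalMap ξ.atlas ξ.atlas .torus i
      (_root_.torus ∩ toricCoords σ ⁻¹' (_root_.torus ∩ {q | d q ≠ 0})) (k ∘ toricCoords σ) :=
    { isOpen := (contDiffOn_monomialMap _).continuousOn.isOpen_inter_preimage isOpen_torus ht
      subset := inter_subset_left
      contDiffOn := hk.comp ((contDiffOn_monomialMap _).mono inter_subset_left) fun p hp => hp.2
      mapsTo := fun p hp => (hbk _ hp.2.1 hp.2.2).1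
      par_eq := fun p hp _ => by
        change ξ.chartPar i (k (toricCoords σ p)) = p
        rw [hpar, (hbk _ hp.2.1 hp.2.2).2, monomialMap_toricCoords hs hp.1] }
  refine h1.ofChart_eq h2 ⟨hz, hbz⟩ ⟨hzt, ?_⟩
  rw [mem_preimage, hpar, toricCoords_monomialMap hs hbz]
  exact ⟨hbz, hdb z hz hbz⟩

instance uniformized_atlas : ξ.atlas.Uniformized where
  ofChart_eq_ofTorus i z hz hzt := by
    cases i with
    | torus => rfl
    | cone σ hσ =>
      exact ofChart_eq_ofTorus_aux hσ id contDiff_id (fun _ => rfl) (fun _ => 1) continuous_const id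
        contDiffOn_id (fun q hq _ => ⟨torus_subset_chartDom_cone hq, rfl⟩)
        (fun _ _ _ => one_ne_zero) z hz hzt
    | strict σ hσ =>
      -- In toric coordinates (a, b) one has s = b + 1 and w = a / s ^ m. The condition is that s ^
      -- m, rather than s, does not vanish: for m = 0 the points of the torus with s = 0 belong to
      -- the chart as well.
      refine ofChart_eq_ofTorus_aux hσ (fun p => (p.1 ^ ξ.m σ.1 * p.2, p.1 - 1)) (by fun_prop)
        (chartPar_strict hσ) (fun q => (q.2 + 1) ^ ξ.m σ.1) (by fun_prop)
        (fun q => (q.2 + 1, q.1 / (q.2 + 1) ^ ξ.m σ.1))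
        (ContDiffOn.prodMk (by fun_prop) (ContDiffOn.div (by fun_prop) (by fun_prop)
          fun q hq => hq.2)) ?_ ?_ z hz hzt
      · intro q hq hd
        refine ⟨?_, ?_⟩
        · rw [mem_chartDom_strict]; simpa using hq.2
        · ext
          · simp only; field_simp
          · simp
      · intro p _ hp
        have := left_ne_zero_of_mul hp.1
        simpa using this
    | exc σ hσ j =>
      refine ofChart_eq_ofTorus_aux hσ
        (fun p => ((p.1 * p.2) ^ (j : ℕ) * p.2, p.1 * p.2 - 1)) (by fun_prop)
        (chartPar_exc hσ j) (fun q => (q.2 + 1) ^ (j : ℕ)) (by fun_prop)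
        (fun q => ((q.2 + 1) ^ ((j : ℕ) + 1) / q.1, q.1 / (q.2 + 1) ^ (j : ℕ)))
        (ContDiffOn.prodMk (ContDiffOn.div (by fun_prop) (by fun_prop) fun q hq => hq.1.1)
          (ContDiffOn.div (by fun_prop) (by fun_prop) fun q hq => hq.2)) ?_ ?_ z hz hzt
      · intro q hq hd
        have h1 : (q.2 + 1) ^ ((j : ℕ) + 1) / q.1 * (q.1 / (q.2 + 1) ^ (j : ℕ)) = q.2 + 1 := by
          have := hq.1
          field_simp
          ring
        refine ⟨?_, ?_⟩
        · rw [mem_chartDom_exc, h1]; simpa using hq.2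
        · simp only [h1]
          ext
          · simp only; field_simp
          · simp
      · intro p _ hp
        have := left_ne_zero_of_mul hp.1
        simpa using this

theorem isLocalMap_strict_cone {σ : (ℤ × ℤ) × (ℤ × ℤ)} (hσ : σ ∈ ξ.cones) :
    IsLocalMap ξ.atlas ξ.atlas (.strict σ hσ) (.cone σ hσ) {p | p.1 ≠ 1 ∧ p.1 ≠ 0}
      (fun p => (p.1 ^ ξ.m σ.1 * p.2, p.1 - 1)) where
  isOpen := (isOpen_ne_fun continuous_fst continuous_const).inter
    (isOpen_ne_fun continuous_fst continuous_const)
  subset p hp := hp.1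
  contDiffOn := by fun_prop
  mapsTo p hp := by
    refine (mem_chartDom_cone (hσ := hσ)).2 ⟨fun h => hp.2 ?_, fun h => hp.1 ?_⟩
    · simpa using congrArg Prod.snd h
    · simpa [sub_eq_zero] using congrArg Prod.snd h
  par_eq p _ _ := (chartPar_strict hσ p).symm

theorem isLocalMap_cone_strict {σ : (ℤ × ℤ) × (ℤ × ℤ)} (hσ : σ ∈ ξ.cones) :
    IsLocalMap ξ.atlas ξ.atlas (.cone σ hσ) (.strict σ hσ) {p | p.2 ≠ 0 ∧ p.2 + 1 ≠ 0}
      (fun p => (p.2 + 1, p.1 / (p.2 + 1) ^ ξ.m σ.1)) where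
  isOpen := (isOpen_ne_fun continuous_snd continuous_const).inter
    (isOpen_ne_fun (by fun_prop) continuous_const)
  subset p hp := (mem_chartDom_cone (hσ := hσ)).2 ⟨fun h => hp.2 (by simp [h]), fun h => hp.1 (by simp [h])⟩
  contDiffOn := ContDiffOn.prodMk (by fun_prop) (ContDiffOn.div (by fun_prop) (by fun_prop)
    fun q hq => pow_ne_zero _ hq.2)
  mapsTo p hp := (mem_chartDom_strict (hσ := hσ)).2 (by simpa using hp.1)
  par_eq p hp _ := by
    have := hp.2
    refine (chartPar_strict hσ _).trans (congrArg (monomialMap σ) ?_)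
    ext
    · simp only; field_simp
    · simp

theorem ofChart_strict {σ : (ℤ × ℤ) × (ℤ × ℤ)} (hσ : σ ∈ ξ.cones) {p : ℂ × ℂ} (h1 : p.1 ≠ 1)
    (h0 : p.1 ≠ 0) : ξ.atlas.ofChart (.strict σ hσ) p =
      ξ.atlas.ofChart (.cone σ hσ) (p.1 ^ ξ.m σ.1 * p.2, p.1 - 1) :=
  (isLocalMap_strict_cone hσ).ofChart_eq (isLocalMap_cone_strict hσ) ⟨h1, h0⟩
    ⟨sub_ne_zero.2 h1, by simpa using h0⟩

/-- For cones with a common ray the transition only inverts the coordinate along the common boundary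
component, so it extends over the interior of this component. The removed distinguished points
correspond to each other because -1 is its own inverse. -/
theorem isLocalMap_adjacent {σ τ : (ℤ × ℤ) × (ℤ × ℤ)} (hσ : σ ∈ ξ.cones) (hτ : τ ∈ ξ.cones)
    (h : σ.1 = τ.2) :
    IsLocalMap ξ.atlas ξ.atlas (.cone τ hτ) (.cone σ hσ)
      (ξ.chartDom (.cone τ hτ) ∩ {q | q.1 ≠ 0})
      (fun q => (q.1 ^ det2 τ.1 σ.2 * q.2, q.1⁻¹)) ∧
    IsLocalMap ξ.atlas ξ.atlas (.cone σ hσ) (.cone τ hτ)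
      (ξ.chartDom (.cone σ hσ) ∩ {q | q.2 ≠ 0})
      (fun q => (q.2⁻¹, q.1 * q.2 ^ det2 τ.1 σ.2)) := by
  have h1 := ξ.smooth σ hσ
  have h2 := ξ.smooth τ hτ
  constructor
  · refine ⟨(ξ.isOpen_chartDom _).inter (isOpen_ne_fun continuous_fst continuous_const),
      inter_subset_left, ?_, ?_, ?_⟩
    · exact (((contDiffOn_zpow_fst _).mono fun p hp => hp.2).mul contDiff_snd.contDiffOn).prodMk
        (contDiff_fst.contDiffOn.inv fun p hp => hp.2)
    · rintro q ⟨hq, hq1⟩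
      refine (mem_chartDom_cone (hσ := hσ)).2 ⟨fun h => (mem_chartDom_cone.1 hq).2 ?_,
        fun h => inv_ne_zero hq1 (congrArg Prod.snd h)⟩
      simp only [Prod.mk.injEq, mul_eq_zero, zpow_ne_zero _ hq1, false_or] at h
      exact Prod.ext (by rw [← inv_inv q.1, h.2]; norm_num) h.1
    · intro q hq hqt
      have hq' : q ∈ _root_.torus := mem_torus_of_monomialMap h2 hqt
      refine Eq.trans (congrArg (monomialMap σ) ?_) (monomialMap_transition h1 τ hq')
      rw [det2_swap] at h2
      simp only [monomialMap, transition, h, det2_self]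
      rw [h] at h1
      rw [show det2 τ.2 τ.1 = -1 by omega, h1]
      simp
  · refine ⟨(ξ.isOpen_chartDom _).inter (isOpen_ne_fun continuous_snd continuous_const),
      inter_subset_left, ?_, ?_, ?_⟩
    · exact (contDiff_snd.contDiffOn.inv fun p hp => hp.2).prodMk
        (contDiff_fst.contDiffOn.mul ((contDiffOn_zpow_snd _).mono fun p hp => hp.2))
    · rintro q ⟨hq, hq1⟩
      refine (mem_chartDom_cone (hσ := hτ)).2 ⟨fun h => inv_ne_zero hq1 (congrArg Prod.fst h),
        fun h => (mem_chartDom_cone.1 hq).1 ?_⟩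
      simp only [Prod.mk.injEq, mul_eq_zero, zpow_ne_zero _ hq1, or_false] at h
      exact Prod.ext h.2 (by rw [← inv_inv q.2, h.1]; norm_num)
    · intro q hq hqt
      have hq' : q ∈ _root_.torus := mem_torus_of_monomialMap h1 hqt
      refine Eq.trans (congrArg (monomialMap τ) ?_) (monomialMap_transition h2 σ hq')
      rw [det2_swap] at h1
      simp only [monomialMap, transition, h, det2_self, h2]
      rw [h] at h1
      rw [show det2 σ.2 τ.2 = -1 by omega]
      simp

/-- These are the two charts of the last blow-up, glued by s = u v and w = u⁻¹. -/
theorem isLocalMap_exc_strict {σ : (ℤ × ℤ) × (ℤ × ℤ)} (hσ : σ ∈ ξ.cones) (j : Fin (ξ.m σ.1))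
    (hj : (j : ℕ) + 1 = ξ.m σ.1) :
    IsLocalMap ξ.atlas ξ.atlas (.exc σ hσ j) (.strict σ hσ) {p | p.1 * p.2 ≠ 1 ∧ p.1 ≠ 0}
      (fun p => (p.1 * p.2, p.1⁻¹)) ∧
    IsLocalMap ξ.atlas ξ.atlas (.strict σ hσ) (.exc σ hσ j) {p | p.1 ≠ 1 ∧ p.2 ≠ 0}
      (fun p => (p.2⁻¹, p.1 * p.2)) := by
  constructor
  · refine ⟨(isOpen_ne_fun (by fun_prop) continuous_const).inter
      (isOpen_ne_fun continuous_fst continuous_const), fun p hp => hp.1,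
      ContDiffOn.prodMk (by fun_prop) (contDiff_fst.contDiffOn.inv fun p hp => hp.2),
      fun p hp => hp.1, fun p hp _ => ?_⟩
    refine (chartPar_strict hσ _).trans (Eq.trans (congrArg (monomialMap σ) ?_)
      (chartPar_exc hσ j p).symm)
    have := hp.2
    ext
    · simp only [← hj, pow_succ]; field_simp
    · rfl
  · refine ⟨(isOpen_ne_fun (by fun_prop) continuous_const).inter
      (isOpen_ne_fun continuous_snd continuous_const), fun p hp => hp.1,
      ContDiffOn.prodMk (contDiff_snd.contDiffOn.inv fun p hp => hp.2) (by fun_prop),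
      fun p hp => ?_, fun p hp _ => ?_⟩
    · refine (mem_chartDom_exc (hσ := hσ) (j := j)).2 ?_
      have := hp.2
      have h1 : p.2⁻¹ * (p.1 * p.2) = p.1 := by field_simp
      rw [h1]; exact hp.1
    · refine (chartPar_exc hσ j _).trans (Eq.trans (congrArg (monomialMap σ) ?_)
        (chartPar_strict hσ p).symm)
      have := hp.2
      have h1 : p.2⁻¹ * (p.1 * p.2) = p.1 := by field_simp
      simp only [h1]
      ext
      · simp only [← hj]; ring
      · rfl

theorem isLocalMap_exc_exc {σ : (ℤ × ℤ) × (ℤ × ℤ)} (hσ : σ ∈ ξ.cones) (j k : Fin (ξ.m σ.1))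
    (hjk : (j : ℕ) + 1 = k) :
    IsLocalMap ξ.atlas ξ.atlas (.exc σ hσ j) (.exc σ hσ k) {p | p.1 * p.2 ≠ 1 ∧ p.1 ≠ 0}
      (fun p => (p.1 ^ 2 * p.2, p.1⁻¹)) ∧
    IsLocalMap ξ.atlas ξ.atlas (.exc σ hσ k) (.exc σ hσ j) {p | p.1 * p.2 ≠ 1 ∧ p.2 ≠ 0}
      (fun p => (p.2⁻¹, p.1 * p.2 ^ 2)) := by
  constructor
  · have key : ∀ p : ℂ × ℂ, p.1 ≠ 0 → p.1 ^ 2 * p.2 * p.1⁻¹ = p.1 * p.2 := by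
      intro p hp; field_simp
    refine ⟨(isOpen_ne_fun (by fun_prop) continuous_const).inter
      (isOpen_ne_fun continuous_fst continuous_const), fun p hp => hp.1,
      ContDiffOn.prodMk (by fun_prop) (contDiff_fst.contDiffOn.inv fun p hp => hp.2),
      fun p hp => (mem_chartDom_exc (hσ := hσ) (j := k)).2 (by simp only [key p hp.2]; exact hp.1), fun p hp _ => ?_⟩
    refine (chartPar_exc hσ k _).trans (Eq.trans (congrArg (monomialMap σ) ?_)
      (chartPar_exc hσ j p).symm)
    have := hp.2
    rw [← hjk]
    simp only [key p hp.2]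
    ext
    · simp only; field_simp; ring
    · rfl
  · have key : ∀ p : ℂ × ℂ, p.2 ≠ 0 → p.2⁻¹ * (p.1 * p.2 ^ 2) = p.1 * p.2 := by
      intro p hp; field_simp
    refine ⟨(isOpen_ne_fun (by fun_prop) continuous_const).inter
      (isOpen_ne_fun continuous_snd continuous_const), fun p hp => hp.1,
      ContDiffOn.prodMk (contDiff_snd.contDiffOn.inv fun p hp => hp.2) (by fun_prop),
      fun p hp => (mem_chartDom_exc (hσ := hσ) (j := j)).2 (by simp only [key p hp.2]; exact hp.1), fun p hp _ => ?_⟩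
    refine (chartPar_exc hσ j _).trans (Eq.trans (congrArg (monomialMap σ) ?_)
      (chartPar_exc hσ k p).symm)
    have := hp.2
    rw [← hjk]
    simp only [key p hp.2]
    ext
    · simp only; ring
    · rfl

/-! ### Points over the toric charts and over the distinguished points; the Hausdorff property. -/

/-- Every chart other than the torus lies over the toric chart of a cone. -/
inductive OverCone (ξ : CY2) : ξ.ChartIndex → (σ : (ℤ × ℤ) × (ℤ × ℤ)) → (ℂ × ℂ → ℂ × ℂ) → Prop
  | cone (σ : (ℤ × ℤ) × (ℤ × ℤ)) (hσ : σ ∈ ξ.cones) : OverCone ξ (.cone σ hσ) σ id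
  | strict (σ : (ℤ × ℤ) × (ℤ × ℤ)) (hσ : σ ∈ ξ.cones) :
    OverCone ξ (.strict σ hσ) σ (fun p => (p.1 ^ ξ.m σ.1 * p.2, p.1 - 1))
  | exc (σ : (ℤ × ℤ) × (ℤ × ℤ)) (hσ : σ ∈ ξ.cones) (j : Fin (ξ.m σ.1)) :
    OverCone ξ (.exc σ hσ j) σ (fun p => ((p.1 * p.2) ^ (j : ℕ) * p.2, p.1 * p.2 - 1))

theorem OverCone.spec {i : ξ.ChartIndex} {σ : (ℤ × ℤ) × (ℤ × ℤ)} {b : ℂ × ℂ → ℂ × ℂ}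
    (h : OverCone ξ i σ b) : σ ∈ ξ.cones ∧ Continuous b ∧
      ∀ p, ξ.chartPar i p = monomialMap σ (b p) := by
  cases h with
  | cone _ hσ => exact ⟨hσ, continuous_id, fun _ => rfl⟩
  | strict _ hσ => exact ⟨hσ, by fun_prop, chartPar_strict hσ⟩
  | exc _ hσ j => exact ⟨hσ, by fun_prop, chartPar_exc hσ j⟩

theorem limitRelation_of_haveCommonLimit {i j : ξ.ChartIndex} {σ τ : (ℤ × ℤ) × (ℤ × ℤ)}
    {b c : ℂ × ℂ → ℂ × ℂ} (hi : OverCone ξ i σ b) (hj : OverCone ξ j τ c) {p q : ℂ × ℂ}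
    (h : ξ.atlas.HaveCommonLimit i p j q) :
    SmoothCompleteFan.LimitRelation σ τ (b p) (c q) := by
  obtain ⟨hσ, hb, hbp⟩ := hi.spec
  obtain ⟨hτ, hc, hcp⟩ := hj.spec
  obtain ⟨l, f, g, hl, hf, hg, h⟩ := h
  refine SmoothCompleteFan.limitRelation (F := ξ.toSmoothCompleteFan) hσ hτ
    ((hb.tendsto p).comp hf) ((hc.tendsto q).comp hg) ?_
  filter_upwards [h] with t ht
  obtain ⟨-, -, h1, h2⟩ := ht
  change ξ.chartPar i (f t) ∈ _root_.torus at h1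
  change ξ.chartPar i (f t) = ξ.chartPar j (g t) at h2
  have h3 := h1
  rw [h2] at h3
  refine ⟨mem_torus_of_monomialMap (ξ.smooth σ hσ) (by rw [hbp] at h1; exact h1),
    mem_torus_of_monomialMap (ξ.smooth τ hτ) (by rw [hcp] at h3; exact h3), ?_⟩
  rw [Function.comp_apply, Function.comp_apply, ← hbp, ← hcp, h2]

theorem ofTorus_eq_ofChart_cone {σ : (ℤ × ℤ) × (ℤ × ℤ)} (hσ : σ ∈ ξ.cones) {t : ℂ × ℂ}
    (ht : t ∈ _root_.torus) :
    ξ.atlas.ofTorus t = ξ.atlas.ofChart (.cone σ hσ) (toricCoords σ t) := by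
  have h2 : ξ.atlas.par (.cone σ hσ) (toricCoords σ t) = t :=
    monomialMap_toricCoords (ξ.smooth σ hσ) ht
  have := Uniformized.ofChart_eq_ofTorus (A := ξ.atlas) (.cone σ hσ) (toricCoords σ t)
    (torus_subset_chartDom_cone (hσ := hσ) (toricCoords_mem_torus ht)) (by rw [h2]; exact ht)
  rw [this, h2]

theorem exists_cone (ξ : CY2) : ∃ σ, σ ∈ ξ.cones :=
  let ⟨σ, hσ, _⟩ := ξ.complete 0
  ⟨σ, hσ⟩

/-- A point lies over a distinguished point of the toric boundary. -/
inductive OverDistinguished (ξ : CY2) (σ : (ℤ × ℤ) × (ℤ × ℤ)) (hσ : σ ∈ ξ.cones) :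
    ξ.ChartIndex → ℂ × ℂ → Prop
  | strict (w : ℂ) (hw : ξ.m σ.1 = 0 → w = 0) : OverDistinguished ξ σ hσ (.strict σ hσ) (0, w)
  | exc (j : Fin (ξ.m σ.1)) (u v : ℂ) (huv : u * v = 0) (hv : (j : ℕ) = 0 → v = 0) :
    OverDistinguished ξ σ hσ (.exc σ hσ j) (u, v)

theorem OverDistinguished.spec {σ : (ℤ × ℤ) × (ℤ × ℤ)} {hσ : σ ∈ ξ.cones} {i : ξ.ChartIndex}
    {p : ℂ × ℂ} (h : OverDistinguished ξ σ hσ i p) :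
    p ∈ ξ.chartDom i ∧ ∃ b, OverCone ξ i σ b ∧ b p = (0, -1) := by
  cases h with
  | strict w hw =>
    refine ⟨mem_chartDom_strict.2 zero_ne_one, _, .strict σ hσ, ?_⟩
    rcases Nat.eq_zero_or_pos (ξ.m σ.1) with h | h
    · simp [hw h]
    · simp [h.ne']
  | exc j u v huv hv =>
    refine ⟨mem_chartDom_exc.2 (by simp [huv]), _, .exc σ hσ j, ?_⟩
    rcases Nat.eq_zero_or_pos (j : ℕ) with h | h
    · simp [hv h]
    · simp [huv, h.ne']

theorem chart_cone_or_overDistinguished {i : ξ.ChartIndex} {p : ℂ × ℂ} (hp : p ∈ ξ.chartDom i) :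
    (∃ σ, ∃ hσ : σ ∈ ξ.cones, ∃ q ∈ ξ.chartDom (.cone σ hσ),
      ξ.atlas.ofChart (.cone σ hσ) q = ξ.atlas.ofChart i p) ∨
    ∃ σ, ∃ hσ : σ ∈ ξ.cones, OverDistinguished ξ σ hσ i p := by
  have htor : ξ.chartPar i p ∈ _root_.torus → ∃ σ, ∃ hσ : σ ∈ ξ.cones,
      ∃ q ∈ ξ.chartDom (.cone σ hσ), ξ.atlas.ofChart (.cone σ hσ) q = ξ.atlas.ofChart i p := by
    intro ht
    obtain ⟨σ, hσ⟩ := ξ.exists_cone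
    exact ⟨σ, hσ, _, torus_subset_chartDom_cone (toricCoords_mem_torus ht),
      ((Uniformized.ofChart_eq_ofTorus (A := ξ.atlas) i p hp ht).trans
        (ofTorus_eq_ofChart_cone hσ ht)).symm⟩
  cases i with
  | torus => exact .inl (htor hp)
  | cone σ hσ => exact .inl ⟨σ, hσ, p, hp, rfl⟩
  | strict σ hσ =>
    by_cases h0 : p.1 = 0
    -- If nothing is blown up on this component, the curve s = 0 of the chart is b = -1 with a = w,
    -- so its points with w ≠ 0 lie in the torus.
    · by_cases hw : ξ.m σ.1 = 0 → p.2 = 0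
      · refine .inr ⟨σ, hσ, ?_⟩
        have := OverDistinguished.strict (hσ := hσ) p.2 hw
        rwa [← h0] at this
      · push Not at hw
        refine .inl (htor ?_)
        rw [chartPar_strict]
        exact monomialMap_mem_torus ⟨by simp [hw], sub_ne_zero.2 hp⟩
    · refine .inl ⟨σ, hσ, _, (isLocalMap_strict_cone hσ).mapsTo ⟨hp, h0⟩,
        (ofChart_strict hσ hp h0).symm⟩
  | exc σ hσ j =>
    by_cases h : p.1 * p.2 = 0 ∧ ((j : ℕ) = 0 → p.2 = 0)
    · exact .inr ⟨σ, hσ, OverDistinguished.exc j p.1 p.2 h.1 h.2⟩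
    · refine .inl (htor ?_)
      rw [chartPar_exc]
      refine monomialMap_mem_torus ⟨?_, sub_ne_zero.2 hp⟩
      intro h'
      apply h
      rcases mul_eq_zero.1 h' with h' | h'
      · exact ⟨pow_eq_zero_iff (fun h0 => by simp [h0] at h') |>.1 h',
          fun h0 => by simp [h0] at h'⟩
      · exact ⟨by simp [h'], fun _ => h'⟩

theorem cone_or_overDistinguished (y : ξ.Y) :
    (∃ σ, ∃ hσ : σ ∈ ξ.cones, ∃ p ∈ ξ.chartDom (.cone σ hσ), ξ.atlas.ofChart (.cone σ hσ) p = y) ∨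
    ∃ σ, ∃ hσ : σ ∈ ξ.cones, ∃ i p, OverDistinguished ξ σ hσ i p ∧ ξ.atlas.ofChart i p = y := by
  obtain ⟨i, p, hp, rfl⟩ := exists_ofChart y
  rcases chart_cone_or_overDistinguished hp with h | ⟨σ, hσ, h⟩
  · exact .inl h
  · exact .inr ⟨σ, hσ, i, p, h, rfl⟩

/-- The second point lies over (0, -1) in the cone `τ`. By `limitRelation` the first would have to
be (0, -1) in the same cone, or lie on the common component of the preceding cone. There the change
of coordinates identifies it with (-1, 0). Both points are removed from cone charts. -/
theorem not_haveCommonLimit_cone {σ τ : (ℤ × ℤ) × (ℤ × ℤ)} {hσ : σ ∈ ξ.cones} {hτ : τ ∈ ξ.cones}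
    {p q : ℂ × ℂ} (hp : p ∈ ξ.chartDom (.cone σ hσ)) {j : ξ.ChartIndex}
    (hq : OverDistinguished ξ τ hτ j q) : ¬ ξ.atlas.HaveCommonLimit (.cone σ hσ) p j q := by
  intro h
  obtain ⟨-, c, hc, hcq⟩ := hq.spec
  have h1 := limitRelation_of_haveCommonLimit (.cone σ hσ) hc h
  have hdom := mem_chartDom_cone.1 hp
  rw [hcq] at h1
  rcases h1 with h1 | h1 | h1 | ⟨h1, h2, -⟩
  · exact hdom.1 h1.2
  · exact h1.2.1 rfl
  · exact h1.2.2 rfl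
  · change p.1 ≠ 0 at h2
    have hl := isLocalMap_adjacent (ξ := ξ) hτ hσ h1.symm
    obtain ⟨l, f, g, hl', hf, hg, he⟩ := h
    have hpt := ((hl.1.contDiffOn.continuousOn.continuousAt
      (hl.1.isOpen.mem_nhds ⟨hp, h2⟩)).tendsto.comp hf)
    have hgt := (hc.spec.2.1.tendsto q).comp hg
    rw [hcq] at hgt
    have hlim : (p.1 ^ det2 σ.1 τ.2 * p.2, p.1⁻¹) = ((0, -1) : ℂ × ℂ) := by
      refine tendsto_nhds_unique hpt (hgt.congr' ?_)
      filter_upwards [he, hf (hl.1.isOpen.mem_nhds ⟨hp, h2⟩)] with t ht htN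
      have e1 := hl.1.par_eq (f t) htN ht.2.2.1
      have e2 : ξ.atlas.par j (g t) = monomialMap τ (c (g t)) := hc.spec.2.2 (g t)
      have e3 : ξ.atlas.par (.cone σ hσ) (f t) ∈ _root_.torus := ht.2.2.1
      have e4 := e3
      rw [ht.2.2.2, e2] at e4
      refine monomialMap_injOn (ξ.smooth τ hτ) (mem_torus_of_monomialMap (ξ.smooth τ hτ) e4)
        (mem_torus_of_monomialMap (ξ.smooth τ hτ) (Eq.subst (motive := (· ∈ _root_.torus)) e1.symm e3)) ?_
      rw [Function.comp_apply, ← e2, ← ht.2.2.2, ← e1]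
      rfl
    simp only [Prod.mk.injEq, mul_eq_zero, zpow_ne_zero _ h2, false_or] at hlim
    exact hdom.2 (Prod.ext (by rw [← inv_inv p.1, hlim.2]; norm_num) hlim.1)

/-- Limits in the charts around two of the exceptional curves over a distinguished point. -/
theorem exc_limit {α : Type*} {l : Filter α} [l.NeBot] {u v s w : α → ℂ} {u₀ v₀ w₀ : ℂ} {j k : ℕ}
    (hjk : j < k) (hu : Filter.Tendsto u l (𝓝 u₀)) (hv : Filter.Tendsto v l (𝓝 v₀))
    (hs : Filter.Tendsto s l (𝓝 0)) (hw : Filter.Tendsto w l (𝓝 w₀))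
    (h : ∀ᶠ t in l, u t * v t = s t ∧ (s t) ^ j * v t = (s t) ^ k * w t ∧ (s t) ^ k * w t ≠ 0) :
    j + 1 = k ∧ u₀ * w₀ = 1 ∧ v₀ = 0 := by
  obtain ⟨d, rfl⟩ := Nat.exists_eq_add_of_lt hjk
  -- Here k = j + d + 1. As s → 0 while u and w converge, the second relation forces d = 0: only
  -- consecutive charts can share such a limit.
  have h' : ∀ᶠ t in l, v t = (s t) ^ (d + 1) * w t ∧ u t * ((s t) ^ d * w t) = 1 := by
    filter_upwards [h] with t ht
    obtain ⟨h1, h2, h3⟩ := ht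
    have hs0 : s t ≠ 0 := fun h0 => h3 (by simp [h0])
    have e1 : v t = (s t) ^ (d + 1) * w t := by
      apply mul_left_cancel₀ (pow_ne_zero j hs0)
      rw [h2]; ring
    refine ⟨e1, mul_left_cancel₀ hs0 ?_⟩
    rw [mul_one]
    nth_rewrite 3 [← h1]
    rw [e1]; ring
  have l1 : u₀ * (0 ^ d * w₀) = 1 := by
    refine tendsto_nhds_unique (hu.mul ((hs.pow d).mul hw)) (tendsto_const_nhds.congr' ?_)
    filter_upwards [h'] with t ht using ht.2.symm
  have l2 : v₀ = 0 ^ (d + 1) * w₀ := by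
    refine tendsto_nhds_unique hv (((hs.pow (d + 1)).mul hw).congr' ?_)
    filter_upwards [h'] with t ht using ht.1.symm
  have hd : d = 0 := by
    by_contra hd
    simp [hd] at l1
  subst hd
  exact ⟨by ring, by simpa using l1, by simpa using l2⟩

/-- In `exc_limit` the strict chart plays the role of an exceptional chart with number `m`. -/
theorem haveCommonLimit_exc_strict {σ : (ℤ × ℤ) × (ℤ × ℤ)} {hσ : σ ∈ ξ.cones}
    {j : Fin (ξ.m σ.1)} {u v w : ℂ}
    (h : ξ.atlas.HaveCommonLimit (.exc σ hσ j) (u, v) (.strict σ hσ) (0, w)) :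
    (j : ℕ) + 1 = ξ.m σ.1 ∧ u * w = 1 ∧ v = 0 := by
  obtain ⟨l, f, g, hl, hf, hg, he⟩ := h
  have hsm := ξ.smooth σ hσ
  refine exc_limit (l := l) j.2 ((continuous_fst.tendsto _).comp hf)
    ((continuous_snd.tendsto _).comp hf) ((continuous_fst.tendsto _).comp hg)
    ((continuous_snd.tendsto _).comp hg) ?_
  filter_upwards [he]
  rintro t ⟨-, -, h1, h2⟩
  change ξ.chartPar (.exc σ hσ j) (f t) ∈ _root_.torus at h1
  change ξ.chartPar (.exc σ hσ j) (f t) = ξ.chartPar (.strict σ hσ) (g t) at h2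
  have h3 := h1
  rw [h2] at h3
  rw [chartPar_exc] at h1 h2
  rw [chartPar_strict] at h2 h3
  have t1 := mem_torus_of_monomialMap hsm h1
  have t3 := mem_torus_of_monomialMap hsm h3
  have := monomialMap_injOn hsm t1 t3 h2
  simp only [Prod.mk.injEq, sub_left_inj] at this
  obtain ⟨e1, e2⟩ := this
  simp only [Function.comp_apply]
  exact ⟨e2, by rw [← e1, e2], t3.1⟩

theorem haveCommonLimit_exc_exc {σ : (ℤ × ℤ) × (ℤ × ℤ)} {hσ : σ ∈ ξ.cones}
    {j k : Fin (ξ.m σ.1)} (hjk : (j : ℕ) < k) {u v u' w : ℂ} (hs : u' * w = 0)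
    (h : ξ.atlas.HaveCommonLimit (.exc σ hσ j) (u, v) (.exc σ hσ k) (u', w)) :
    (j : ℕ) + 1 = k ∧ u * w = 1 ∧ v = 0 := by
  obtain ⟨l, f, g, hl, hf, hg, he⟩ := h
  have hsm := ξ.smooth σ hσ
  have hg1 := (continuous_fst.tendsto _).comp hg
  have hg2 := (continuous_snd.tendsto _).comp hg
  have hgs := hg1.mul hg2
  simp only [hs] at hgs
  refine exc_limit (l := l) hjk ((continuous_fst.tendsto _).comp hf)
    ((continuous_snd.tendsto _).comp hf) hgs hg2 ?_
  filter_upwards [he]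
  rintro t ⟨-, -, h1, h2⟩
  change ξ.chartPar (.exc σ hσ j) (f t) ∈ _root_.torus at h1
  change ξ.chartPar (.exc σ hσ j) (f t) = ξ.chartPar (.exc σ hσ k) (g t) at h2
  have h3 := h1
  rw [h2] at h3
  rw [chartPar_exc] at h1 h2 h3
  rw [chartPar_exc] at h2
  have t1 := mem_torus_of_monomialMap hsm h1
  have t3 := mem_torus_of_monomialMap hsm h3
  have := monomialMap_injOn hsm t1 t3 h2
  simp only [Prod.mk.injEq, sub_left_inj] at this
  obtain ⟨e1, e2⟩ := this
  simp only [Function.comp_apply]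
  exact ⟨e2, by rw [← e1, e2], t3.1⟩

theorem cone_eq_of_haveCommonLimit {σ τ : (ℤ × ℤ) × (ℤ × ℤ)} {hσ : σ ∈ ξ.cones}
    {hτ : τ ∈ ξ.cones} {i j : ξ.ChartIndex} {p q : ℂ × ℂ} (hp : OverDistinguished ξ σ hσ i p)
    (hq : OverDistinguished ξ τ hτ j q) (h : ξ.atlas.HaveCommonLimit i p j q) : σ = τ := by
  obtain ⟨-, b, hb, hbp⟩ := hp.spec
  obtain ⟨-, c, hc, hcq⟩ := hq.spec
  have h1 := limitRelation_of_haveCommonLimit hb hc h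
  rw [hbp, hcq] at h1
  rcases h1 with h1 | h1 | h1 | h1
  · exact h1.1
  · exact absurd rfl h1.2.1
  · exact absurd rfl h1.2.2
  · exact absurd rfl h1.2.1

/-- Each point lies in a cone chart or over a distinguished point. For inseparable points the mixed
case is impossible; in the other cases the limit lemmas put the two points into the overlap of
charts that are glued there, or into a single chart or the torus, so they coincide. -/
instance t2Space_Y : T2Space ξ.atlas.Space := by
  rw [t2_iff_nhds]
  intro x y hxy
  rcases cone_or_overDistinguished x with ⟨σ, hσ, p, hp, rfl⟩ | ⟨σ, hσ, i, p, hp, rfl⟩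
  · rcases cone_or_overDistinguished y with ⟨τ, hτ, q, hq, rfl⟩ | ⟨τ, hτ, j, q, hq, rfl⟩
    · have h := haveCommonLimit (A := ξ.atlas) hp hq hxy
      rcases limitRelation_of_haveCommonLimit (.cone σ hσ) (.cone τ hτ) h with
        ⟨rfl, h1⟩ | ⟨h1, h2⟩ | ⟨h1, h2, h3⟩ | ⟨h1, h2, h3⟩
      · change p = q at h1
        rw [h1]
      · change p ∈ _root_.torus at h1
        change q ∈ _root_.torus at h2
        rw [Uniformized.ofChart_eq_ofTorus (A := ξ.atlas) (.cone σ hσ) p hp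
          (monomialMap_mem_torus h1), Uniformized.ofChart_eq_ofTorus (A := ξ.atlas) (.cone τ hτ) q hq
          (monomialMap_mem_torus h2)]
        obtain ⟨l, f, g, hl, hf, hg, he⟩ := h
        congr 1
        refine tendsto_nhds_unique ((continuousAt_monomialMap σ h1).tendsto.comp hf)
          (((continuousAt_monomialMap τ h2).tendsto.comp hg).congr' ?_)
        filter_upwards [he] with t ht using ht.2.2.2.symm
      · have hl := isLocalMap_adjacent hσ hτ h1
        exact h.ofChart_eq hl.2 hl.1 ⟨hp, h2⟩ ⟨hq, h3⟩
      · have hl := isLocalMap_adjacent hτ hσ h1.symm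
        exact h.ofChart_eq hl.1 hl.2 ⟨hp, h2⟩ ⟨hq, h3⟩
    · exact absurd (haveCommonLimit (A := ξ.atlas) hp hq.spec.1 hxy) (not_haveCommonLimit_cone hp hq)
  · rcases cone_or_overDistinguished y with ⟨τ, hτ, q, hq, rfl⟩ | ⟨τ, hτ, j, q, hq, rfl⟩
    · exact absurd (haveCommonLimit (A := ξ.atlas) hp.spec.1 hq hxy).symm
        (not_haveCommonLimit_cone hq hp)
    · have h := haveCommonLimit (A := ξ.atlas) hp.spec.1 hq.spec.1 hxy
      obtain rfl := cone_eq_of_haveCommonLimit hp hq h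
      cases hp with
      | strict w hw =>
        cases hq with
        | strict w' hw' => rw [h.eq]
        | exc j u v huv hv =>
          obtain ⟨h1, h2, h3⟩ := haveCommonLimit_exc_strict h.symm
          have hl := isLocalMap_exc_strict hσ j h1
          exact (h.symm.ofChart_eq hl.1 hl.2 ⟨by simp [huv], left_ne_zero_of_mul_eq_one h2⟩
            ⟨by simp, right_ne_zero_of_mul_eq_one h2⟩).symm
      | exc i u v huv hv =>
        cases hq with
        | strict w hw =>
          obtain ⟨h1, h2, h3⟩ := haveCommonLimit_exc_strict h
          have hl := isLocalMap_exc_strict hσ i h1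
          exact h.ofChart_eq hl.1 hl.2 ⟨by simp [huv], left_ne_zero_of_mul_eq_one h2⟩
            ⟨by simp, right_ne_zero_of_mul_eq_one h2⟩
        | exc j u' v' huv' hv' =>
          rcases lt_trichotomy (i : ℕ) j with hij | hij | hij
          · obtain ⟨h1, h2, h3⟩ := haveCommonLimit_exc_exc hij huv' h
            have hl := isLocalMap_exc_exc hσ i j h1
            exact h.ofChart_eq hl.1 hl.2 ⟨by simp [huv], left_ne_zero_of_mul_eq_one h2⟩
              ⟨by simp [huv'], right_ne_zero_of_mul_eq_one h2⟩
          · obtain rfl := Fin.ext hij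
            rw [h.eq]
          · obtain ⟨h1, h2, h3⟩ := haveCommonLimit_exc_exc hij huv h.symm
            have hl := isLocalMap_exc_exc hσ j i h1
            exact (h.symm.ofChart_eq hl.1 hl.2 ⟨by simp [huv'], left_ne_zero_of_mul_eq_one h2⟩
              ⟨by simp [huv], right_ne_zero_of_mul_eq_one h2⟩).symm

end CY2

/-! ### Lifting to blow-ups -/

/-- An analytic map vanishing at the origin can be written as `z ↦ L z z` with `L` analytic. -/
theorem AnalyticAt.exists_eventually_eq_apply_self {E F : Type*} [NormedAddCommGroup E]
    [NormedSpace ℂ E] [NormedAddCommGroup F] [NormedSpace ℂ F] [CompleteSpace F] {g : E → F}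
    (hg : AnalyticAt ℂ g 0) (h0 : g 0 = 0) :
    ∃ L : E → E →L[ℂ] F, AnalyticAt ℂ L 0 ∧ L 0 = fderiv ℂ g 0 ∧ ∀ᶠ z in 𝓝 0, g z = L z z := by
  obtain ⟨p, r, hp⟩ := hg
  have hr : 0 < p.shift.radius := by
    rw [FormalMultilinearSeries.radius_shift]
    exact hp.r_pos.trans_le hp.r_le
  -- The map `L` sums the power series of `g` with the last argument of every homogeneous term left
  -- free; the constant term is zero.
  have hL := p.shift.hasFPowerSeriesOnBall hr
  have h1 := hL.unshift (z := 0)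
  have hp0 : p 0 = (continuousMultilinearCurryFin0 ℂ E F).symm 0 := by
    ext v
    rw [hp.coeff_zero, h0]
    rfl
  have h2 : p.shift.unshift 0 = p := by
    funext n
    cases n with
    | zero => rw [hp0]; rfl
    | succ n => ext v; simp [FormalMultilinearSeries.shift, FormalMultilinearSeries.unshift]
  rw [h2] at h1
  have hev : ∀ᶠ z in 𝓝 0, g z = p.shift.sum z z := by
    have hr' : 0 < min r p.shift.radius := lt_min hp.r_pos hr
    filter_upwards [Metric.eball_mem_nhds (0 : E) hr'] with z hz
    have e1 := hp.hasSum (y := z) (Metric.eball_subset_eball (min_le_left _ _) hz)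
    have e2 := h1.hasSum (y := z) (Metric.eball_subset_eball (min_le_right _ _) hz)
    simpa using e1.unique e2
  refine ⟨p.shift.sum, hL.analyticAt, ?_, hev⟩
  have hd := hL.analyticAt.differentiableAt.hasFDerivAt.clm_apply (hasFDerivAt_id (𝕜 := ℂ) (0 : E))
  have := hd.congr_of_eventuallyEq hev
  rw [this.fderiv]
  ext v
  simp

/-- One of the two charts of the blow-up of the origin. -/
def IsBlowUpMap (β : ℂ × ℂ → ℂ × ℂ) : Prop := β = blowUpStrict ∨ β = blowUpExc

theorem IsBlowUpMap.contDiff {β : ℂ × ℂ → ℂ × ℂ} (h : IsBlowUpMap β) : ContDiff ℂ ω β := by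
  rcases h with rfl | rfl
  · unfold blowUpStrict; fun_prop
  · unfold blowUpExc; fun_prop

/-- Here `l` is an equation of the exceptional curve and `ν` a nowhere vanishing vector spanning the
line through the origin that the point represents. -/
theorem IsBlowUpMap.exists_smul {β : ℂ × ℂ → ℂ × ℂ} (h : IsBlowUpMap β) :
    ∃ (l : ℂ × ℂ → ℂ) (ν : ℂ × ℂ → ℂ × ℂ), ContDiff ℂ ω l ∧ ContDiff ℂ ω ν ∧
      (∀ v, β v = l v • ν v) ∧ ∀ v, ν v ≠ 0 := by
  rcases h with rfl | rfl
  · exact ⟨fun v => v.1, fun v => (1, v.2), by fun_prop, by fun_prop,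
      fun v => by simp [blowUpStrict], fun v h => one_ne_zero (congrArg Prod.fst h)⟩
  · exact ⟨fun v => v.2, fun v => (v.1, 1), by fun_prop, by fun_prop,
      fun v => by simp [blowUpExc, mul_comm], fun v h => one_ne_zero (congrArg Prod.snd h)⟩

/-- A local biholomorphism of the plane fixing the origin lifts to the blow-up of the origin. -/
theorem IsBlowUpMap.exists_lift {β g : ℂ × ℂ → ℂ × ℂ} (hβ : IsBlowUpMap β)
    (hg : ContDiffAt ℂ ω g 0) (h0 : g 0 = 0) (hinj : Function.Injective (fderiv ℂ g 0))
    {v₀ : ℂ × ℂ} (hv₀ : β v₀ = 0) :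
    ∃ β' r, IsBlowUpMap β' ∧ ContDiffAt ℂ ω r v₀ ∧ β' (r v₀) = 0 ∧
      ∀ᶠ v in 𝓝 v₀, g (β v) = β' (r v) := by
  obtain ⟨L, hL, hL0, hgL⟩ := hg.analyticAt.exists_eventually_eq_apply_self h0
  obtain ⟨l, ν, hl, hν, hlν, hν0⟩ := hβ.exists_smul
  have hβt : Filter.Tendsto β (𝓝 v₀) (𝓝 0) := by
    have := hβ.contDiff.continuous.tendsto v₀
    rwa [hv₀] at this
  have hl0 : l v₀ = 0 := by
    have := hlν v₀
    rw [hv₀, eq_comm, smul_eq_zero] at this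
    exact this.resolve_right (hν0 v₀)
  -- By linearity g ∘ β = l • h. At `v₀` the vector h is the derivative of g applied to a nonzero
  -- direction, hence nonzero. A nonvanishing coordinate of it selects the target chart of the
  -- blow-up, and the lift is obtained by dividing by this coordinate.
  set h : ℂ × ℂ → ℂ × ℂ := fun v => L (β v) (ν v) with hh
  have hLβ : ContDiffAt ℂ ω (fun v => L (β v)) v₀ :=
    ContDiffAt.comp v₀ (by rw [hv₀]; exact hL.contDiffAt) hβ.contDiff.contDiffAt
  have hhs : ContDiffAt ℂ ω h v₀ := hLβ.clm_apply hν.contDiffAt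
  have hh0 : h v₀ ≠ 0 := by
    simp only [hh, hv₀, hL0]
    intro h'
    exact hν0 v₀ (hinj (by rw [h', map_zero]))
  have hgh : ∀ᶠ v in 𝓝 v₀, g (β v) = l v • h v := by
    filter_upwards [hβt.eventually hgL] with v hv
    rw [hv]
    nth_rewrite 2 [hlν v]
    rw [map_smul]
  by_cases h1 : (h v₀).1 = 0
  · have h2 : (h v₀).2 ≠ 0 := fun h2 => hh0 (Prod.ext h1 h2)
    refine ⟨blowUpExc, fun v => ((h v).1 / (h v).2, l v * (h v).2), .inr rfl, ?_, ?_, ?_⟩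
    · exact (hhs.fst.div hhs.snd h2).prodMk (hl.contDiffAt.mul hhs.snd)
    · simp [blowUpExc, hl0]
    · have hc : ∀ᶠ v in 𝓝 v₀, (h v).2 ≠ 0 :=
        (hhs.continuousAt.snd).eventually_ne h2
      filter_upwards [hgh, hc] with v hv hv2
      rw [hv]
      ext
      · simp only [blowUpExc, Prod.smul_fst, smul_eq_mul]; field_simp
      · simp [blowUpExc]
  · refine ⟨blowUpStrict, fun v => (l v * (h v).1, (h v).2 / (h v).1), .inl rfl, ?_, ?_, ?_⟩
    · exact (hl.contDiffAt.mul hhs.fst).prodMk (hhs.snd.div hhs.fst h1)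
    · simp [blowUpStrict, hl0]
    · have hc : ∀ᶠ v in 𝓝 v₀, (h v).1 ≠ 0 :=
        (hhs.continuousAt.fst).eventually_ne h1
      filter_upwards [hgh, hc] with v hv hv2
      rw [hv]
      ext
      · simp [blowUpStrict]
      · simp only [blowUpStrict, Prod.smul_snd, smul_eq_mul]; field_simp

/-! ### Blow-ups of a point and the lifting of biholomorphisms. -/

namespace TorusAtlas

/-- The map `p` is the blow-up of the point with coordinates `(0, 0)` in the chart `i`. -/
structure IsBlowUp (A B : TorusAtlas) (p : B.Space → A.Space) (i : A.Index) : Prop where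
  zero_mem : (0 : ℂ × ℂ) ∈ A.dom i
  contMDiff : ContMDiff 𝓘(ℂ, ℂ × ℂ) 𝓘(ℂ, ℂ × ℂ) ω p
  map_ofTorus : ∀ t ∈ torus, p (B.ofTorus t) = A.ofTorus t
  ofTorus_ne : ∀ t ∈ torus, A.ofTorus t ≠ A.ofChart i 0
  exists_section : ∃ q : A.Space → B.Space,
    ContMDiffOn 𝓘(ℂ, ℂ × ℂ) 𝓘(ℂ, ℂ × ℂ) ω q {A.ofChart i 0}ᶜ ∧
      ∀ t ∈ torus, q (A.ofTorus t) = B.ofTorus t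
  exists_coordinates : ∀ y, p y = A.ofChart i 0 → ∃ (d : B.Space → ℂ × ℂ) (β : ℂ × ℂ → ℂ × ℂ),
    IsBlowUpMap β ∧ ContMDiffAt 𝓘(ℂ, ℂ × ℂ) 𝓘(ℂ, ℂ × ℂ) ω d y ∧ β (d y) = 0 ∧
      ∀ᶠ z in 𝓝 y, p z = A.ofChart i (β (d z))
  exists_lift : ∀ β, IsBlowUpMap β → ∀ v, β v = 0 → ∃ c : ℂ × ℂ → B.Space,
    ContMDiffAt 𝓘(ℂ, ℂ × ℂ) 𝓘(ℂ, ℂ × ℂ) ω c v ∧ ∀ᶠ z in 𝓝 v, p (c z) = A.ofChart i (β z)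

variable {A B A' B' : TorusAtlas}

theorem IsBlowUp.isOpen_preimage [T2Space A.Space] {p : B.Space → A.Space} {i : A.Index} (h : IsBlowUp A B p i) :
    IsOpen (p ⁻¹' {A.ofChart i 0}ᶜ) :=
  isOpen_compl_singleton.preimage h.contMDiff.continuous

theorem IsBlowUp.dense_preimage [B.Uniformized] {p : B.Space → A.Space} {i : A.Index} (h : IsBlowUp A B p i) :
    Dense (p ⁻¹' {A.ofChart i 0}ᶜ) := by
  refine dense_ofTorus_image.mono ?_
  rintro _ ⟨t, ht, rfl⟩
  rw [mem_preimage, h.map_ofTorus t ht]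
  exact h.ofTorus_ne t ht

/-- The section and `p` are both the identity on the dense torus, hence inverse to each other off
the centre and its preimage. -/
theorem IsBlowUp.exists_inverse [A.Uniformized] [B.Uniformized] [T2Space A.Space]
    [T2Space B.Space] {p : B.Space → A.Space} {i : A.Index} (h : IsBlowUp A B p i) :
    ∃ q : A.Space → B.Space, ContMDiffOn 𝓘(ℂ, ℂ × ℂ) 𝓘(ℂ, ℂ × ℂ) ω q {A.ofChart i 0}ᶜ ∧
      (∀ x, x ≠ A.ofChart i 0 → p (q x) = x) ∧ ∀ y, p y ≠ A.ofChart i 0 → q (p y) = y := by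
  obtain ⟨q, hq, hqt⟩ := h.exists_section
  refine ⟨q, hq, ?_, ?_⟩
  · refine eqOn_of_eqOn_ofTorus (g := id) isOpen_compl_singleton
      (h.contMDiff.continuous.comp_continuousOn hq.continuousOn) continuousOn_id ?_
    intro t ht _
    rw [hqt t ht, h.map_ofTorus t ht]; rfl
  · refine eqOn_of_eqOn_ofTorus (f := fun y => q (p y)) (g := id) h.isOpen_preimage
      (hq.continuousOn.comp h.contMDiff.continuous.continuousOn fun y hy => hy)
      continuousOn_id ?_
    intro t ht _
    rw [h.map_ofTorus t ht, hqt t ht]; rfl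

/-- A biholomorphism in the coordinates of charts. -/
theorem exists_coordinate_expression {i : A.Index} {i' : A'.Index} (hi : (0 : ℂ × ℂ) ∈ A.dom i)
    (hi' : (0 : ℂ × ℂ) ∈ A'.dom i')
    (Φ : Diffeomorph 𝓘(ℂ, ℂ × ℂ) 𝓘(ℂ, ℂ × ℂ) A.Space A'.Space ω)
    (hΦ : Φ (A.ofChart i 0) = A'.ofChart i' 0) :
    ∃ g : ℂ × ℂ → ℂ × ℂ, ContDiffAt ℂ ω g 0 ∧ g 0 = 0 ∧ Function.Injective (fderiv ℂ g 0) ∧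
      ∀ᶠ z in 𝓝 0, Φ (A.ofChart i z) = A'.ofChart i' (g z) := by
  have key : ∀ {A A' : TorusAtlas} {i : A.Index} {i' : A'.Index} (_ : (0 : ℂ × ℂ) ∈ A.dom i)
      (_ : (0 : ℂ × ℂ) ∈ A'.dom i')
      (Φ : Diffeomorph 𝓘(ℂ, ℂ × ℂ) 𝓘(ℂ, ℂ × ℂ) A.Space A'.Space ω)
      (_ : Φ (A.ofChart i 0) = A'.ofChart i' 0),
      ContDiffAt ℂ ω (fun z => chart i' (Φ (A.ofChart i z))) 0 ∧
      chart i' (Φ (A.ofChart i 0)) = 0 ∧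
      ∀ᶠ z in 𝓝 0, Φ (A.ofChart i z) = A'.ofChart i' (chart i' (Φ (A.ofChart i z))) := by
    intro A A' i i' hi hi' Φ hΦ
    have ho : A'.ofChart i' '' A'.dom i' ∈ 𝓝 (Φ (A.ofChart i 0)) := by
      rw [hΦ]
      exact (isOpen_ofChart_image (A'.isOpen_dom i') subset_rfl).mem_nhds (mem_image_of_mem _ hi')
    have h1 : ContMDiffAt 𝓘(ℂ, ℂ × ℂ) 𝓘(ℂ, ℂ × ℂ) ω (fun z => Φ (A.ofChart i z)) 0 :=
      (Φ.contMDiff.contMDiffAt).comp 0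
        ((contMDiffOn_ofChart i).contMDiffAt ((A.isOpen_dom i).mem_nhds hi))
    refine ⟨?_, by rw [hΦ, chart_ofChart hi'], ?_⟩
    · rw [← contMDiffAt_iff_contDiffAt]
      exact ((contMDiffOn_chart i').contMDiffAt ho).comp 0 h1
    · filter_upwards [h1.continuousAt ho] with z hz
      obtain ⟨w, hw, hwz⟩ := hz
      simp only at hwz
      rw [← hwz, chart_ofChart hw]
  have hΦ' : Φ.symm (A'.ofChart i' 0) = A.ofChart i 0 := by rw [← hΦ, Φ.symm_apply_apply]
  obtain ⟨g1, g2, g3⟩ := key hi hi' Φ hΦ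
  obtain ⟨k1, k2, k3⟩ := key hi' hi Φ.symm hΦ'
  refine ⟨_, g1, g2, ?_, g3⟩
  set g := fun z => chart i' (Φ (A.ofChart i z)) with hg
  set k := fun z => chart i (Φ.symm (A'.ofChart i' z)) with hk
  -- By the chain rule the derivative of `k`, the coordinate expression of the inverse, is a left
  -- inverse of that of `g`.
  have hkg : ∀ᶠ z in 𝓝 (0 : ℂ × ℂ), k (g z) = z := by
    filter_upwards [g3, (A.isOpen_dom i).mem_nhds hi] with z hz hzi
    simp only [hk]
    rw [← hz, Φ.symm_apply_apply, chart_ofChart hzi]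
  have hω : (ω : WithTop ℕ∞) ≠ 0 := by simp
  have dg := (g1.differentiableAt hω).hasFDerivAt
  have dk : HasFDerivAt k (fderiv ℂ k 0) (g 0) := by
    rw [show g 0 = 0 from g2]
    exact (k1.differentiableAt hω).hasFDerivAt
  have h2 := (dk.comp 0 dg).congr_of_eventuallyEq (f₁ := id)
    (by filter_upwards [hkg] with z hz using hz.symm)
  have h3 := h2.unique (hasFDerivAt_id (𝕜 := ℂ) (0 : ℂ × ℂ))
  intro v w hvw
  have := congrArg (fderiv ℂ k 0) hvw
  rw [← ContinuousLinearMap.comp_apply, ← ContinuousLinearMap.comp_apply, h3] at this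
  exact this

/-- A biholomorphism which maps the centre of a blow-up to the centre of a blow-up can be
lifted. -/
theorem IsBlowUp.exists_contMDiff_lift [A.Uniformized] [B.Uniformized] [A'.Uniformized]
    [B'.Uniformized] [T2Space A.Space] [T2Space B.Space] [T2Space A'.Space] [T2Space B'.Space]
    {p : B.Space → A.Space} {i : A.Index}
    (h : IsBlowUp A B p i) {p' : B'.Space → A'.Space} {i' : A'.Index} (h' : IsBlowUp A' B' p' i')
    (Φ : Diffeomorph 𝓘(ℂ, ℂ × ℂ) 𝓘(ℂ, ℂ × ℂ) A.Space A'.Space ω)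
    (hΦ : Φ (A.ofChart i 0) = A'.ofChart i' 0) :
    ∃ Ψ : B.Space → B'.Space, ContMDiff 𝓘(ℂ, ℂ × ℂ) 𝓘(ℂ, ℂ × ℂ) ω Ψ ∧
      ∀ y, p' (Ψ y) = Φ (p y) := by
  obtain ⟨q', hq', hpq', hqp'⟩ := h'.exists_inverse
  have hne : ∀ y, p y ≠ A.ofChart i 0 → Φ (p y) ≠ A'.ofChart i' 0 := by
    intro y hy hy'
    rw [← hΦ] at hy'
    exact hy (Φ.injective hy')
  obtain ⟨Ψ, hΨ, hΨ'⟩ := exists_contMDiffOn_of_locally (A := B) (B := B') (O := univ)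
    h.dense_preimage (fun y => q' (Φ (p y))) (by
      intro y _
      -- Over the centre, the coordinate expression of Φ is lifted through the blow-up charts and
      -- gives `c ∘ r ∘ d`; elsewhere `q' ∘ Φ ∘ p` serves. The two agree off the exceptional set
      -- because `q'` inverts `p'` there.
      by_cases hy : p y = A.ofChart i 0
      · obtain ⟨d, β, hβ, hd, hβd, hpd⟩ := h.exists_coordinates y hy
        obtain ⟨g, hg, hg0, hginj, hΦg⟩ := exists_coordinate_expression h.zero_mem h'.zero_mem Φ hΦ
        obtain ⟨β', r, hβ', hr, hβr, hgr⟩ := hβ.exists_lift hg hg0 hginj hβd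
        obtain ⟨c, hc, hpc⟩ := h'.exists_lift β' hβ' _ hβr
        have hrd : ContMDiffAt 𝓘(ℂ, ℂ × ℂ) 𝓘(ℂ, ℂ × ℂ) ω (fun z => r (d z)) y :=
          hr.contMDiffAt.comp y hd
        have hcrd : ContMDiffAt 𝓘(ℂ, ℂ × ℂ) 𝓘(ℂ, ℂ × ℂ) ω (fun z => c (r (d z))) y :=
          ContMDiffAt.comp y hc hrd
        have hβd0 : Filter.Tendsto (fun z => β (d z)) (𝓝 y) (𝓝 0) := by
          have := (hβ.contDiff.continuous.continuousAt (x := d y)).tendsto.comp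
            hd.continuousAt.tendsto
          rwa [hβd] at this
        have hev : ∀ᶠ z in 𝓝 y, p' (c (r (d z))) = Φ (p z) := by
          filter_upwards [hpd, hd.continuousAt.eventually hgr, hrd.continuousAt.eventually hpc,
            hβd0.eventually hΦg] with z h1 h2 h3 h4
          rw [h3, h1, h4, h2]
        have hev2 : ∀ᶠ z in 𝓝 y, ContMDiffAt 𝓘(ℂ, ℂ × ℂ) 𝓘(ℂ, ℂ × ℂ) ω
            (fun z => c (r (d z))) z := by
          obtain ⟨u, hu, hcu⟩ := contMDiffAt_iff_contMDiffOn_nhds (by simp) |>.1 hcrd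
          filter_upwards [eventually_mem_nhds_iff.2 hu] with z hz using hcu.contMDiffAt hz
        obtain ⟨N, hN, hNo, hyN⟩ := eventually_nhds_iff.1 (hev.and hev2)
        refine ⟨N, hNo, hyN, _, fun z hz => (hN z hz).2.contMDiffWithinAt, ?_⟩
        rintro z ⟨hz, hzp⟩
        have hz' := hne z hzp
        rw [← (hN z hz).1] at hz' ⊢
        exact (hqp' _ hz').symm
      · refine ⟨p ⁻¹' {A.ofChart i 0}ᶜ, h.isOpen_preimage, hy, fun y => q' (Φ (p y)), ?_,
          fun _ _ => rfl⟩
        exact hq'.comp ((Φ.contMDiff.comp h.contMDiff).contMDiffOn) fun z hz => hne z hz)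
  rw [contMDiffOn_univ] at hΨ
  refine ⟨Ψ, hΨ, fun y => ?_⟩
  have hcont : Continuous fun y => p' (Ψ y) := h'.contMDiff.continuous.comp hΨ.continuous
  have hcont' : Continuous fun y => Φ (p y) := Φ.continuous.comp h.contMDiff.continuous
  refine congrFun (hcont.ext_on h.dense_preimage hcont' ?_) y
  intro z hz
  simp only
  rw [hΨ' z ⟨trivial, hz⟩, hpq' _ (hne z hz)]

/-- The lifts of Φ and of its inverse have composites covering the identity. These are the identity
off the exceptional sets, where the blow-down maps are injective, and everywhere by density. -/
theorem IsBlowUp.exists_diffeomorph [A.Uniformized] [B.Uniformized] [A'.Uniformized]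
    [B'.Uniformized] [T2Space A.Space] [T2Space B.Space] [T2Space A'.Space] [T2Space B'.Space]
    {p : B.Space → A.Space} {i : A.Index}
    (h : IsBlowUp A B p i) {p' : B'.Space → A'.Space} {i' : A'.Index} (h' : IsBlowUp A' B' p' i')
    (Φ : Diffeomorph 𝓘(ℂ, ℂ × ℂ) 𝓘(ℂ, ℂ × ℂ) A.Space A'.Space ω)
    (hΦ : Φ (A.ofChart i 0) = A'.ofChart i' 0) :
    ∃ Ψ : Diffeomorph 𝓘(ℂ, ℂ × ℂ) 𝓘(ℂ, ℂ × ℂ) B.Space B'.Space ω,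
      ∀ y, p' (Ψ y) = Φ (p y) := by
  have hΦ' : Φ.symm (A'.ofChart i' 0) = A.ofChart i 0 := by rw [← hΦ, Φ.symm_apply_apply]
  obtain ⟨Ψ, hΨ, hpΨ⟩ := h.exists_contMDiff_lift h' Φ hΦ
  obtain ⟨Θ, hΘ, hpΘ⟩ := h'.exists_contMDiff_lift h Φ.symm hΦ'
  obtain ⟨q, -, -, hq⟩ := h.exists_inverse
  obtain ⟨q', -, -, hq'⟩ := h'.exists_inverse
  refine ⟨{ toFun := Ψ, invFun := Θ, left_inv := ?_, right_inv := ?_,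
            contMDiff_toFun := hΨ, contMDiff_invFun := hΘ }, hpΨ⟩
  · refine congrFun (Continuous.ext_on (f := fun y => Θ (Ψ y)) (g := id) h.dense_preimage
      (hΘ.continuous.comp hΨ.continuous) continuous_id fun y hy => ?_)
    have e : p (Θ (Ψ y)) = p y := by rw [hpΘ, hpΨ, Φ.symm_apply_apply]
    have e' := hq (Θ (Ψ y)) (by rw [e]; exact hy)
    rw [e, hq y hy] at e'
    exact e'.symm
  · refine congrFun (Continuous.ext_on (f := fun y => Ψ (Θ y)) (g := id) h'.dense_preimage
      (hΨ.continuous.comp hΘ.continuous) continuous_id fun y hy => ?_)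
    have e : p' (Ψ (Θ y)) = p' y := by rw [hpΨ, hpΘ, Φ.apply_symm_apply]
    have e' := hq' (Ψ (Θ y)) (by rw [e]; exact hy)
    rw [e, hq' y hy] at e'
    exact e'.symm

end TorusAtlas

/-! ### Recognising blow-ups in charts. -/

namespace TorusAtlas

/-- A criterion for blow-ups in terms of compatible maps of charts. -/
theorem exists_isBlowUp {A B : TorusAtlas} [A.Uniformized] [B.Uniformized] [T2Space A.Space]
    [T2Space B.Space] {i₀ : A.Index} (h0 : (0 : ℂ × ℂ) ∈ A.dom i₀)
    (ht : ∀ t ∈ torus, A.ofTorus t ≠ A.ofChart i₀ 0)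
    (hp : ∀ i, ∀ p ∈ B.dom i,
      (∃ N β F, IsBlowUpMap β ∧ ContDiffOn ℂ ω F N ∧
        IsLocalMap B A i i₀ N (fun z => β (F z)) ∧ p ∈ N) ∨
      ∃ j N k, IsLocalMap B A i j N k ∧ p ∈ N ∧ A.ofChart j (k p) ≠ A.ofChart i₀ 0)
    (hq : ∀ i, ∀ p ∈ A.dom i, A.ofChart i p ≠ A.ofChart i₀ 0 → ∃ j N k,
      IsLocalMap A B i j N k ∧ p ∈ N)
    (hl : ∀ β, IsBlowUpMap β → ∀ v, β v = 0 → ∃ i N h c, IsLocalMap B A i i₀ N h ∧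
      ContDiffAt ℂ ω c v ∧ c v ∈ N ∧ ∀ᶠ z in 𝓝 v, h (c z) = β z) :
    ∃ p, IsBlowUp A B p i₀ := by
  obtain ⟨p, hpd, hpt⟩ := exists_contMDiffOn_of_isLocalMap (A := B) (B := A) (O := univ) (by
    intro i z hz _
    rcases hp i z hz with ⟨N, β, F, -, -, h, hzN⟩ | ⟨j, N, k, h, hzN, -⟩
    · exact ⟨_, _, _, h, hzN⟩
    · exact ⟨_, _, _, h, hzN⟩)
  obtain ⟨q, hqd, hqt⟩ := exists_contMDiffOn_of_isLocalMap (A := A) (B := B)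
    (O := {A.ofChart i₀ 0}ᶜ) (fun i z hz hzO => hq i z hz hzO)
  have hmap : ∀ {i j N k}, IsLocalMap B A i j N k → ∀ z ∈ N,
      p (B.ofChart i z) = A.ofChart j (k z) := fun hk z hz =>
    hk.map_ofChart isOpen_univ hpd.continuousOn hpt hz trivial
  rw [contMDiffOn_univ] at hpd
  refine ⟨p, h0, hpd, fun t ht => hpt t ht trivial, ht, ⟨q, hqd, fun t ht' => hqt t ht' (ht t ht')⟩,
    ?_, ?_⟩
  · intro y hy
    obtain ⟨i, z, hz, rfl⟩ := exists_ofChart y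
    -- The second alternative is ruled out as the point lies over the centre; in the first, `F` read
    -- in the chart supplies the blow-up coordinates.
    rcases hp i z hz with ⟨N, β, F, hβ, hF, h, hzN⟩ | ⟨j, N, k, h, hzN, hne⟩
    · have hN : B.ofChart i '' N ∈ 𝓝 (B.ofChart i z) :=
        (isOpen_ofChart_image h.isOpen h.subset).mem_nhds (mem_image_of_mem _ hzN)
      refine ⟨fun y => F (chart i y), β, hβ, ?_, ?_, ?_⟩
      · have h1 : ContMDiffAt 𝓘(ℂ, ℂ × ℂ) 𝓘(ℂ, ℂ × ℂ) ω (chart i) (B.ofChart i z) :=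
          ((contMDiffOn_chart i).mono (image_mono h.subset)).contMDiffAt hN
        refine ContMDiffAt.comp (I' := 𝓘(ℂ, ℂ × ℂ)) (B.ofChart i z) ?_ h1
        rw [chart_ofChart hz]
        exact (hF.contDiffAt (h.isOpen.mem_nhds hzN)).contMDiffAt
      · simp only [chart_ofChart hz]
        have h2 := (hmap h z hzN).symm.trans hy
        have h3 := congrArg (chart i₀) h2
        rwa [chart_ofChart (h.mapsTo hzN), chart_ofChart h0] at h3
      · filter_upwards [hN]
        rintro _ ⟨w, hw, rfl⟩
        rw [hmap h w hw, chart_ofChart (h.subset hw)]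
    · exact absurd ((hmap h z hzN).symm.trans hy) hne
  · intro β hβ v hv
    obtain ⟨i, N, h, c, hh, hc, hcN, hev⟩ := hl β hβ v hv
    refine ⟨fun z => B.ofChart i (c z), ?_, ?_⟩
    · exact ContMDiffAt.comp (I' := 𝓘(ℂ, ℂ × ℂ)) v ((contMDiffOn_ofChart i).contMDiffAt
        ((B.isOpen_dom i).mem_nhds (hh.subset hcN))) hc.contMDiffAt
    · filter_upwards [hev, hc.continuousAt (hh.isOpen.mem_nhds hcN)] with z hz hzN
      rw [hmap hh _ hzN, hz]

end TorusAtlas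

/-! ### The centres of the blow-up steps. -/

open TorusAtlas

namespace CY2

variable {ξ η : CY2}

/-- Both toric coordinates of a corner vanish, while every alternative of `LimitRelation` except
equality asks for a nonzero one. Strict and exceptional charts are excluded since b = s - 1 ≠ 0
there. So only one chart sees the corner. -/
theorem ofChart_eq_corner {σ₀ : (ℤ × ℤ) × (ℤ × ℤ)} (hσ₀ : σ₀ ∈ ξ.cones) {i : ξ.ChartIndex}
    {p : ℂ × ℂ} (hp : p ∈ ξ.chartDom i)
    (h : ξ.atlas.ofChart i p = ξ.atlas.ofChart (.cone σ₀ hσ₀) 0) :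
    i = .cone σ₀ hσ₀ ∧ p = 0 := by
  have h0 : (0 : ℂ × ℂ) ∈ ξ.atlas.dom (.cone σ₀ hσ₀) :=
    (mem_chartDom_cone (hσ := hσ₀)).2 ⟨by simp [Prod.ext_iff], by simp [Prod.ext_iff]⟩
  have key : ∀ {σ b i p}, OverCone ξ i σ b → p ∈ ξ.chartDom i →
      ξ.atlas.ofChart i p = ξ.atlas.ofChart (.cone σ₀ hσ₀) 0 → σ = σ₀ ∧ b p = 0 := by
    intro σ b i p hb hp h
    have h1 := limitRelation_of_haveCommonLimit hb (.cone σ₀ hσ₀)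
      (haveCommonLimit_of_eq (A := ξ.atlas) hp h0 h)
    rcases h1 with h1 | h1 | h1 | h1
    · exact h1
    · exact absurd rfl h1.2.1
    · exact absurd rfl h1.2.2
    · exact absurd rfl h1.2.2
  cases i with
  | torus =>
    have hp' : p ∈ _root_.torus := hp
    have h1 := ofTorus_eq_ofChart_cone hσ₀ hp'
    have h2 := toricCoords_mem_torus (σ := σ₀) hp'
    have h3 := key (.cone σ₀ hσ₀) (torus_subset_chartDom_cone h2) (h1.symm.trans h)
    exact absurd (congrArg Prod.fst h3.2) h2.1
  | cone σ hσ =>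
    obtain ⟨rfl, h1⟩ := key (.cone σ hσ) hp h
    exact ⟨rfl, h1⟩
  | strict σ hσ =>
    have h1 := key (.strict σ hσ) hp h
    exact absurd (sub_eq_zero.1 (congrArg Prod.snd h1.2)) hp
  | exc σ hσ j =>
    have h1 := key (.exc σ hσ j) hp h
    exact absurd (sub_eq_zero.1 (congrArg Prod.snd h1.2)) hp

theorem zero_mem_cone {σ₀ : (ℤ × ℤ) × (ℤ × ℤ)} (hσ₀ : σ₀ ∈ ξ.cones) :
    (0 : ℂ × ℂ) ∈ ξ.atlas.dom (.cone σ₀ hσ₀) :=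
  (mem_chartDom_cone (hσ := hσ₀)).2 ⟨by simp [Prod.ext_iff], by simp [Prod.ext_iff]⟩

theorem zero_mem_strict {σ₀ : (ℤ × ℤ) × (ℤ × ℤ)} (hσ₀ : σ₀ ∈ ξ.cones) :
    (0 : ℂ × ℂ) ∈ ξ.atlas.dom (.strict σ₀ hσ₀) :=
  (mem_chartDom_strict (hσ := hσ₀)).2 (by simp)

/-- The origin of the strict chart is where the strict transform of the component meets the last
exceptional curve (the distinguished point itself if `m` is 0), hence the next centre. An
exceptional chart meets s = 0 in the strict chart only where u w = 1, so not at w = 0. -/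
theorem ofChart_eq_distinguished {σ₀ : (ℤ × ℤ) × (ℤ × ℤ)} (hσ₀ : σ₀ ∈ ξ.cones) {i : ξ.ChartIndex}
    {p : ℂ × ℂ} (hp : p ∈ ξ.chartDom i)
    (h : ξ.atlas.ofChart i p = ξ.atlas.ofChart (.strict σ₀ hσ₀) 0) : i = .strict σ₀ hσ₀ := by
  have h0 : OverDistinguished ξ σ₀ hσ₀ (.strict σ₀ hσ₀) 0 := .strict 0 fun _ => rfl
  have hd : (0 : ℂ × ℂ) ∈ ξ.atlas.dom (.strict σ₀ hσ₀) := zero_mem_strict hσ₀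
  rcases chart_cone_or_overDistinguished hp with ⟨τ, hτ, q, hq, hqp⟩ | ⟨τ, hτ, hd'⟩
  · exact absurd (haveCommonLimit_of_eq (A := ξ.atlas) hq hd (hqp.trans h))
      (not_haveCommonLimit_cone hq h0)
  · have hl := haveCommonLimit_of_eq (A := ξ.atlas) hp hd h
    obtain rfl := cone_eq_of_haveCommonLimit hd' h0 hl
    cases hd' with
    | strict => rfl
    | exc j u v =>
      have := (haveCommonLimit_exc_strict hl).2.1
      simp at this

theorem ofTorus_ne_corner {σ₀ : (ℤ × ℤ) × (ℤ × ℤ)} (hσ₀ : σ₀ ∈ ξ.cones) :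
    ∀ t ∈ _root_.torus, ξ.atlas.ofTorus t ≠ ξ.atlas.ofChart (.cone σ₀ hσ₀) 0 :=
  fun _ ht h => ChartIndex.noConfusion rfl (heq_of_eq (ofChart_eq_corner hσ₀ (i := .torus) ht h).1)

theorem ofTorus_ne_distinguished {σ₀ : (ℤ × ℤ) × (ℤ × ℤ)} (hσ₀ : σ₀ ∈ ξ.cones) :
    ∀ t ∈ _root_.torus, ξ.atlas.ofTorus t ≠ ξ.atlas.ofChart (.strict σ₀ hσ₀) 0 :=
  fun _ ht h => ChartIndex.noConfusion rfl
    (heq_of_eq (ofChart_eq_distinguished hσ₀ (i := .torus) ht h))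

/-! ### Charts shared by two surfaces -/

theorem isLocalMap_torus (ξ η : CY2) :
    IsLocalMap ξ.atlas η.atlas .torus .torus _root_.torus id :=
  ⟨isOpen_torus, subset_rfl, contDiffOn_id, fun _ hp => hp, fun _ _ _ => rfl⟩

theorem isLocalMap_cone {σ : (ℤ × ℤ) × (ℤ × ℤ)} (hσ : σ ∈ ξ.cones) (hσ' : σ ∈ η.cones) :
    IsLocalMap ξ.atlas η.atlas (.cone σ hσ) (.cone σ hσ') (ξ.chartDom (.cone σ hσ)) id :=
  ⟨ξ.isOpen_chartDom _, subset_rfl, contDiffOn_id, fun _ hp => hp, fun _ _ _ => rfl⟩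

theorem isLocalMap_strict {σ : (ℤ × ℤ) × (ℤ × ℤ)} (hσ : σ ∈ ξ.cones) (hσ' : σ ∈ η.cones)
    (hm : ξ.m σ.1 = η.m σ.1) :
    IsLocalMap ξ.atlas η.atlas (.strict σ hσ) (.strict σ hσ') (ξ.chartDom (.strict σ hσ)) id :=
  ⟨ξ.isOpen_chartDom _, subset_rfl, contDiffOn_id, fun _ hp => hp,
    fun p _ _ => (chartPar_strict hσ' p).trans (by rw [← hm]; exact (chartPar_strict hσ p).symm)⟩

theorem isLocalMap_exc {σ : (ℤ × ℤ) × (ℤ × ℤ)} (hσ : σ ∈ ξ.cones) (hσ' : σ ∈ η.cones)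
    (j : Fin (ξ.m σ.1)) (hj : (j : ℕ) < η.m σ.1) :
    IsLocalMap ξ.atlas η.atlas (.exc σ hσ j) (.exc σ hσ' ⟨j, hj⟩)
      (ξ.chartDom (.exc σ hσ j)) id :=
  ⟨ξ.isOpen_chartDom _, subset_rfl, contDiffOn_id, fun _ hp => hp,
    fun p _ _ => (chartPar_exc hσ' ⟨j, hj⟩ p).trans (chartPar_exc hσ j p).symm⟩

/-! ### Interior blow-ups -/

/-- The new strict chart and the new last exceptional chart at this ray are exactly the two charts
of the blow-up of the origin of the old strict chart. The remaining charts are shared by both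
surfaces and miss the centre. -/
theorem exists_isBlowUp_interior {σ₀ : (ℤ × ℤ) × (ℤ × ℤ)} (hσ₀ : σ₀ ∈ ξ.cones)
    (hcones : η.cones = ξ.cones) (hm : η.m = Function.update ξ.m σ₀.1 (ξ.m σ₀.1 + 1)) :
    ∃ p, IsBlowUp ξ.atlas η.atlas p (.strict σ₀ hσ₀) := by
  have hc : ∀ {σ}, σ ∈ η.cones → σ ∈ ξ.cones := fun h => hcones ▸ h
  have hc' : ∀ {σ}, σ ∈ ξ.cones → σ ∈ η.cones := fun h => hcones.symm ▸ h
  have hm0 : η.m σ₀.1 = ξ.m σ₀.1 + 1 := by rw [hm, Function.update_self]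
  have hm1 : ∀ {σ}, σ ∈ ξ.cones → σ ≠ σ₀ → η.m σ.1 = ξ.m σ.1 := fun hσ hne => by
    rw [hm, Function.update_of_ne]
    exact fun h => hne (ξ.eq_of_fst_eq hσ hσ₀ h)
  have hle : ∀ n, ξ.m n ≤ η.m n := fun n => by
    by_cases h : n = σ₀.1
    · rw [h, hm0]; omega
    · rw [hm, Function.update_of_ne h]
  have hS : IsLocalMap η.atlas ξ.atlas (.strict σ₀ (hc' hσ₀)) (.strict σ₀ hσ₀)
      (η.chartDom (.strict σ₀ (hc' hσ₀))) (fun z => blowUpStrict (id z)) :=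
    ⟨η.isOpen_chartDom _, subset_rfl, by unfold blowUpStrict; fun_prop, fun _ hp => hp,
      fun p _ _ => (chartPar_strict hσ₀ _).trans (Eq.trans (by
        rw [hm0]; simp only [blowUpStrict, id]; ring_nf) (chartPar_strict (hc' hσ₀) p).symm)⟩
  have hlast : ξ.m σ₀.1 < η.m σ₀.1 := by omega
  have hE : IsLocalMap η.atlas ξ.atlas (.exc σ₀ (hc' hσ₀) ⟨ξ.m σ₀.1, hlast⟩) (.strict σ₀ hσ₀)
      (η.chartDom (.exc σ₀ (hc' hσ₀) ⟨ξ.m σ₀.1, hlast⟩)) (fun z => blowUpExc (id z)) :=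
    ⟨η.isOpen_chartDom _, subset_rfl, by unfold blowUpExc; fun_prop, fun _ hp => hp,
      fun p _ _ => (chartPar_strict hσ₀ _).trans (chartPar_exc (hc' hσ₀) ⟨_, hlast⟩ p).symm⟩
  refine exists_isBlowUp (zero_mem_strict hσ₀) (ofTorus_ne_distinguished hσ₀) ?_ ?_ ?_
  · intro i p hp
    cases i with
    | torus => exact .inr ⟨_, _, _, isLocalMap_torus η ξ, hp, ofTorus_ne_distinguished hσ₀ p hp⟩
    | cone σ hσ =>
      exact .inr ⟨_, _, _, isLocalMap_cone hσ (hc hσ), hp, fun h =>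
        ChartIndex.noConfusion rfl (heq_of_eq
          (ofChart_eq_distinguished hσ₀ (i := .cone σ (hc hσ)) hp h))⟩
    | strict σ hσ =>
      by_cases hne : σ = σ₀
      · subst hne
        exact .inl ⟨_, _, id, .inl rfl, contDiffOn_id, hS, hp⟩
      · refine .inr ⟨_, _, _, isLocalMap_strict hσ (hc hσ) (hm1 (hc hσ) hne), hp, fun h => hne ?_⟩
        have := ofChart_eq_distinguished hσ₀ (i := .strict σ (hc hσ)) hp h
        injection this
    | exc σ hσ j =>
      by_cases hj : (j : ℕ) < ξ.m σ.1
      · exact .inr ⟨_, _, _, isLocalMap_exc hσ (hc hσ) j hj, hp, fun h =>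
          ChartIndex.noConfusion rfl (heq_of_eq
            (ofChart_eq_distinguished hσ₀ (i := .exc σ (hc hσ) ⟨j, hj⟩) hp h))⟩
      · have hne : σ = σ₀ := by
          by_contra hne
          exact hj (hm1 (hc hσ) hne ▸ j.2)
        subst hne
        obtain ⟨j, hj'⟩ := j
        obtain rfl : j = ξ.m σ.1 := by simp only at hj; omega
        exact .inl ⟨_, _, id, .inr rfl, contDiffOn_id, hE, hp⟩
  · intro i p hp hne
    cases i with
    | torus => exact ⟨_, _, _, isLocalMap_torus ξ η, hp⟩
    | cone σ hσ => exact ⟨_, _, _, isLocalMap_cone hσ (hc' hσ), hp⟩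
    | exc σ hσ j => exact ⟨_, _, _, isLocalMap_exc hσ (hc' hσ) j (j.2.trans_le (hle _)), hp⟩
    | strict σ hσ =>
      by_cases hσσ : σ = σ₀
      · subst hσσ
        by_cases hp1 : p.1 = 0
        · have hp2 : p.2 ≠ 0 := fun hp2 => hne (by rw [show p = 0 from Prod.ext hp1 hp2])
          refine ⟨.exc σ (hc' hσ) ⟨ξ.m σ.1, hlast⟩, {p | p.1 ≠ 1 ∧ p.2 ≠ 0},
            fun p => (p.1 / p.2, p.2), ⟨?_, fun p hp => hp.1, ?_, ?_, ?_⟩, hp, hp2⟩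
          · exact (isOpen_ne_fun continuous_fst continuous_const).inter
              (isOpen_ne_fun continuous_snd continuous_const)
          · exact (ContDiffOn.div (by fun_prop) (by fun_prop) fun p hp => hp.2).prodMk (by fun_prop)
          · rintro p ⟨hp1, hp2⟩
            refine (mem_chartDom_exc (hσ := hc' hσ) (j := ⟨_, hlast⟩)).2 ?_
            change p.2 ≠ 0 at hp2
            simpa [div_mul_cancel₀ _ hp2] using hp1
          · rintro p ⟨hp1, hp2⟩ _
            refine (chartPar_exc (hc' hσ) ⟨_, hlast⟩ _).trans
              (Eq.trans ?_ (chartPar_strict hσ p).symm)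
            simp only [div_mul_cancel₀ _ hp2]
        · refine ⟨.strict σ (hc' hσ), {p | p.1 ≠ 1 ∧ p.1 ≠ 0},
            fun p => (p.1, p.2 / p.1), ⟨?_, fun p hp => hp.1, ?_, fun p hp => hp.1, ?_⟩, hp, hp1⟩
          · exact (isOpen_ne_fun continuous_fst continuous_const).inter
              (isOpen_ne_fun continuous_fst continuous_const)
          · exact ContDiffOn.prodMk (by fun_prop)
              (ContDiffOn.div (by fun_prop) (by fun_prop) fun p hp => hp.2)
          · rintro p ⟨hp1, hp2⟩ _
            refine (chartPar_strict (hc' hσ) _).trans (Eq.trans ?_ (chartPar_strict hσ p).symm)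
            simp only [hm0]
            congr 2
            have : p.1 ≠ 0 := hp2
            field_simp
            ring
      · exact ⟨_, _, _, isLocalMap_strict hσ (hc' hσ) (hm1 hσ hσσ).symm, hp⟩
  · rintro β (rfl | rfl) v hv
    · refine ⟨_, _, _, id, hS, contDiffAt_id, ?_, .of_forall fun _ => rfl⟩
      have : v.1 = 0 := congrArg Prod.fst hv
      refine (mem_chartDom_strict (hσ := hc' hσ₀)).2 ?_
      simp [this]
    · refine ⟨_, _, _, id, hE, contDiffAt_id, ?_, .of_forall fun _ => rfl⟩
      have : v.2 = 0 := congrArg Prod.snd hv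
      refine (mem_chartDom_exc (hσ := hc' hσ₀)).2 ?_
      simp [this]

/-! ### Corner blow-ups -/

theorem monomialMap_star_left (σ : (ℤ × ℤ) × (ℤ × ℤ)) {p : ℂ × ℂ} (hp : p.2 ≠ 0) :
    monomialMap (σ.1, σ.1 + σ.2) p = monomialMap σ (p.1 * p.2, p.2) := by
  simp only [monomialMap, Prod.fst_add, Prod.snd_add, mul_zpow, zpow_add₀ hp, mul_assoc]

theorem monomialMap_star_right (σ : (ℤ × ℤ) × (ℤ × ℤ)) {p : ℂ × ℂ} (hp : p.1 ≠ 0) :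
    monomialMap (σ.1 + σ.2, σ.2) p = monomialMap σ (p.1, p.1 * p.2) := by
  simp only [monomialMap, Prod.fst_add, Prod.snd_add, mul_zpow, zpow_add₀ hp, mul_assoc]

/-- The cone charts of the two halves are the charts of the blow-up of the origin, up to the removed
distinguished points. Charts of other cones are unchanged, and those at the first ray of `σ₀` change
by a unit. -/
theorem exists_isBlowUp_corner {σ₀ : (ℤ × ℤ) × (ℤ × ℤ)} (hσ₀ : σ₀ ∈ ξ.cones)
    (hcones : η.cones =
      insert (σ₀.1, σ₀.1 + σ₀.2) (insert (σ₀.1 + σ₀.2, σ₀.2) (ξ.cones.erase σ₀)))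
    (hm : η.m = ξ.m) :
    ∃ p, IsBlowUp ξ.atlas η.atlas p (.cone σ₀ hσ₀) := by
  have hc : ∀ {τ}, τ ∈ η.cones →
      τ = (σ₀.1, σ₀.1 + σ₀.2) ∨ τ = (σ₀.1 + σ₀.2, σ₀.2) ∨ (τ ∈ ξ.cones ∧ τ ≠ σ₀) :=
    fun h => SmoothCompleteFan.eq_or_of_mem_star (by rwa [hcones] at h)
  have hl : (σ₀.1, σ₀.1 + σ₀.2) ∈ η.cones := by rw [hcones]; simp
  have hr : (σ₀.1 + σ₀.2, σ₀.2) ∈ η.cones := by rw [hcones]; simp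
  have hc' : ∀ {τ}, τ ∈ ξ.cones → τ ≠ σ₀ → τ ∈ η.cones := fun h h' => by
    rw [hcones]; simp [h, h']
  have hm0 : η.m (σ₀.1 + σ₀.2) = 0 := by
    rw [hm]; exact ξ.m_eq_zero _ (ξ.add_notMem_rays hσ₀)
  have hsl := η.smooth _ hl
  have hsr := η.smooth _ hr
  have hL : IsLocalMap η.atlas ξ.atlas (.cone _ hl) (.cone σ₀ hσ₀) (η.chartDom (.cone _ hl))
      (fun z => blowUpExc (id z)) := by
    refine ⟨η.isOpen_chartDom _, subset_rfl, by unfold blowUpExc; fun_prop, fun p hp => ?_,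
      fun p _ hpt => (monomialMap_star_left σ₀ (mem_torus_of_monomialMap hsl hpt).2).symm⟩
    refine (mem_chartDom_cone (hσ := hσ₀)).2 ⟨fun h => (mem_chartDom_cone.1 hp).1 ?_, fun h => ?_⟩
    · simp only [blowUpExc, id, Prod.mk.injEq] at h
      refine Prod.ext ?_ h.2
      simpa [h.2] using h.1
    · simp only [blowUpExc, id, Prod.mk.injEq] at h
      simp [h.2] at h
  have hR : IsLocalMap η.atlas ξ.atlas (.cone _ hr) (.cone σ₀ hσ₀) (η.chartDom (.cone _ hr))
      (fun z => blowUpStrict (id z)) := by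
    refine ⟨η.isOpen_chartDom _, subset_rfl, by unfold blowUpStrict; fun_prop, fun p hp => ?_,
      fun p _ hpt => (monomialMap_star_right σ₀ (mem_torus_of_monomialMap hsr hpt).1).symm⟩
    refine (mem_chartDom_cone (hσ := hσ₀)).2 ⟨fun h => ?_, fun h => (mem_chartDom_cone.1 hp).2 ?_⟩
    · simp only [blowUpStrict, id, Prod.mk.injEq] at h
      simp [h.1] at h
    · simp only [blowUpStrict, id, Prod.mk.injEq] at h
      refine Prod.ext h.1 ?_
      simpa [h.1] using h.2
  -- Although the new ray has m = 0, its distinguished point is missing from the cone charts; the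
  -- strict chart restores it, with toric coordinates (w, s - 1).
  have hRs : IsLocalMap η.atlas ξ.atlas (.strict _ hr) (.cone σ₀ hσ₀) (η.chartDom (.strict _ hr))
      (fun z => blowUpStrict ((fun z : ℂ × ℂ => (z.2, z.1 - 1)) z)) := by
    have hpar : ∀ p, η.chartPar (.strict _ hr) p =
        monomialMap (σ₀.1 + σ₀.2, σ₀.2) (p.2, p.1 - 1) := fun p => by
      rw [chartPar_strict, hm0, pow_zero, one_mul]
    refine ⟨η.isOpen_chartDom _, subset_rfl, by unfold blowUpStrict; fun_prop, fun p hp => ?_,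
      fun p _ hpt => ?_⟩
    · refine (mem_chartDom_cone (hσ := hσ₀)).2 ⟨fun h => ?_, fun h => hp ?_⟩
      · simp only [blowUpStrict, Prod.mk.injEq] at h
        simp [h.1] at h
      · simp only [blowUpStrict, Prod.mk.injEq] at h
        linear_combination (p.1 - 1) * h.1 - h.2
    · change η.chartPar (.strict _ hr) p ∈ _root_.torus at hpt
      change _ = η.chartPar (.strict _ hr) p
      rw [hpar] at hpt ⊢
      exact (monomialMap_star_right σ₀ (mem_torus_of_monomialMap hsr hpt).1).symm
  have hstrict : ∀ {σ} {hσ : σ ∈ ξ.cones} {p}, p ∈ ξ.chartDom (.strict σ hσ) →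
      ξ.atlas.ofChart (.strict σ hσ) p ≠ ξ.atlas.ofChart (.cone σ₀ hσ₀) 0 := fun hp h =>
    ChartIndex.noConfusion rfl (heq_of_eq (ofChart_eq_corner hσ₀ hp h).1)
  have hexc : ∀ {σ} {hσ : σ ∈ ξ.cones} {j p}, p ∈ ξ.chartDom (.exc σ hσ j) →
      ξ.atlas.ofChart (.exc σ hσ j) p ≠ ξ.atlas.ofChart (.cone σ₀ hσ₀) 0 := fun hp h =>
    ChartIndex.noConfusion rfl (heq_of_eq (ofChart_eq_corner hσ₀ hp h).1)
  refine exists_isBlowUp (zero_mem_cone hσ₀) (ofTorus_ne_corner hσ₀) ?_ ?_ ?_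
  · intro i p hp
    cases i with
    | torus => exact .inr ⟨_, _, _, isLocalMap_torus η ξ, hp, ofTorus_ne_corner hσ₀ p hp⟩
    | cone σ hσ =>
      rcases hc hσ with rfl | rfl | ⟨h, h'⟩
      · exact .inl ⟨_, _, id, .inr rfl, contDiffOn_id, hL, hp⟩
      · exact .inl ⟨_, _, id, .inl rfl, contDiffOn_id, hR, hp⟩
      · refine .inr ⟨_, _, _, isLocalMap_cone hσ h, hp, fun he => h' ?_⟩
        have := (ofChart_eq_corner hσ₀ (i := .cone σ h) hp he).1
        injection this
    | strict σ hσ =>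
      rcases hc hσ with rfl | rfl | ⟨h, h'⟩
      -- Since a = a' b' and b = b' = s - 1, passing to the half cone keeps s and rescales w by the
      -- unit s - 1.
      · refine .inr ⟨.strict σ₀ hσ₀, η.chartDom (.strict _ hl), fun p => (p.1, p.2 * (p.1 - 1)),
          ⟨η.isOpen_chartDom _, subset_rfl, by fun_prop, fun p hp => hp, ?_⟩, hp,
          hstrict (hσ := hσ₀) hp⟩
        intro p _ hpt
        change η.chartPar (.strict _ hl) p ∈ _root_.torus at hpt
        refine (chartPar_strict hσ₀ _).trans (Eq.trans ?_ (chartPar_strict hl p).symm)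
        rw [chartPar_strict] at hpt
        rw [monomialMap_star_left σ₀ (mem_torus_of_monomialMap hsl hpt).2, hm]
        simp only [mul_assoc]
      · exact .inl ⟨_, _, fun z => (z.2, z.1 - 1), .inl rfl, by fun_prop, hRs, hp⟩
      · exact .inr ⟨_, _, _, isLocalMap_strict hσ h (by rw [hm]), hp, hstrict (hσ := h) hp⟩
    | exc σ hσ j =>
      rcases hc hσ with rfl | rfl | ⟨h, h'⟩
      · have hj : (j : ℕ) < ξ.m σ₀.1 := hm ▸ j.2
        have key : ∀ p : ℂ × ℂ, p.1 * p.2 ≠ 1 →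
            p.1 / (p.1 * p.2 - 1) * (p.2 * (p.1 * p.2 - 1)) = p.1 * p.2 := by
          intro p hp
          have := sub_ne_zero.2 hp
          field_simp
        have hmaps : MapsTo (fun p : ℂ × ℂ => (p.1 / (p.1 * p.2 - 1), p.2 * (p.1 * p.2 - 1)))
            (η.chartDom (.exc _ hl j)) (ξ.chartDom (.exc σ₀ hσ₀ ⟨j, hj⟩)) := by
          intro p hp
          rw [mem_chartDom_exc] at hp ⊢
          rwa [key p hp]
        refine .inr ⟨.exc σ₀ hσ₀ ⟨j, hj⟩, η.chartDom (.exc _ hl j),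
          fun p => (p.1 / (p.1 * p.2 - 1), p.2 * (p.1 * p.2 - 1)),
          ⟨η.isOpen_chartDom _, subset_rfl, ?_, hmaps, ?_⟩, hp, hexc (hσ := hσ₀) (hmaps hp)⟩
        · exact (ContDiffOn.div (by fun_prop) (by fun_prop)
            fun p hp => sub_ne_zero.2 (mem_chartDom_exc.1 hp)).prodMk (by fun_prop)
        · intro p hp hpt
          change η.chartPar (.exc _ hl j) p ∈ _root_.torus at hpt
          refine (chartPar_exc hσ₀ ⟨j, hj⟩ _).trans (Eq.trans ?_ (chartPar_exc hl j p).symm)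
          rw [chartPar_exc] at hpt
          rw [monomialMap_star_left σ₀ (mem_torus_of_monomialMap hsl hpt).2]
          simp only [key p hp, mul_assoc]
      · exact absurd j.2 (by simp [hm0])
      · exact .inr ⟨_, _, _, isLocalMap_exc hσ h j (hm ▸ j.2), hp, hexc (hσ := h) hp⟩
  · intro i p hp hne
    cases i with
    | torus => exact ⟨_, _, _, isLocalMap_torus ξ η, hp⟩
    | cone σ hσ =>
      by_cases h : σ = σ₀
      · subst h
        by_cases hp2 : p.2 = 0
        · have hp1 : p.1 ≠ 0 := fun hp1 => hne (by rw [show p = 0 from Prod.ext hp1 hp2])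
          refine ⟨.cone _ hr, ξ.chartDom (.cone σ hσ) ∩ {p | p.1 ≠ 0}, fun p => (p.1, p.2 / p.1),
            ⟨(ξ.isOpen_chartDom _).inter (isOpen_ne_fun continuous_fst continuous_const),
            inter_subset_left, ContDiffOn.prodMk (by fun_prop)
              (ContDiffOn.div (by fun_prop) (by fun_prop) fun p hp => hp.2), ?_, ?_⟩, hp, hp1⟩
          · rintro p ⟨hp, hp1⟩
            refine (mem_chartDom_cone (hσ := hr)).2 ⟨fun h => hp1 (congrArg Prod.fst h),
              fun h => (mem_chartDom_cone.1 hp).2 ?_⟩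
            simp only [Prod.mk.injEq, div_eq_zero_iff] at h
            exact Prod.ext h.1 (h.2.resolve_right hp1)
          · rintro p ⟨hp, hp1⟩ hpt
            have hp1' : p.1 ≠ 0 := hp1
            have e : p.1 * (p.2 / p.1) = p.2 := by field_simp
            refine (monomialMap_star_right σ (p := (p.1, p.2 / p.1)) hp1).trans ?_
            simp only [e]
            rfl
        · refine ⟨.cone _ hl, ξ.chartDom (.cone σ hσ) ∩ {p | p.2 ≠ 0}, fun p => (p.1 / p.2, p.2),
            ⟨(ξ.isOpen_chartDom _).inter (isOpen_ne_fun continuous_snd continuous_const),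
            inter_subset_left, (ContDiffOn.div (by fun_prop) (by fun_prop)
              fun p hp => hp.2).prodMk (by fun_prop), ?_, ?_⟩, hp, hp2⟩
          · rintro p ⟨hp, hp1⟩
            refine (mem_chartDom_cone (hσ := hl)).2 ⟨fun h => (mem_chartDom_cone.1 hp).1 ?_,
              fun h => hp1 (congrArg Prod.snd h)⟩
            simp only [Prod.mk.injEq, div_eq_zero_iff] at h
            exact Prod.ext (h.1.resolve_right hp1) h.2
          · rintro p ⟨hp, hp1⟩ hpt
            refine (monomialMap_star_left σ (p := (p.1 / p.2, p.2)) hp1).trans ?_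
            simp only [div_mul_cancel₀ _ (show p.2 ≠ 0 from hp1)]
            rfl
      · exact ⟨_, _, _, isLocalMap_cone hσ (hc' hσ h), hp⟩
    | strict σ hσ =>
      by_cases h : σ = σ₀
      · subst h
        refine ⟨.strict _ hl, ξ.chartDom (.strict σ hσ), fun p => (p.1, p.2 / (p.1 - 1)),
          ⟨ξ.isOpen_chartDom _, subset_rfl, ContDiffOn.prodMk (by fun_prop)
            (ContDiffOn.div (by fun_prop) (by fun_prop) fun p hp => sub_ne_zero.2 hp),
          fun p hp => hp, ?_⟩, hp⟩
        intro p hp hpt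
        have hp' : p.1 - 1 ≠ 0 := sub_ne_zero.2 hp
        refine (chartPar_strict hl _).trans (Eq.trans ?_ (chartPar_strict hσ p).symm)
        rw [monomialMap_star_left σ (by exact hp'), hm]
        simp only [mul_assoc, div_mul_cancel₀ _ hp']
      · exact ⟨_, _, _, isLocalMap_strict hσ (hc' hσ h) (by rw [hm]), hp⟩
    | exc σ hσ j =>
      by_cases h : σ = σ₀
      · subst h
        have hj : (j : ℕ) < η.m σ.1 := by rw [hm]; exact j.2
        have key : ∀ p : ℂ × ℂ, p.1 * p.2 ≠ 1 →
            p.1 * (p.1 * p.2 - 1) * (p.2 / (p.1 * p.2 - 1)) = p.1 * p.2 := by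
          intro p hp
          have := sub_ne_zero.2 hp
          field_simp
        refine ⟨.exc _ hl ⟨j, hj⟩, ξ.chartDom (.exc σ hσ j),
          fun p => (p.1 * (p.1 * p.2 - 1), p.2 / (p.1 * p.2 - 1)),
          ⟨ξ.isOpen_chartDom _, subset_rfl, ContDiffOn.prodMk (by fun_prop)
            (ContDiffOn.div (by fun_prop) (by fun_prop)
              fun p hp => sub_ne_zero.2 (mem_chartDom_exc.1 hp)), ?_, ?_⟩, hp⟩
        · intro p hp
          refine (mem_chartDom_exc (hσ := hl) (j := ⟨j, hj⟩)).2 ?_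
          rw [key p hp]; exact hp
        · intro p hp hpt
          have hp' : p.1 * p.2 - 1 ≠ 0 := sub_ne_zero.2 hp
          refine (chartPar_exc hl ⟨j, hj⟩ _).trans (Eq.trans ?_ (chartPar_exc hσ j p).symm)
          simp only [key p hp]
          rw [monomialMap_star_left σ (by exact hp')]
          simp only [mul_assoc, div_mul_cancel₀ _ hp']
      · exact ⟨_, _, _, isLocalMap_exc hσ (hc' hσ h) j (by rw [hm]; exact j.2), hp⟩
  · rintro β (rfl | rfl) v hv
    · have h1 : v.1 = 0 := congrArg Prod.fst hv
      -- The point of the exceptional curve with coordinate -1 is the distinguished point of the new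
      -- component, so it has to be reached through its strict chart.
      by_cases h2 : v.2 = -1
      · refine ⟨_, _, _, fun z => (z.2 + 1, z.1), hRs, by fun_prop, ?_, .of_forall fun z => ?_⟩
        · refine (mem_chartDom_strict (hσ := hr)).2 ?_
          simp [h2]
        · simp
      · refine ⟨_, _, _, id, hR, contDiffAt_id, ?_, .of_forall fun _ => rfl⟩
        exact (mem_chartDom_cone (hσ := hr)).2 ⟨fun h => h2 (congrArg Prod.snd h),
          fun h => by simpa [h1] using (congrArg Prod.fst h : v.1 = -1)⟩
    · have h1 : v.2 = 0 := congrArg Prod.snd hv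
      by_cases h2 : v.1 = -1
      -- The same distinguished point seen from the other blow-up chart: the coordinates along the
      -- exceptional curve are mutually inverse, and -1 is fixed by inversion.
      · refine ⟨_, _, _, fun z => (z.1⁻¹ + 1, z.1 * z.2), hRs, ?_, ?_, ?_⟩
        · exact ((contDiffAt_fst.inv (by simp [h2])).add contDiffAt_const).prodMk (by fun_prop)
        · refine (mem_chartDom_strict (hσ := hr)).2 ?_
          simp [h2]
        · have : ∀ᶠ z : ℂ × ℂ in 𝓝 v, z.1 ≠ 0 :=
            continuousAt_fst.eventually_ne (by simp [h2])
          filter_upwards [this] with z hz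
          simp only [blowUpStrict, blowUpExc]
          ext
          · rfl
          · simp only; field_simp; simp
      · refine ⟨_, _, _, id, hL, contDiffAt_id, ?_, .of_forall fun _ => rfl⟩
        exact (mem_chartDom_cone (hσ := hl)).2 ⟨fun h => by simpa [h1] using (congrArg Prod.snd h : v.2 = -1),
          fun h => h2 (congrArg Prod.fst h)⟩

end CY2

/-! ### Values of rational functions -/

namespace HasValueAt

variable {f g : RatField} {t : ℂ × ℂ} {a b : ℂ}

theorem ne_zero_of_eval_ne_zero {Q : MvPolynomial (Fin 2) ℂ} {x : Fin 2 → ℂ}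
    (h : MvPolynomial.eval x Q ≠ 0) : algebraMap (MvPolynomial (Fin 2) ℂ) RatField Q ≠ 0 := by
  rw [Ne, FaithfulSMul.algebraMap_eq_zero_iff]
  rintro rfl
  exact h (map_zero _)

theorem polynomial (P : MvPolynomial (Fin 2) ℂ) (t : ℂ × ℂ) :
    HasValueAt (algebraMap _ RatField P) t (MvPolynomial.eval ![t.1, t.2] P) :=
  ⟨P, 1, by simp, by simp, by simp⟩

theorem coord_zero (t : ℂ × ℂ) : HasValueAt (coord 0) t t.1 := by
  simpa [coord] using polynomial (MvPolynomial.X 0) t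

theorem coord_one (t : ℂ × ℂ) : HasValueAt (coord 1) t t.2 := by
  simpa [coord] using polynomial (MvPolynomial.X 1) t

theorem one (t : ℂ × ℂ) : HasValueAt 1 t 1 := by
  simpa using polynomial 1 t

theorem add (hf : HasValueAt f t a) (hg : HasValueAt g t b) : HasValueAt (f + g) t (a + b) := by
  obtain ⟨P, Q, hQ, rfl, rfl⟩ := hf
  obtain ⟨R, S, hS, rfl, rfl⟩ := hg
  have h1 := ne_zero_of_eval_ne_zero hQ
  have h2 := ne_zero_of_eval_ne_zero hS
  refine ⟨P * S + Q * R, Q * S, ?_, ?_, ?_⟩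
  · rw [map_mul]; exact mul_ne_zero hQ hS
  · rw [div_add_div _ _ h1 h2]; simp only [map_mul, map_add]
  · rw [div_add_div _ _ hQ hS]; simp only [map_mul, map_add]

theorem mul (hf : HasValueAt f t a) (hg : HasValueAt g t b) : HasValueAt (f * g) t (a * b) := by
  obtain ⟨P, Q, hQ, rfl, rfl⟩ := hf
  obtain ⟨R, S, hS, rfl, rfl⟩ := hg
  refine ⟨P * R, Q * S, ?_, ?_, ?_⟩
  · rw [map_mul]; exact mul_ne_zero hQ hS
  · rw [div_mul_div_comm]; simp only [map_mul]
  · rw [div_mul_div_comm]; simp only [map_mul]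

theorem inv (hf : HasValueAt f t a) (ha : a ≠ 0) : HasValueAt f⁻¹ t a⁻¹ := by
  obtain ⟨P, Q, hQ, rfl, rfl⟩ := hf
  exact ⟨Q, P, fun h => ha (by rw [h, zero_div]), inv_div _ _, inv_div _ _⟩

theorem pow (hf : HasValueAt f t a) (k : ℕ) : HasValueAt (f ^ k) t (a ^ k) := by
  induction k with
  | zero => simpa using one t
  | succ k ih => simpa [pow_succ] using ih.mul hf

theorem zpow (hf : HasValueAt f t a) (ha : a ≠ 0) (k : ℤ) : HasValueAt (f ^ k) t (a ^ k) := by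
  cases k with
  | ofNat k => simpa using hf.pow k
  | negSucc k => simpa [zpow_negSucc] using (hf.pow (k + 1)).inv (pow_ne_zero _ ha)

theorem pullback_polynomial {ψ : BirP2} {t' : ℂ × ℂ} (h : ψ.MapsPoint t t')
    (P : MvPolynomial (Fin 2) ℂ) :
    HasValueAt (ψ.pullback (algebraMap _ RatField P)) t (MvPolynomial.eval ![t'.1, t'.2] P) := by
  induction P using MvPolynomial.induction_on with
  | C c =>
    have hc : algebraMap (MvPolynomial (Fin 2) ℂ) RatField (MvPolynomial.C c) =
        algebraMap ℂ RatField c := by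
      rw [← MvPolynomial.algebraMap_eq, ← IsScalarTower.algebraMap_apply]
    have h2 := polynomial (MvPolynomial.C c) t
    rw [hc] at h2 ⊢
    rw [AlgEquiv.commutes]
    simpa using h2
  | add p q hp hq => simpa only [map_add] using hp.add hq
  | mul_X p k hp =>
    have hk : HasValueAt (ψ.pullback (algebraMap (MvPolynomial (Fin 2) ℂ) RatField (MvPolynomial.X k))) t
        (![t'.1, t'.2] k) := by
      fin_cases k
      · exact h.1
      · exact h.2
    simpa only [map_mul, MvPolynomial.eval_X] using hp.mul hk

/-- Numerator and denominator are pulled back separately; the denominator keeps its nonzero value.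
This makes `MapsPoint` compatible with composition. -/
theorem pullback {ψ : BirP2} {t' : ℂ × ℂ} (h : ψ.MapsPoint t t') (hf : HasValueAt f t' a) :
    HasValueAt (ψ.pullback f) t a := by
  obtain ⟨P, Q, hQ, rfl, rfl⟩ := hf
  have := (pullback_polynomial h P).mul ((pullback_polynomial h Q).inv hQ)
  rwa [← div_eq_mul_inv, ← div_eq_mul_inv, ← map_div₀] at this

end HasValueAt

namespace BirP2

theorem pullback_mul (φ ψ : BirP2) (f : RatField) :
    (φ * ψ).pullback f = ψ.pullback (φ.pullback f) := rfl

theorem pullback_one (f : RatField) : (1 : BirP2).pullback f = f := rfl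

theorem MapsPoint.comp {φ ψ : BirP2} {t t' t'' : ℂ × ℂ} (hψ : ψ.MapsPoint t t')
    (hφ : φ.MapsPoint t' t'') : (φ * ψ).MapsPoint t t'' :=
  ⟨show HasValueAt (ψ.pullback (φ.pullback (coord 0))) t _ from hφ.1.pullback hψ,
    show HasValueAt (ψ.pullback (φ.pullback (coord 1))) t _ from hφ.2.pullback hψ⟩

theorem mapsPoint_one (t : ℂ × ℂ) : (1 : BirP2).MapsPoint t t :=
  ⟨.coord_zero t, .coord_one t⟩

theorem ext_coord {φ ψ : BirP2} (h : ∀ k, φ.pullback (coord k) = ψ.pullback (coord k)) : φ = ψ := by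
  apply MulOpposite.unop_injective
  refine AlgEquiv.ext fun f => ?_
  have hpol : ∀ P : MvPolynomial (Fin 2) ℂ, φ.pullback (algebraMap _ RatField P) =
      ψ.pullback (algebraMap _ RatField P) := by
    have : (φ.pullback.toAlgHom.comp (IsScalarTower.toAlgHom ℂ (MvPolynomial (Fin 2) ℂ) RatField)) =
        (ψ.pullback.toAlgHom.comp (IsScalarTower.toAlgHom ℂ (MvPolynomial (Fin 2) ℂ) RatField)) :=
      MvPolynomial.algHom_ext h
    exact fun P => congrArg (fun g => g P) this
  obtain ⟨P, Q, -, rfl⟩ := IsFractionRing.div_surjective (A := MvPolynomial (Fin 2) ℂ) f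
  change φ.pullback _ = ψ.pullback _
  rw [map_div₀, map_div₀, hpol, hpol]

end BirP2

/-! ### Monomial and elementary transformations at points -/

/-- The exponents of the monomial map given by a matrix. -/
def matrixCone (A : GL (Fin 2) ℤ) : (ℤ × ℤ) × (ℤ × ℤ) := ((A 0 0, A 0 1), (A 1 0, A 1 1))

theorem monomialBir_pullback (A : GL (Fin 2) ℤ) (k : Fin 2) :
    (monomialBir A).pullback (coord k) = coord 0 ^ A 0 k * coord 1 ^ A 1 k :=
  birOf_pullback_coord _ _ k

theorem GL_mul_inv_entry (A : GL (Fin 2) ℤ) (r c : Fin 2) :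
    A r 0 * A⁻¹ 0 c + A r 1 * A⁻¹ 1 c = (1 : Matrix (Fin 2) (Fin 2) ℤ) r c := by
  have hAB : (A : Matrix (Fin 2) (Fin 2) ℤ) * (A⁻¹ : GL (Fin 2) ℤ).1 = 1 := by
    rw [← Units.val_mul, mul_inv_cancel, Units.val_one]
  rw [← hAB, Matrix.mul_apply, Fin.sum_univ_two]

theorem monomialBir_inv (A : GL (Fin 2) ℤ) : (monomialBir A)⁻¹ = monomialBir A⁻¹ := by
  rw [inv_eq_iff_mul_eq_one]
  refine BirP2.ext_coord fun k => ?_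
  rw [BirP2.pullback_mul, BirP2.pullback_one, monomialBir_pullback, map_mul, map_zpow₀, map_zpow₀,
    monomialBir_pullback, monomialBir_pullback, mul_zpow, mul_zpow, ← zpow_mul, ← zpow_mul,
    ← zpow_mul, ← zpow_mul, mul_mul_mul_comm, ← zpow_add₀ (coord_ne_zero 0),
    ← zpow_add₀ (coord_ne_zero 1)]
  have h : ∀ r : Fin 2, A⁻¹ r 0 * A 0 k + A⁻¹ r 1 * A 1 k = (1 : Matrix (Fin 2) (Fin 2) ℤ) r k := by
    intro r
    have := GL_mul_inv_entry A⁻¹ r k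
    rwa [inv_inv] at this
  rw [h, h]
  fin_cases k <;> simp [Matrix.one_apply]

theorem monomialBir_mapsPoint (A : GL (Fin 2) ℤ) {t : ℂ × ℂ} (ht : t ∈ torus) :
    (monomialBir A).MapsPoint t (monomialMap (matrixCone A) t) := by
  refine ⟨?_, ?_⟩
  · rw [monomialBir_pullback]
    exact ((HasValueAt.coord_zero t).zpow ht.1 _).mul ((HasValueAt.coord_one t).zpow ht.2 _)
  · rw [monomialBir_pullback]
    exact ((HasValueAt.coord_zero t).zpow ht.1 _).mul ((HasValueAt.coord_one t).zpow ht.2 _)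

theorem monomialBir_inv_mapsPoint (A : GL (Fin 2) ℤ) {t : ℂ × ℂ} (ht : t ∈ torus) :
    (monomialBir A)⁻¹.MapsPoint (monomialMap (matrixCone A) t) t := by
  have h := monomialBir_mapsPoint A⁻¹ (monomialMap_mem_torus (σ := matrixCone A) ht)
  rw [monomialMap_comp _ _ ht] at h
  rw [monomialBir_inv]
  convert h using 1
  rw [← monomialMap_one t]
  simp only [matrixCone, Prod.smul_mk, smul_eq_mul, Prod.mk_add_mk, GL_mul_inv_entry]
  simp [monomialMap]

theorem elementaryE_pullback_zero : elementaryE.pullback (coord 0) = coord 0 :=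
  birOf_pullback_coord _ _ 0

theorem elementaryE_pullback_one :
    elementaryE.pullback (coord 1) = coord 1 * (coord 0 + 1)⁻¹ :=
  birOf_pullback_coord _ _ 1

theorem elementaryE_inv_pullback (f : RatField) :
    elementaryE⁻¹.pullback (elementaryE.pullback f) = f := by
  rw [← BirP2.pullback_mul, mul_inv_cancel, BirP2.pullback_one]

theorem elementaryE_inv_pullback_zero : elementaryE⁻¹.pullback (coord 0) = coord 0 := by
  have := elementaryE_inv_pullback (coord 0)
  rwa [elementaryE_pullback_zero] at this

theorem elementaryE_inv_pullback_one :
    elementaryE⁻¹.pullback (coord 1) = coord 1 * (coord 0 + 1) := by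
  have := elementaryE_inv_pullback (coord 1)
  rw [elementaryE_pullback_one, map_mul, map_inv₀, map_add, map_one,
    elementaryE_inv_pullback_zero] at this
  rw [← this]
  nth_rewrite 2 [← this]
  rw [mul_assoc, inv_mul_cancel₀ (coord_add_one_ne_zero 0), mul_one, this]

theorem elementaryE_mapsPoint {t : ℂ × ℂ} (ht : t.1 + 1 ≠ 0) :
    elementaryE.MapsPoint t (t.1, t.2 / (t.1 + 1)) := by
  refine ⟨?_, ?_⟩
  · rw [elementaryE_pullback_zero]; exact .coord_zero t
  · rw [elementaryE_pullback_one, div_eq_mul_inv]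
    exact (HasValueAt.coord_one t).mul (((HasValueAt.coord_zero t).add (.one t)).inv ht)

theorem elementaryE_inv_mapsPoint {t : ℂ × ℂ} (ht : t.1 + 1 ≠ 0) :
    elementaryE⁻¹.MapsPoint (t.1, t.2 / (t.1 + 1)) t := by
  refine ⟨?_, ?_⟩
  · rw [elementaryE_inv_pullback_zero]; exact .coord_zero _
  · rw [elementaryE_inv_pullback_one]
    convert (HasValueAt.coord_one (t.1, t.2 / (t.1 + 1))).mul
      ((HasValueAt.coord_zero (t.1, t.2 / (t.1 + 1))).add (.one _)) using 1
    field_simp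

/-! ### Arcs -/

/-- The arc `γ` in the torus converges for `t → 0` to a point on the boundary component of the ray
`n`, at which `x ^ n₂ * y ^ (-n₁)` takes the value `z`. -/
def IsArc (n : ℤ × ℤ) (z : ℂ) (γ : ℂ → ℂ × ℂ) : Prop :=
  ∃ α β : ℂ, α ≠ 0 ∧ β ≠ 0 ∧ Filter.Tendsto (fun t => (γ t).1 * t ^ (-n.1)) (𝓝[≠] 0) (𝓝 α) ∧
    Filter.Tendsto (fun t => (γ t).2 * t ^ (-n.2)) (𝓝[≠] 0) (𝓝 β) ∧ z = α ^ n.2 * β ^ (-n.1)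

/-- A vector of `ℤ²` is primitive if it belongs to an oriented basis. -/
def IsPrimitive (n : ℤ × ℤ) : Prop := ∃ n₀, det2 n n₀ = 1

/-- A birational transformation acts on arcs, preserving the coordinates of the boundary components
up to inversion. -/
def TransformsArcs (φ : BirP2) : Prop :=
  ∀ n, IsPrimitive n → ∃ n', IsPrimitive n' ∧ ∃ ε : ℤ, (ε = 1 ∨ ε = -1) ∧
    ∀ z, z ≠ -1 → ∀ γ, IsArc n z γ → ∃ γ', IsArc n' (z ^ ε) γ' ∧
      ∀ᶠ t in 𝓝[≠] (0 : ℂ), φ.MapsPoint (γ t) (γ' t) ∧ φ⁻¹.MapsPoint (γ' t) (γ t)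

theorem IsArc.eventually_mem_torus {n : ℤ × ℤ} {z : ℂ} {γ : ℂ → ℂ × ℂ} (h : IsArc n z γ) :
    ∀ᶠ t in 𝓝[≠] (0 : ℂ), γ t ∈ torus := by
  obtain ⟨α, β, hα, hβ, h1, h2, -⟩ := h
  filter_upwards [h1.eventually_ne hα, h2.eventually_ne hβ] with t ht1 ht2
  exact ⟨left_ne_zero_of_mul ht1, left_ne_zero_of_mul ht2⟩

theorem IsArc.monomialMap {n : ℤ × ℤ} {z : ℂ} {γ : ℂ → ℂ × ℂ} (h : IsArc n z γ)
    (ρ : (ℤ × ℤ) × (ℤ × ℤ)) :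
    IsArc (n.1 • ρ.1 + n.2 • ρ.2) (z ^ det2 ρ.1 ρ.2) (fun t => monomialMap ρ (γ t)) := by
  obtain ⟨α, β, hα, hβ, h1, h2, rfl⟩ := h
  have key : ∀ i j : ℤ, Filter.Tendsto
      (fun t => (γ t).1 ^ i * (γ t).2 ^ j * t ^ (-(n.1 * i + n.2 * j))) (𝓝[≠] 0)
      (𝓝 (α ^ i * β ^ j)) := by
    intro i j
    refine ((SmoothCompleteFan.tendsto_zpow_ne h1 hα i).mul
      (SmoothCompleteFan.tendsto_zpow_ne h2 hβ j)).congr' ?_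
    filter_upwards [self_mem_nhdsWithin] with t ht
    rw [mul_zpow, mul_zpow, ← zpow_mul, ← zpow_mul, mul_mul_mul_comm,
      ← zpow_add₀ (show t ≠ 0 from ht)]
    congr 2
    ring
  refine ⟨_, _, mul_ne_zero (zpow_ne_zero ρ.1.1 hα) (zpow_ne_zero ρ.2.1 hβ),
    mul_ne_zero (zpow_ne_zero ρ.1.2 hα) (zpow_ne_zero ρ.2.2 hβ), ?_, ?_, ?_⟩
  · simpa [_root_.monomialMap] using key ρ.1.1 ρ.2.1
  · simpa [_root_.monomialMap] using key ρ.1.2 ρ.2.2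
  · simp only [Prod.fst_add, Prod.snd_add, Prod.smul_fst, Prod.smul_snd, smul_eq_mul]
    rw [mul_zpow, mul_zpow, mul_zpow, ← zpow_mul, ← zpow_mul, ← zpow_mul, ← zpow_mul, ← zpow_mul,
      ← zpow_mul, mul_mul_mul_comm, ← zpow_add₀ hα, ← zpow_add₀ hβ]
    simp only [det2]
    congr 2 <;> ring

theorem TransformsArcs.mul {φ ψ : BirP2} (hφ : TransformsArcs φ) (hψ : TransformsArcs ψ) :
    TransformsArcs (φ * ψ) := by
  intro n hn
  obtain ⟨n', hn', ε, hε, h⟩ := hψ n hn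
  obtain ⟨n'', hn'', ε', hε', h'⟩ := hφ n' hn'
  refine ⟨n'', hn'', ε * ε', ?_, fun z hz γ hγ => ?_⟩
  · rcases hε with rfl | rfl <;> rcases hε' with rfl | rfl <;> simp
  · obtain ⟨γ', hγ', hm⟩ := h z hz γ hγ
    -- The excluded value -1 is fixed by inversion, so the second transformation may be applied to
    -- the image arc.
    have hz' : z ^ ε ≠ -1 := by
      rcases hε with rfl | rfl
      · simpa using hz
      · rw [zpow_neg_one]
        intro h0
        apply hz
        rw [← inv_inv z, h0]; norm_num
    obtain ⟨γ'', hγ'', hm'⟩ := h' _ hz' γ' hγ'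
    refine ⟨γ'', by rwa [zpow_mul], ?_⟩
    filter_upwards [hm, hm'] with t h1 h2
    refine ⟨h1.1.comp h2.1, ?_⟩
    rw [mul_inv_rev]
    exact h2.2.comp h1.2

theorem TransformsArcs.one : TransformsArcs 1 := fun n hn =>
  ⟨n, hn, 1, .inl rfl, fun z _ γ hγ => ⟨γ, by simpa using hγ,
    .of_forall fun t => ⟨BirP2.mapsPoint_one _, by rw [inv_one]; exact BirP2.mapsPoint_one _⟩⟩⟩

theorem transformsArcs_monomialBir (A : GL (Fin 2) ℤ) : TransformsArcs (monomialBir A) := by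
  have hdet : det2 (matrixCone A).1 (matrixCone A).2 = (A : Matrix (Fin 2) (Fin 2) ℤ).det := by
    rw [Matrix.det_fin_two]; simp [det2, matrixCone]
  have hε : det2 (matrixCone A).1 (matrixCone A).2 = 1 ∨
      det2 (matrixCone A).1 (matrixCone A).2 = -1 := by
    rw [hdet]
    exact Int.isUnit_iff.1 ((Matrix.isUnit_iff_isUnit_det _).1 A.isUnit)
  rintro n ⟨n₀, hn⟩
  refine ⟨n.1 • (matrixCone A).1 + n.2 • (matrixCone A).2, ?_, _, hε, fun z _ γ hγ =>
    ⟨_, hγ.monomialMap _, ?_⟩⟩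
  · set ρ := matrixCone A
    have h : det2 (n.1 • ρ.1 + n.2 • ρ.2) (n₀.1 • ρ.1 + n₀.2 • ρ.2) =
        det2 n n₀ * det2 ρ.1 ρ.2 := by
      simp only [det2, Prod.fst_add, Prod.snd_add, Prod.smul_fst, Prod.smul_snd, smul_eq_mul]
      ring
    refine ⟨det2 ρ.1 ρ.2 • (n₀.1 • ρ.1 + n₀.2 • ρ.2), ?_⟩
    rw [det2_smul_right, h, hn]
    rcases hε with h | h <;> rw [h] <;> norm_num
  · filter_upwards [hγ.eventually_mem_torus] with t ht
    exact ⟨monomialBir_mapsPoint A ht, monomialBir_inv_mapsPoint A ht⟩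

/-- The leading term of x + 1 along the arc decides: it is that of x for p < 0, so y loses the order
p of x; it is 1 for p > 0; and for p = 0 it is α + 1, where z = α ^ q with q = ±1, so z ≠ -1 keeps
it from vanishing. In each case z is unchanged. -/
theorem transformsArcs_elementaryE : TransformsArcs elementaryE := by
  rintro ⟨p, q⟩ ⟨n₀, hn⟩
  have ht0 : Filter.Tendsto (fun t : ℂ => t) (𝓝[≠] 0) (𝓝 0) := nhdsWithin_le_nhds
  have hpow : ∀ k : ℤ, 0 < k → Filter.Tendsto (fun t : ℂ => t ^ k) (𝓝[≠] 0) (𝓝 0) := by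
    intro k hk
    have := ht0.zpow₀ k (.inr hk.le)
    rwa [zero_zpow k hk.ne'] at this
  have main : ∀ {γ : ℂ → ℂ × ℂ}, (∀ᶠ t in 𝓝[≠] (0 : ℂ), (γ t).1 + 1 ≠ 0) →
      ∀ᶠ t in 𝓝[≠] (0 : ℂ), elementaryE.MapsPoint (γ t) ((γ t).1, (γ t).2 / ((γ t).1 + 1)) ∧
        elementaryE⁻¹.MapsPoint ((γ t).1, (γ t).2 / ((γ t).1 + 1)) (γ t) := fun h => by
    filter_upwards [h] with t ht using ⟨elementaryE_mapsPoint ht, elementaryE_inv_mapsPoint ht⟩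
  rcases lt_trichotomy p 0 with hp | rfl | hp
  · refine ⟨(p, q - p), ?_, 1, .inl rfl, ?_⟩
    · refine ⟨(n₀.1, n₀.2 - n₀.1), ?_⟩
      simp only [det2] at hn ⊢
      linear_combination hn
    · rintro z - γ ⟨α, β, hα, hβ, h1, h2, rfl⟩
      have h3 : Filter.Tendsto (fun t => ((γ t).1 + 1) * t ^ (-p)) (𝓝[≠] 0) (𝓝 α) := by
        simpa [add_mul] using h1.add (hpow (-p) (by omega))
      refine ⟨fun t => ((γ t).1, (γ t).2 / ((γ t).1 + 1)),
        ⟨α, β / α, hα, div_ne_zero hβ hα, h1, ?_, ?_⟩, main ?_⟩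
      · refine (h2.div h3 hα).congr' ?_
        filter_upwards [self_mem_nhdsWithin] with t ht
        change (γ t).2 * t ^ (-q) / (((γ t).1 + 1) * t ^ (-p)) = _
        rw [show -(q - p) = -q - -p by ring, zpow_sub₀ (show t ≠ 0 from ht), div_mul_div_comm]
      · simp only
        rw [zpow_one, div_zpow, zpow_sub₀ hα, zpow_neg α p]
        have := zpow_ne_zero p hα
        field_simp
      · filter_upwards [h3.eventually_ne hα] with t ht using left_ne_zero_of_mul ht
  · refine ⟨(0, q), ⟨n₀, hn⟩, 1, .inl rfl, ?_⟩
    rintro z hz γ ⟨α, β, hα, hβ, h1, h2, rfl⟩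
    have hα1 : α + 1 ≠ 0 := by
      intro h
      apply hz
      rw [eq_neg_of_add_eq_zero_left h]
      have hq : q = 1 ∨ q = -1 := by
        refine Int.isUnit_iff.1 (IsUnit.of_mul_eq_one (-n₀.1) ?_)
        simp only [det2] at hn
        linear_combination hn
      rcases hq with rfl | rfl <;> simp
    have h1' : Filter.Tendsto (fun t => (γ t).1) (𝓝[≠] 0) (𝓝 α) := by simpa using h1
    have h3 := h1'.add_const 1
    refine ⟨fun t => ((γ t).1, (γ t).2 / ((γ t).1 + 1)),
      ⟨α, β / (α + 1), hα, div_ne_zero hβ hα1, h1, ?_, ?_⟩, main (h3.eventually_ne hα1)⟩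
    · refine (h2.div h3 hα1).congr fun t => ?_
      simp only [Pi.div_apply]
      ring
    · simp
  · refine ⟨(p, q), ⟨n₀, hn⟩, 1, .inl rfl, ?_⟩
    rintro z - γ ⟨α, β, hα, hβ, h1, h2, rfl⟩
    have h1' : Filter.Tendsto (fun t => (γ t).1) (𝓝[≠] 0) (𝓝 0) := by
      have := h1.mul (hpow p hp)
      rw [mul_zero] at this
      refine this.congr' ?_
      filter_upwards [self_mem_nhdsWithin] with t ht
      rw [mul_assoc, ← zpow_add₀ (show t ≠ 0 from ht)]
      simp
    have h3 := h1'.add_const 1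
    rw [zero_add] at h3
    refine ⟨fun t => ((γ t).1, (γ t).2 / ((γ t).1 + 1)),
      ⟨α, β, hα, hβ, h1, ?_, ?_⟩, main (h3.eventually_ne one_ne_zero)⟩
    · have := h2.div h3 one_ne_zero
      rw [div_one] at this
      refine this.congr fun t => ?_
      simp only [Pi.div_apply]
      ring
    · simp

/-- The matrix of the monomial map `(x, y) ↦ (x, y⁻¹)`. -/
def reflection : GL (Fin 2) ℤ where
  val := !![1, 0; 0, -1]
  inv := !![1, 0; 0, -1]
  val_inv := by simp [Matrix.one_fin_two]
  inv_val := by simp [Matrix.one_fin_two]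

/-- Conjugation by y ↦ y⁻¹ inverts E, so arcs need not be analysed separately for the inverse. -/
theorem elementaryE_inv :
    elementaryE⁻¹ = monomialBir reflection * elementaryE * monomialBir reflection := by
  refine BirP2.ext_coord fun k => ?_
  rw [BirP2.pullback_mul, BirP2.pullback_mul, monomialBir_pullback, map_mul, map_mul]
  simp only [map_zpow₀, elementaryE_pullback_zero, elementaryE_pullback_one, map_mul, map_inv₀,
    map_add, map_one, monomialBir_pullback]
  fin_cases k
  · simp [reflection, elementaryE_inv_pullback_zero]
  · simp [reflection, elementaryE_inv_pullback_one, mul_comm]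

/-- The property is carried for φ and φ⁻¹ together, so that it passes to inverses in the induction
over the generated group. -/
theorem transformsArcs_of_mem_birE {φ : BirP2} (hφ : φ ∈ BirE) :
    TransformsArcs φ ∧ TransformsArcs φ⁻¹ := by
  refine Subgroup.closure_induction (p := fun φ _ => TransformsArcs φ ∧ TransformsArcs φ⁻¹)
    ?_ ?_ ?_ ?_ hφ
  · rintro _ (rfl | ⟨A, rfl⟩)
    · refine ⟨transformsArcs_elementaryE, ?_⟩
      rw [elementaryE_inv]
      exact ((transformsArcs_monomialBir _).mul transformsArcs_elementaryE).mul
        (transformsArcs_monomialBir _)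
    · refine ⟨transformsArcs_monomialBir A, ?_⟩
      rw [monomialBir_inv]
      exact transformsArcs_monomialBir _
  · rw [inv_one]
    exact ⟨.one, .one⟩
  · rintro φ ψ - - ⟨h1, h2⟩ ⟨h3, h4⟩
    rw [mul_inv_rev]
    exact ⟨h1.mul h3, h4.mul h2⟩
  · rintro φ - ⟨h1, h2⟩
    rw [inv_inv]
    exact ⟨h2, h1⟩

/-! ### Limits of arcs -/

theorem tendsto_zero_of_tendsto_mul_zpow_neg {f : ℂ → ℂ} {α : ℂ} {k : ℤ} (hk : 0 < k)
    (h : Filter.Tendsto (fun t => f t * t ^ (-k)) (𝓝[≠] 0) (𝓝 α)) :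
    Filter.Tendsto f (𝓝[≠] 0) (𝓝 0) := by
  have ht0 : Filter.Tendsto (fun t : ℂ => t) (𝓝[≠] 0) (𝓝 0) := nhdsWithin_le_nhds
  have h1 := h.mul (ht0.zpow₀ k (.inr hk.le))
  rw [zero_zpow k hk.ne', mul_zero] at h1
  refine h1.congr' ?_
  filter_upwards [self_mem_nhdsWithin] with t ht
  rw [mul_assoc, ← zpow_add₀ (show t ≠ 0 from ht), neg_add_cancel, zpow_zero, mul_one]

theorem IsArc.tendsto_zero {n : ℤ × ℤ} {z : ℂ} {γ : ℂ → ℂ × ℂ} (h : IsArc n z γ) (h1 : 0 < n.1)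
    (h2 : 0 < n.2) : Filter.Tendsto γ (𝓝[≠] 0) (𝓝 0) := by
  obtain ⟨α, β, -, -, ha, hb, -⟩ := h
  exact (tendsto_zero_of_tendsto_mul_zpow_neg h1 ha).prodMk_nhds
    (tendsto_zero_of_tendsto_mul_zpow_neg h2 hb)

theorem IsArc.tendsto_of_eq_one {z : ℂ} {γ : ℂ → ℂ × ℂ} (h : IsArc (1, 0) z γ) :
    Filter.Tendsto γ (𝓝[≠] 0) (𝓝 (0, z⁻¹)) := by
  obtain ⟨α, β, -, -, ha, hb, rfl⟩ := h
  exact (tendsto_zero_of_tendsto_mul_zpow_neg one_pos ha).prodMk_nhds (by simpa using hb)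

/-- The new exponents are the coordinates of `n` in the basis of the cone. The invariant z does not
change since the base change has determinant 1. -/
theorem IsArc.toricCoords {n : ℤ × ℤ} {z : ℂ} {γ : ℂ → ℂ × ℂ} (h : IsArc n z γ)
    {σ : (ℤ × ℤ) × (ℤ × ℤ)} (hσ : det2 σ.1 σ.2 = 1) :
    IsArc (det2 n σ.2, det2 σ.1 n) z (fun t => toricCoords σ (γ t)) := by
  have h1 := h.monomialMap (transition σ ((1, 0), (0, 1)))
  have h2 : det2 (transition σ ((1, 0), (0, 1))).1 (transition σ ((1, 0), (0, 1))).2 = 1 := by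
    simp only [transition, det2] at hσ ⊢
    linear_combination hσ
  rw [h2, zpow_one] at h1
  have h3 : (det2 n σ.2, det2 σ.1 n) = n.1 • (transition σ ((1, 0), (0, 1))).1 +
      n.2 • (transition σ ((1, 0), (0, 1))).2 := by
    simp only [transition, det2]
    ext <;> simp <;> ring
  rw [h3]
  exact h1

/-- Test arcs crossing the component of the first ray at the coordinate c. For the ray (1, 0) the
invariant is y⁻¹, hence the inverse. -/
theorem isArc_monomialMap {σ : (ℤ × ℤ) × (ℤ × ℤ)} (hσ : det2 σ.1 σ.2 = 1) {c : ℂ} (hc : c ≠ 0) :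
    IsArc σ.1 c⁻¹ (fun t => monomialMap σ (t, c)) := by
  have h : IsArc (1, 0) c⁻¹ (fun t => (t, c)) := by
    refine ⟨1, c, one_ne_zero, hc, ?_, by simp, by simp⟩
    refine tendsto_const_nhds.congr' ?_
    filter_upwards [self_mem_nhdsWithin] with t ht
    simp [mul_inv_cancel₀ (show t ≠ 0 from ht)]
  simpa [hσ] using h.monomialMap σ

namespace CY2

open TorusAtlas

variable {ξ ξ' : CY2}

theorem emb_eq_ofTorus (t : _root_.torus) : ξ.emb t = ξ.atlas.ofTorus t :=
  TorusAtlas.emb_eq_ofTorus t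

theorem tendsto_ofTorus {n : ℤ × ℤ} {z : ℂ} {γ : ℂ → ℂ × ℂ} (h : IsArc n z γ)
    {σ : (ℤ × ℤ) × (ℤ × ℤ)} (hσ : σ ∈ ξ.cones) {p : ℂ × ℂ} (hp : p ∈ ξ.atlas.dom (.cone σ hσ))
    (hγ : Filter.Tendsto (fun t => toricCoords σ (γ t)) (𝓝[≠] 0) (𝓝 p)) :
    Filter.Tendsto (fun t => ξ.atlas.ofTorus (γ t)) (𝓝[≠] 0)
      (𝓝 (ξ.atlas.ofChart (.cone σ hσ) p)) := by
  refine ((continuousAt_ofChart hp).tendsto.comp hγ).congr' ?_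
  filter_upwards [h.eventually_mem_torus] with t ht
  exact (ofTorus_eq_ofChart_cone hσ ht).symm

theorem mem_dom_cone_boundary {σ : (ℤ × ℤ) × (ℤ × ℤ)} (hσ : σ ∈ ξ.cones) {c : ℂ} (hc : c ≠ -1) :
    ((0 : ℂ), c) ∈ ξ.atlas.dom (.cone σ hσ) :=
  (mem_chartDom_cone (hσ := hσ)).2 ⟨by simpa using hc, by simp⟩

theorem tendsto_ofTorus_ray {σ : (ℤ × ℤ) × (ℤ × ℤ)} (hσ : σ ∈ ξ.cones) {z : ℂ} (hz : z ≠ -1)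
    {γ : ℂ → ℂ × ℂ} (h : IsArc σ.1 z γ) :
    Filter.Tendsto (fun t => ξ.atlas.ofTorus (γ t)) (𝓝[≠] 0)
      (𝓝 (ξ.atlas.ofChart (.cone σ hσ) (0, z⁻¹))) := by
  have h1 := h.toricCoords (ξ.smooth σ hσ)
  rw [ξ.smooth σ hσ, det2_self] at h1
  refine tendsto_ofTorus h hσ (mem_dom_cone_boundary hσ ?_) h1.tendsto_of_eq_one
  rwa [Ne, inv_eq_iff_eq_inv, inv_neg_one]

theorem tendsto_ofTorus_interior {σ : (ℤ × ℤ) × (ℤ × ℤ)} (hσ : σ ∈ ξ.cones) {n : ℤ × ℤ}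
    (h1 : 0 < det2 n σ.2) (h2 : 0 < det2 σ.1 n) {z : ℂ} {γ : ℂ → ℂ × ℂ} (h : IsArc n z γ) :
    Filter.Tendsto (fun t => ξ.atlas.ofTorus (γ t)) (𝓝[≠] 0)
      (𝓝 (ξ.atlas.ofChart (.cone σ hσ) 0)) :=
  tendsto_ofTorus h hσ (zero_mem_cone hσ) ((h.toricCoords (ξ.smooth σ hσ)).tendsto_zero h1 h2)

/-! ### The action on the boundary -/

/-- The map `f` is given by `φ` at the points of the torus near which `φ` is invertible. -/
def Realizes (φ : BirP2) (f : ξ.Y → ξ'.Y) : Prop :=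
  ∀ t ∈ _root_.torus, ∀ t' ∈ _root_.torus, φ.MapsPoint t t' → φ⁻¹.MapsPoint t' t →
    f (ξ.atlas.ofTorus t) = ξ'.atlas.ofTorus t'

/-- The biholomorphism `f` takes the boundary component of the first ray of `σ` to that of the
first ray of `σ'`. -/
def MapsComponent (f : ξ.Y → ξ'.Y) {σ σ' : (ℤ × ℤ) × (ℤ × ℤ)} (hσ : σ ∈ ξ.cones)
    (hσ' : σ' ∈ ξ'.cones) (ε : ℤ) : Prop :=
  ∀ c : ℂ, c ≠ 0 → c ≠ -1 → f (ξ.atlas.ofChart (.cone σ hσ) (0, c)) =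
    ξ'.atlas.ofChart (.cone σ' hσ') (0, c ^ ε)

theorem zpow_ne_neg_one {c : ℂ} (hc : c ≠ -1) {ε : ℤ} (hε : ε = 1 ∨ ε = -1) : c ^ ε ≠ -1 := by
  rcases hε with rfl | rfl
  · simpa using hc
  · rwa [zpow_neg_one, Ne, inv_eq_iff_eq_inv, inv_neg_one]

/-- The image under `f` of a boundary point is the limit of the transformed test arc. If the
exponent n' were not a ray of ξ', all these limits would be one corner, against injectivity. -/
theorem Realizes.exists_mapsComponent {φ : BirP2} (hφ : TransformsArcs φ) {f : ξ.Y → ξ'.Y}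
    (hf : Continuous f) (hinj : Function.Injective f) (h : Realizes φ f)
    {σ : (ℤ × ℤ) × (ℤ × ℤ)} (hσ : σ ∈ ξ.cones) :
    ∃ σ', ∃ hσ' : σ' ∈ ξ'.cones, ∃ ε : ℤ, (ε = 1 ∨ ε = -1) ∧ MapsComponent f hσ hσ' ε := by
  obtain ⟨n', ⟨n₀, hn'⟩, ε, hε, harc⟩ := hφ σ.1 ⟨σ.2, ξ.smooth σ hσ⟩
  have key : ∀ c : ℂ, c ≠ 0 → c ≠ -1 → ∃ γ', IsArc n' (c ^ (-ε)) γ' ∧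
      Filter.Tendsto (fun t => ξ'.atlas.ofTorus (γ' t)) (𝓝[≠] 0)
        (𝓝 (f (ξ.atlas.ofChart (.cone σ hσ) (0, c)))) := by
    intro c hc hc'
    have hγ := isArc_monomialMap (ξ.smooth σ hσ) hc
    have hz : c⁻¹ ≠ -1 := by rwa [Ne, inv_eq_iff_eq_inv, inv_neg_one]
    obtain ⟨γ', hγ', hm⟩ := harc c⁻¹ hz _ hγ
    refine ⟨γ', by rwa [inv_zpow, ← zpow_neg] at hγ', ?_⟩
    have hl := (hf.tendsto _).comp (tendsto_ofTorus_ray hσ hz hγ)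
    rw [inv_inv] at hl
    refine hl.congr' ?_
    filter_upwards [hm, hγ.eventually_mem_torus, hγ'.eventually_mem_torus] with t h1 h2 h3
    exact h _ h2 _ h3 h1.1 h1.2
  rcases ξ'.mem_rays_or_interior hn' with hr | ⟨τ, hτ, h1, h2⟩
  · obtain ⟨σ', hσ', rfl⟩ := ξ'.exists_fst_eq hr
    refine ⟨σ', hσ', ε, hε, fun c hc hc' => ?_⟩
    obtain ⟨γ', hγ', hl⟩ := key c hc hc'
    refine tendsto_nhds_unique hl ?_
    have := tendsto_ofTorus_ray hσ' (zpow_ne_neg_one hc' (by omega)) hγ'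
    rwa [← zpow_neg, neg_neg] at this
  · exfalso
    have hcorner : ∀ c : ℂ, c ≠ 0 → c ≠ -1 →
        f (ξ.atlas.ofChart (.cone σ hσ) (0, c)) = ξ'.atlas.ofChart (.cone τ hτ) 0 := by
      intro c hc hc'
      obtain ⟨γ', hγ', hl⟩ := key c hc hc'
      exact tendsto_nhds_unique hl (tendsto_ofTorus_interior hτ h1 h2 hγ')
    have h12 := hinj ((hcorner 1 (by norm_num) (by norm_num)).trans
      (hcorner 2 (by norm_num) (by norm_num)).symm)
    have := congrArg (chart (A := ξ.atlas) (.cone σ hσ)) h12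
    rw [chart_ofChart (mem_dom_cone_boundary hσ (by norm_num)),
      chart_ofChart (mem_dom_cone_boundary hσ (by norm_num))] at this
    norm_num at this

theorem eventually_ne_zero_ne_neg_one : ∀ᶠ c : ℂ in 𝓝[≠] 0, c ≠ 0 ∧ c ≠ -1 := by
  filter_upwards [self_mem_nhdsWithin,
    nhdsWithin_le_nhds (isOpen_ne.mem_nhds (show (0 : ℂ) ≠ -1 by norm_num))] with c h1 h2
  exact ⟨h1, h2⟩

theorem tendsto_ofChart_corner {σ : (ℤ × ℤ) × (ℤ × ℤ)} (hσ : σ ∈ ξ.cones) :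
    Filter.Tendsto (fun c : ℂ => ξ.atlas.ofChart (.cone σ hσ) (0, c)) (𝓝[≠] 0)
      (𝓝 (ξ.atlas.ofChart (.cone σ hσ) 0)) :=
  ((continuousAt_ofChart (zero_mem_cone hσ)).comp_of_eq (f := fun c : ℂ => ((0 : ℂ), c))
    (by fun_prop) rfl).tendsto.mono_left nhdsWithin_le_nhds

theorem tendsto_ofChart_corner_fst {σ : (ℤ × ℤ) × (ℤ × ℤ)} (hσ : σ ∈ ξ.cones) :
    Filter.Tendsto (fun c : ℂ => ξ.atlas.ofChart (.cone σ hσ) (c, 0)) (𝓝[≠] 0)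
      (𝓝 (ξ.atlas.ofChart (.cone σ hσ) 0)) :=
  ((continuousAt_ofChart (zero_mem_cone hσ)).comp_of_eq (f := fun c : ℂ => (c, (0 : ℂ)))
    (by fun_prop) rfl).tendsto.mono_left nhdsWithin_le_nhds

theorem ofChart_adjacent {σ τ : (ℤ × ℤ) × (ℤ × ℤ)} (hσ : σ ∈ ξ.cones) (hτ : τ ∈ ξ.cones)
    (h : σ.1 = τ.2) {c : ℂ} (hc : c ≠ 0) (hc' : c ≠ -1) :
    ξ.atlas.ofChart (.cone τ hτ) (c, 0) = ξ.atlas.ofChart (.cone σ hσ) (0, c⁻¹) := by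
  obtain ⟨h1, h2⟩ := isLocalMap_adjacent hσ hτ h
  have hd : ((c, 0) : ℂ × ℂ) ∈ ξ.chartDom (.cone τ hτ) ∩ {q | q.1 ≠ 0} :=
    ⟨mem_chartDom_cone.2 ⟨by simp [hc], by simpa using hc'⟩, hc⟩
  have := h1.ofChart_eq h2 hd ⟨h1.mapsTo hd, inv_ne_zero hc⟩
  simpa using this

/-- On the strict transform w = 0 the toric coordinates are (0, s - 1) whatever `m` is, so for c →
-1 the component runs into the origin of the strict chart. -/
theorem tendsto_ofChart_distinguished {σ : (ℤ × ℤ) × (ℤ × ℤ)} (hσ : σ ∈ ξ.cones) :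
    Filter.Tendsto (fun c : ℂ => ξ.atlas.ofChart (.cone σ hσ) (0, c)) (𝓝[≠] (-1))
      (𝓝 (ξ.atlas.ofChart (.strict σ hσ) 0)) := by
  have h1 : Filter.Tendsto (fun c : ℂ => ξ.atlas.ofChart (.strict σ hσ) (c + 1, 0)) (𝓝[≠] (-1))
      (𝓝 (ξ.atlas.ofChart (.strict σ hσ) 0)) :=
    (((continuousAt_ofChart (zero_mem_strict hσ)).tendsto).comp
      ((show Continuous fun c : ℂ => (c + 1, (0 : ℂ)) by fun_prop).tendsto' (-1) 0
        (by simp))).mono_left nhdsWithin_le_nhds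
  refine h1.congr' ?_
  filter_upwards [self_mem_nhdsWithin,
    nhdsWithin_le_nhds (isOpen_ne.mem_nhds (show (-1 : ℂ) ≠ 0 by norm_num))] with c h2 h3
  rw [ofChart_strict hσ (by simpa using h3) (fun h => h2 (eq_neg_of_add_eq_zero_left h))]
  simp

/-- Let c → 0. For ε = 1 the limit is the corner of `σ'`. For ε = -1 the image runs to infinity,
which is the corner of the cone preceding `σ'`. -/
theorem MapsComponent.map_corner {f : ξ.Y → ξ'.Y} (hf : Continuous f)
    {σ σ' : (ℤ × ℤ) × (ℤ × ℤ)} {hσ : σ ∈ ξ.cones} {hσ' : σ' ∈ ξ'.cones} {ε : ℤ}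
    (hε : ε = 1 ∨ ε = -1) (h : MapsComponent f hσ hσ' ε) :
    ∃ τ, ∃ hτ : τ ∈ ξ'.cones,
      f (ξ.atlas.ofChart (.cone σ hσ) 0) = ξ'.atlas.ofChart (.cone τ hτ) 0 := by
  have h1 := (hf.tendsto _).comp (tendsto_ofChart_corner hσ)
  rcases hε with rfl | rfl
  · refine ⟨σ', hσ', tendsto_nhds_unique h1 ((tendsto_ofChart_corner hσ').congr' ?_)⟩
    filter_upwards [eventually_ne_zero_ne_neg_one] with c hc
    rw [Function.comp_apply, h c hc.1 hc.2, zpow_one]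
  · obtain ⟨τ, hτ, hτ'⟩ := ξ'.exists_snd_eq (ξ'.fst_mem_rays hσ')
    refine ⟨τ, hτ, tendsto_nhds_unique h1 ((tendsto_ofChart_corner_fst hτ).congr' ?_)⟩
    filter_upwards [eventually_ne_zero_ne_neg_one] with c hc
    rw [Function.comp_apply, h c hc.1 hc.2, zpow_neg_one,
      ofChart_adjacent hσ' hτ hτ'.symm hc.1 hc.2]

/-- Let c → -1; then also c ^ ε → -1, for either sign. -/
theorem MapsComponent.map_distinguished {f : ξ.Y → ξ'.Y} (hf : Continuous f)
    {σ σ' : (ℤ × ℤ) × (ℤ × ℤ)} {hσ : σ ∈ ξ.cones} {hσ' : σ' ∈ ξ'.cones} {ε : ℤ}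
    (hε : ε = 1 ∨ ε = -1) (h : MapsComponent f hσ hσ' ε) :
    f (ξ.atlas.ofChart (.strict σ hσ) 0) = ξ'.atlas.ofChart (.strict σ' hσ') 0 := by
  have h1 := (hf.tendsto _).comp (tendsto_ofChart_distinguished hσ)
  have h0 : ∀ᶠ c : ℂ in 𝓝[≠] (-1), c ≠ 0 ∧ c ≠ -1 := by
    filter_upwards [self_mem_nhdsWithin,
      nhdsWithin_le_nhds (isOpen_ne.mem_nhds (show (-1 : ℂ) ≠ 0 by norm_num))] with c h1 h2
    exact ⟨h2, h1⟩
  have hpow : Filter.Tendsto (fun c : ℂ => c ^ ε) (𝓝[≠] (-1)) (𝓝[≠] (-1)) := by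
    refine tendsto_nhdsWithin_iff.2 ⟨?_, ?_⟩
    · have : Filter.Tendsto (fun c : ℂ => c) (𝓝[≠] (-1)) (𝓝 (-1)) := nhdsWithin_le_nhds
      convert this.zpow₀ ε (.inl (by norm_num)) using 2
      rcases hε with rfl | rfl <;> norm_num
    · filter_upwards [h0] with c hc using zpow_ne_neg_one hc.2 hε
  refine tendsto_nhds_unique h1 (((tendsto_ofChart_distinguished hσ').comp hpow).congr' ?_)
  filter_upwards [h0] with c hc
  rw [Function.comp_apply, Function.comp_apply, h c hc.1 hc.2]

/-- The points of the boundary away from the corners and the distinguished points. -/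
def openBoundary (ξ : CY2) : Set ξ.Y :=
  {y | ∃ σ, ∃ hσ : σ ∈ ξ.cones, ∃ c : ℂ, c ≠ 0 ∧ c ≠ -1 ∧ ξ.atlas.ofChart (.cone σ hσ) (0, c) = y}

/-- The second axis of a cone is the first axis of the next one, and corners are limits of the first
axis, so test points on first axes suffice. -/
theorem D_eq_closure_openBoundary (ξ : CY2) : ξ.D = closure ξ.openBoundary := by
  refine subset_antisymm (closure_minimal ?_ isClosed_closure) (closure_mono ?_)
  · rintro y ⟨σ, hσ, ⟨a, b⟩, hp, hab, rfl⟩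
    have hd : ((a, b) : ℂ × ℂ) ∈ ξ.atlas.dom (.cone σ hσ) := hp
    change pt (A := ξ.atlas) _ _ hd ∈ _
    rw [← ofChart_eq_pt hd]
    obtain ⟨ha, hb⟩ := mem_chartDom_cone.1 hp
    have hcorner : ξ.atlas.ofChart (.cone σ hσ) 0 ∈ closure ξ.openBoundary := by
      refine mem_closure_of_tendsto (tendsto_ofChart_corner hσ) ?_
      filter_upwards [eventually_ne_zero_ne_neg_one] with c hc
      exact ⟨σ, hσ, c, hc.1, hc.2, rfl⟩
    by_cases ha0 : a = 0
    · subst ha0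
      by_cases hb0 : b = 0
      · subst hb0
        exact hcorner
      · exact subset_closure ⟨σ, hσ, b, hb0, by simpa using ha, rfl⟩
    · obtain rfl : b = 0 := (mul_eq_zero.1 hab).resolve_left ha0
      obtain ⟨τ, hτ, hτσ⟩ := ξ.exists_fst_eq (ξ.snd_mem_rays hσ)
      have ha1 : a ≠ -1 := by simpa using hb
      refine subset_closure ⟨τ, hτ, a⁻¹, inv_ne_zero ha0, ?_, (ofChart_adjacent hτ hσ hτσ ha0 ha1).symm⟩
      rwa [Ne, inv_eq_iff_eq_inv, inv_neg_one]
  · rintro y ⟨σ, hσ, c, hc, hc', rfl⟩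
    exact ⟨σ, hσ, (0, c), mem_dom_cone_boundary hσ hc', by simp, ofChart_eq_pt _⟩

theorem Realizes.mapsTo_D {φ : BirP2} (hφ : TransformsArcs φ) {f : ξ.Y → ξ'.Y}
    (hf : Continuous f) (hinj : Function.Injective f) (h : Realizes φ f) :
    MapsTo f ξ.D ξ'.D := by
  rw [D_eq_closure_openBoundary, D_eq_closure_openBoundary]
  refine MapsTo.closure ?_ hf
  rintro _ ⟨σ, hσ, c, hc, hc', rfl⟩
  obtain ⟨σ', hσ', ε, hε, hm⟩ := h.exists_mapsComponent hφ hf hinj hσ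
  exact ⟨σ', hσ', c ^ ε, zpow_ne_zero _ hc, zpow_ne_neg_one hc' hε, (hm c hc hc').symm⟩

theorem _root_.BirP2.Defines.realizes {φ : BirP2} {f : ξ.Y → ξ'.Y} (h : φ.Defines f) :
    Realizes φ f := by
  intro t ht t' ht' hm _
  have := h ⟨t, ht⟩ ⟨t', ht'⟩ hm
  rwa [emb_eq_ofTorus, emb_eq_ofTorus] at this

/-- Because `Realizes` asks for regularity in both directions, it is symmetric; this lets
`Realizes.mapsTo_D` be applied to the inverse. -/
theorem Realizes.symm {φ : BirP2} {e : ξ.Y ≃ ξ'.Y} (h : Realizes φ e) : Realizes φ⁻¹ e.symm := by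
  intro t ht t' ht' h1 h2
  rw [inv_inv] at h2
  rw [Equiv.symm_apply_eq]
  exact (h t' ht' t ht h2 h1).symm

variable (Φ : Diffeomorph 𝓘(ℂ, ℂ × ℂ) 𝓘(ℂ, ℂ × ℂ) ξ.Y ξ'.Y ω)

theorem apply_mem_D_iff {φ : BirP2} (hφ : φ ∈ BirE) (hΦ : φ.Defines Φ) (y : ξ.Y) :
    Φ y ∈ ξ'.D ↔ y ∈ ξ.D := by
  obtain ⟨h1, h2⟩ := transformsArcs_of_mem_birE hφ
  refine ⟨fun h => ?_, fun h => hΦ.realizes.mapsTo_D h1 Φ.continuous Φ.injective h⟩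
  have := (Realizes.symm (e := Φ.toEquiv) hΦ.realizes).mapsTo_D h2 Φ.symm.continuous
    Φ.symm.injective h
  exact (Φ.symm_apply_apply y) ▸ this

theorem contMDiff_of_subtypeVal_comp {U : TopologicalSpace.Opens ξ.Y}
    {V : TopologicalSpace.Opens ξ'.Y} {f : U → V}
    (h : ContMDiff 𝓘(ℂ, ℂ × ℂ) 𝓘(ℂ, ℂ × ℂ) ω (Subtype.val ∘ f)) :
    ContMDiff 𝓘(ℂ, ℂ × ℂ) 𝓘(ℂ, ℂ × ℂ) ω f :=
  fun x => (ChartedSpace.liftPropWithinAt_subtypeVal_comp_iff ..).1 (h x)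

/-- The restriction of a biholomorphism to the interiors. -/
def diffeomorphU (h : ∀ y, Φ y ∈ ξ'.D ↔ y ∈ ξ.D) :
    Diffeomorph 𝓘(ℂ, ℂ × ℂ) 𝓘(ℂ, ℂ × ℂ) ξ.U ξ'.U ω where
  toFun u := ⟨Φ u, fun hu => u.2 ((h u).1 hu)⟩
  invFun u := ⟨Φ.symm u, fun hu => u.2 (by simpa using (h _).2 hu)⟩
  left_inv u := Subtype.ext (Φ.symm_apply_apply _)
  right_inv u := Subtype.ext (Φ.apply_symm_apply _)
  contMDiff_toFun :=
    contMDiff_of_subtypeVal_comp (Φ.contMDiff.comp contMDiff_subtype_val)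
  contMDiff_invFun :=
    contMDiff_of_subtypeVal_comp (Φ.symm.contMDiff.comp contMDiff_subtype_val)

/-- The restriction of a biholomorphism to the boundaries. -/
def equivD (h : ∀ y, Φ y ∈ ξ'.D ↔ y ∈ ξ.D) : ξ.D ≃ ξ'.D where
  toFun u := ⟨Φ u, (h u).2 u.2⟩
  invFun u := ⟨Φ.symm u, (h _).1 (by simp)⟩
  left_inv u := Subtype.ext (Φ.symm_apply_apply _)
  right_inv u := Subtype.ext (Φ.apply_symm_apply _)

theorem isHolomorphicOnSubsets_of_contMDiff {S : Set ξ.Y} {S' : Set ξ'.Y} {f : S → S'}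
    {F : ξ.Y → ξ'.Y} (hF : ContMDiff 𝓘(ℂ, ℂ × ℂ) 𝓘(ℂ, ℂ × ℂ) ω F) (h : ∀ y : S, F y = f y) :
    IsHolomorphicOnSubsets f :=
  fun _ => ⟨univ, isOpen_univ, trivial, F, hF.contMDiffOn, fun y _ => h y⟩

/-! ### Lifting to blow-ups -/

/-- The conclusion of the lifting theorem for the blow-up `η` of `ξ`, with respect to a relation
between `ξ'` and the surface to be found. -/
def Lifts (φ : BirP2) (r : CY2 → CY2 → Prop) (η : CY2) : Prop :=
  ∃ η' : CY2, r ξ' η' ∧ ∃ Ψ : Diffeomorph 𝓘(ℂ, ℂ × ℂ) 𝓘(ℂ, ℂ × ℂ) η.Y η'.Y ω, φ.Defines Ψ ∧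
    ∃ (p : η.Y → ξ.Y) (p' : η'.Y → ξ'.Y), IsBlowDown p ∧ IsBlowDown p' ∧
      ∀ y : η.Y, p' (Ψ y) = Φ (p y)

variable {Φ}

theorem lifts_of_isBlowUp {φ : BirP2} {r : CY2 → CY2 → Prop} (hΦ : φ.Defines Φ) {η η' : CY2}
    (hr : r ξ' η') {p : η.Y → ξ.Y} {p' : η'.Y → ξ'.Y} {i : ξ.ChartIndex} {i' : ξ'.ChartIndex}
    (h : IsBlowUp ξ.atlas η.atlas p i) (h' : IsBlowUp ξ'.atlas η'.atlas p' i')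
    (hc : Φ (ξ.atlas.ofChart i 0) = ξ'.atlas.ofChart i' 0) : Lifts Φ φ r η := by
  have hd : ∀ {ξ η : CY2} {p : η.Y → ξ.Y} {i : ξ.ChartIndex} (_ : IsBlowUp ξ.atlas η.atlas p i)
      (t : _root_.torus), p (η.emb t) = ξ.emb t := fun h t => by
    rw [emb_eq_ofTorus, emb_eq_ofTorus, h.map_ofTorus t t.2]
  obtain ⟨Ψ, hΨ⟩ := h.exists_diffeomorph h' Φ hc
  refine ⟨η', hr, Ψ, fun t t' hm => ?_, p, p', ⟨h.contMDiff, hd h⟩, ⟨h'.contMDiff, hd h'⟩, hΨ⟩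
  -- That φ defines Ψ: the two points to be compared have the same image under `p'`, and it is not
  -- the centre, so they coincide.
  obtain ⟨q, -, -, hq⟩ := h'.exists_inverse
  have hne : ξ'.emb t' ≠ ξ'.atlas.ofChart i' 0 := by
    rw [emb_eq_ofTorus]; exact h'.ofTorus_ne t' t'.2
  have h1 : p' (Ψ (η.emb t)) = ξ'.emb t' := by rw [hΨ, hd h, hΦ t t' hm]
  rw [← hq (Ψ (η.emb t)) (by rwa [h1]), ← hq (η'.emb t') (by rwa [hd h']), h1, hd h']

/-- The interior blow-up of the distinguished point on the component of the first ray of `σ`. -/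
def interiorBlowUp (ξ : CY2) {σ : (ℤ × ℤ) × (ℤ × ℤ)} (hσ : σ ∈ ξ.cones) : CY2 where
  toSmoothCompleteFan := ξ.toSmoothCompleteFan
  m := Function.update ξ.m σ.1 (ξ.m σ.1 + 1)
  m_eq_zero n hn := by
    rw [Function.update_of_ne, ξ.m_eq_zero n hn]
    rintro rfl
    exact hn (ξ.fst_mem_rays hσ)

/-- The blow-up of the corner of `σ`. -/
def cornerBlowUp (ξ : CY2) {σ : (ℤ × ℤ) × (ℤ × ℤ)} (hσ : σ ∈ ξ.cones) : CY2 where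
  toSmoothCompleteFan := ξ.starSubdivision σ hσ
  m := ξ.m
  m_eq_zero n hn := by
    refine ξ.m_eq_zero n fun h => hn ?_
    obtain ⟨τ, hτ, rfl⟩ := ξ.exists_fst_eq h
    by_cases hτσ : τ = σ
    · subst hτσ
      exact SmoothCompleteFan.fst_mem_rays (σ := (τ.1, τ.1 + τ.2)) (Finset.mem_insert_self _ _)
    · exact SmoothCompleteFan.fst_mem_rays (σ := τ) (Finset.mem_insert_of_mem
        (Finset.mem_insert_of_mem (Finset.mem_erase.2 ⟨hτσ, hτ⟩)))

/-- The step on ξ' is taken at the image of the centre, which is again the next centre on a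
component or a corner. -/
theorem lifts_blowUpStep {φ : BirP2} (hφ : φ ∈ BirE) (hΦ : φ.Defines Φ) {η : CY2}
    (h : ξ.BlowUpStep η) : Lifts Φ φ BlowUpStep η := by
  have hcomp := fun {σ} (hσ : σ ∈ ξ.cones) => hΦ.realizes.exists_mapsComponent
    (transformsArcs_of_mem_birE hφ).1 Φ.continuous Φ.injective hσ
  rcases h with ⟨n, hn, hcones, hm⟩ | ⟨σ, hσ, hcones, hm⟩
  · obtain ⟨σ, hσ, rfl⟩ := ξ.exists_fst_eq hn
    obtain ⟨σ', hσ', ε, hε, hs⟩ := hcomp hσ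
    obtain ⟨p, hp⟩ := exists_isBlowUp_interior hσ hcones hm
    obtain ⟨p', hp'⟩ := exists_isBlowUp_interior (η := ξ'.interiorBlowUp hσ') hσ' rfl rfl
    exact lifts_of_isBlowUp (η' := ξ'.interiorBlowUp hσ') hΦ (.interior σ'.1 (ξ'.fst_mem_rays hσ') rfl rfl) hp
      hp' (hs.map_distinguished Φ.continuous hε)
  · obtain ⟨σ', hσ', ε, hε, hs⟩ := hcomp hσ
    obtain ⟨τ, hτ, hc⟩ := hs.map_corner Φ.continuous hε
    obtain ⟨p, hp⟩ := exists_isBlowUp_corner hσ hcones hm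
    obtain ⟨p', hp'⟩ := exists_isBlowUp_corner (η := ξ'.cornerBlowUp hτ) hτ rfl rfl
    exact lifts_of_isBlowUp (η' := ξ'.cornerBlowUp hτ) hΦ (.corner τ hτ rfl rfl) hp hp' hc

/-- The lift to one blow-up is again defined by the same φ, so it can take the place of Φ in the
next step. -/
theorem lifts_of_lt {φ : BirP2} (hφ : φ ∈ BirE) (hΦ : φ.Defines Φ) {η : CY2}
    (h : Relation.TransGen BlowUpStep ξ η) : Lifts Φ φ (Relation.TransGen BlowUpStep) η := by
  induction h with
  | single h =>
    obtain ⟨η', hr, h⟩ := lifts_blowUpStep hφ hΦ h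
    exact ⟨η', .single hr, h⟩
  | tail _ h ih =>
    obtain ⟨ζ', hr, Θ, hΘ, p, p', hp, hp', hc⟩ := ih
    obtain ⟨η', hr', Ψ, hΨ, q, q', hq, hq', hc'⟩ := lifts_blowUpStep hφ hΘ h
    refine ⟨η', hr.tail hr', Ψ, hΨ, p ∘ q, p' ∘ q', ⟨hp.1.comp hq.1, fun t => ?_⟩,
      ⟨hp'.1.comp hq'.1, fun t => ?_⟩, fun y => ?_⟩
    · rw [Function.comp_apply, hq.2, hp.2]
    · rw [Function.comp_apply, hq'.2, hp'.2]
    · rw [Function.comp_apply, Function.comp_apply, hc', hc]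

end CY2

/-! ### The proposition. -/

theorem mainTheorem10 (φ : BirP2) (hφ : φ ∈ BirE) (ξ ξ' : CY2)
    (Φ : Diffeomorph 𝓘(ℂ, ℂ × ℂ) 𝓘(ℂ, ℂ × ℂ) ξ.Y ξ'.Y ω) (hΦ : φ.Defines Φ) :
    (∃ f : Diffeomorph 𝓘(ℂ, ℂ × ℂ) 𝓘(ℂ, ℂ × ℂ) ξ.U ξ'.U ω,
      ∀ u : ξ.U, (f u : ξ'.Y) = Φ u) ∧
    (∃ g : ξ.D ≃ ξ'.D, (∀ d : ξ.D, (g d : ξ'.Y) = Φ d) ∧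
      IsHolomorphicOnSubsets g ∧ IsHolomorphicOnSubsets g.symm) ∧
    ∀ η : CY2, ξ < η → ∃ η' : CY2, ξ' < η' ∧
      ∃ Ψ : Diffeomorph 𝓘(ℂ, ℂ × ℂ) 𝓘(ℂ, ℂ × ℂ) η.Y η'.Y ω, φ.Defines Ψ ∧
        ∃ (p : η.Y → ξ.Y) (p' : η'.Y → ξ'.Y), CY2.IsBlowDown p ∧ CY2.IsBlowDown p' ∧
          ∀ y : η.Y, p' (Ψ y) = Φ (p y) := by
  have hD := CY2.apply_mem_D_iff Φ hφ hΦ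
  exact ⟨⟨CY2.diffeomorphU Φ hD, fun _ => rfl⟩,
    ⟨CY2.equivD Φ hD, fun _ => rfl,
      CY2.isHolomorphicOnSubsets_of_contMDiff Φ.contMDiff fun _ => rfl,
      CY2.isHolomorphicOnSubsets_of_contMDiff Φ.symm.contMDiff fun _ => rfl⟩,
    fun η hη => CY2.lifts_of_lt hφ hΦ hη⟩

end
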